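/- **Setting.** Let $A\in\mathbb Z^{m\times n}$ ($m\ge 1$) have full row rank, $b\in\mathbb Z^m$, $c\in\mathbb Z^n$. Consider $\min\{c^Tx: Ax=b,\ x\ge 0\}$ and its dual $\max\{b^Ty: A^Ty+s=c,\ s\ge 0\}$. Let $$L=mn+m+n+\sum_{i,j}\lceil\log_2(|a_{ij}|+1)\rceil+\sum_j\lceil\log_2(|c_j|+1)\rceil+\sum_i\lceil\log_2(|b_i|+1)\rceil ,$$ $$\mathcal{PD}^*=\{(x,y,s): Ax=b,\ A^Ty+s=c,\ x^Ts=0,\ x,s\ge0\},$$ and let $\mathcal B$ (resp. $\mathcal N$) be the set of $j$ with $x^*_j>0$ (resp. $s^*_j>0$) for some $(x^*,y^*,s^*)\in\mathcal{PD}^*$. For $s>0$, $\mu>0$, with $S=\mathrm{diag}(s)$ and $e$ the all-ones vector, put $$\Delta s(s,\mu)=-A^T(AS^{-2}A^T)^{-1}\tfrac1\mu\,(b-\mu AS^{-1}e),\quad \delta(s,\mu)=\|S^{-1}\Delta s(s,\mu)\|_2,\quad x(s,\mu)=\mu S^{-1}\bigl(e-S^{-1}\Delta s(s,\mu)\bigr).$$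 **Algorithm (almost-exact dual log-barrier short-step method).** Start from $(y^0,s^0)$ with $A^Ty^0+s^0=c$, $s^0>0$, and $\mu^0>0$ with $\delta(s^0,\mu^0)<\frac12$; let $\theta=\eta/\sqrt n$ with $0<\eta\le\frac18$. While $\mu^k>2^{-2L}$: solve, with precision $2^{-tL}$, the system $$\begin{bmatrix}S_k^2&A^T\\A&0\end{bmatrix}\begin{bmatrix}\hat{\Delta s}\\ \Delta y\end{bmatrix}=\begin{bmatrix}0\\-\frac1{\mu^k}(b-\mu^kAS_k^{-1}e)\end{bmatrix},\qquad S_k=\mathrm{diag}(s^k);$$ set $y^{k+1}=y^k+\Delta y$, $s^{k+1}=s^k+S_k^2\hat{\Delta s}$, $\mu^{k+1}=(1-\theta)\mu^k$. "With precision $\varepsilon$" means that the computed vector either has residual of Euclidean norm at most $\varepsilon$ or lies within Euclidean distance $\varepsilon$ of an exact solution (in each iteration either may occur; the errors are otherwise arbitrary). Put $r^k=A^Ty^k+s^k-c$. **Theorem.** For all real $\kappa$ and $0<\eta\le\frac18$ there are constants $t_0,C$ depending only on $\kappa,\eta$, with $t_0<10$ if $\kappa\le1$ and $\eta\ge\frac1{16}$,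 such that for all data and starting points as above with $\mu^0\le2^{\kappa L}$, all $t\ge t_0$, and all runs with precision $2^{-tL}$: 1. The algorithm stops after $K\le C\sqrt n\,L$ iterations. 2. For every $k\le K$, $(y^k,s^k)$ is strictly dual feasible for the perturbed problem $(A,b,c+r^k)$, $\delta(s^k,\mu^k)<\frac12$, and $\|r^k\|_2\le C2^{-4L}$; if all systems are solved with residual at most $2^{-tL}$, then $\|r^k\|_2\le C2^{(1-t)L}$ for all $k\le K$. 3. The run is a strictly feasible run with almost exact Newton steps for the single perturbed problem $(A,b,c+r^K)$: there are $\tilde s^0,\dots,\tilde s^K>0$ with $\tilde s^K=s^K$, and $A^Ty^k+\tilde s^k=c+r^K$ and $\delta(\tilde s^k,\mu^k)<1$ for all $k\le K$, such that, with $\tilde S_k=\mathrm{diag}(\tilde s^k)$, $\|\tilde S_k^{-1}(\tilde s^{k+1}-\tilde s^k-\Delta s(\tilde s^k,\mu^k))\|_2\le C2^{-L}$ for all $k<K$. 4. $\tilde x=x(s^K,\mu^K)$ satisfies $A\tilde x=b$, $\tilde x>0$ and $\tilde x^Ts^K\le 2n\,2^{-2L}$. 5. (Rounding) For every $j$: $s^K_j<2^{-L}$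 if and only if $j\in\mathcal B$, and $\tilde x_j<2^{-L}$ if and only if $j\in\mathcal N$. The equality-constrained least squares problem of minimizing $\|x-\tilde x\|_2^2+\|s-s^K\|_2^2$ over all $(x,y,s)$ with $Ax=b$, $A^Ty+s=c$, $s_j=0$ whenever $s^K_j<2^{-L}$, and $x_j=0$ whenever $s^K_j\ge2^{-L}$, has exactly one solution, and this solution lies in $\mathcal{PD}^*$, i.e. it is optimal for the original problem. -/

import Mathlib

open scoped Matrix

noncomputable section

/-- The Euclidean norm of a real vector. -/
def l2norm {ι : Type*} [Fintype ι] (v : ι → ℝ) : ℝ := ‖WithLp.toLp 2 v‖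

/-! ### Linear optimization in standard form, real data -/

/-- `x` is feasible for `min cᵀx, A x = b, x ≥ 0`, with all coordinates positive. -/
def StrictPrimalFeasible {m n : ℕ} (A : Matrix (Fin m) (Fin n) ℝ) (b : Fin m → ℝ)
    (x : Fin n → ℝ) : Prop :=
  A *ᵥ x = b ∧ ∀ j, 0 < x j

/-- `(y, s)` is feasible for `max bᵀy, Aᵀy + s = c, s ≥ 0`, with all slacks positive. -/
def StrictDualFeasible {m n : ℕ} (A : Matrix (Fin m) (Fin n) ℝ) (c : Fin n → ℝ)
    (y : Fin m → ℝ) (s : Fin n → ℝ) : Prop :=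
  Aᵀ *ᵥ y + s = c ∧ ∀ j, 0 < s j

/-- The set `PD*` of primal-dual optimal solutions `(x, y, s)`. -/
def optimalSet {m n : ℕ} (A : Matrix (Fin m) (Fin n) ℝ) (b : Fin m → ℝ) (c : Fin n → ℝ) :
    Set ((Fin n → ℝ) × (Fin m → ℝ) × (Fin n → ℝ)) :=
  {w | A *ᵥ w.1 = b ∧ Aᵀ *ᵥ w.2.1 + w.2.2 = c ∧ w.1 ⬝ᵥ w.2.2 = 0 ∧
    (∀ j, 0 ≤ w.1 j) ∧ ∀ j, 0 ≤ w.2.2 j}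

/-- The part `B` of the optimal partition. -/
def partB {m n : ℕ} (A : Matrix (Fin m) (Fin n) ℝ) (b : Fin m → ℝ) (c : Fin n → ℝ) :
    Set (Fin n) :=
  {j | ∃ w ∈ optimalSet A b c, 0 < w.1 j}

/-- The part `N` of the optimal partition. -/
def partN {m n : ℕ} (A : Matrix (Fin m) (Fin n) ℝ) (b : Fin m → ℝ) (c : Fin n → ℝ) :
    Set (Fin n) :=
  {j | ∃ w ∈ optimalSet A b c, 0 < w.2.2 j}

/-! ### Newton steps of the dual logarithmic barrier method -/

/-- The matrix `[S², Aᵀ; A, 0]` of the Newton system. -/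
def newtonMatrix {m n : ℕ} (A : Matrix (Fin m) (Fin n) ℝ) (s : Fin n → ℝ) :
    Matrix (Fin n ⊕ Fin m) (Fin n ⊕ Fin m) ℝ :=
  Matrix.fromBlocks (Matrix.diagonal fun j => s j ^ 2) Aᵀ A 0

/-- The right-hand side `(0, -(1/μ)(b - μ A S⁻¹ e))` of the Newton system. -/
def newtonRhs {m n : ℕ} (A : Matrix (Fin m) (Fin n) ℝ) (b : Fin m → ℝ) (s : Fin n → ℝ)
    (μ : ℝ) : Fin n ⊕ Fin m → ℝ :=
  Sum.elim 0 (-(μ⁻¹ • (b - μ • (A *ᵥ fun j => (s j)⁻¹))))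

/-- The exact Newton direction `Δs = -Aᵀ (A S⁻² Aᵀ)⁻¹ (1/μ)(b - μ A S⁻¹ e)`. -/
def newtonDs {m n : ℕ} (A : Matrix (Fin m) (Fin n) ℝ) (b : Fin m → ℝ) (s : Fin n → ℝ)
    (μ : ℝ) : Fin n → ℝ :=
  -(Aᵀ *ᵥ ((A * Matrix.diagonal (fun j => (s j ^ 2)⁻¹) * Aᵀ)⁻¹ *ᵥ
    (μ⁻¹ • (b - μ • (A *ᵥ fun j => (s j)⁻¹)))))

/-- The proximity measure `δ = ‖S⁻¹ Δs‖`. -/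
def proximity {m n : ℕ} (A : Matrix (Fin m) (Fin n) ℝ) (b : Fin m → ℝ) (s : Fin n → ℝ)
    (μ : ℝ) : ℝ :=
  l2norm fun j => newtonDs A b s μ j / s j

/-- The primal point `x(s, μ) = μ S⁻¹ (e - S⁻¹ Δs)` that belongs to `s` and `μ`. -/
def primalPoint {m n : ℕ} (A : Matrix (Fin m) (Fin n) ℝ) (b : Fin m → ℝ) (s : Fin n → ℝ)
    (μ : ℝ) : Fin n → ℝ :=
  fun j => μ * (s j)⁻¹ * (1 - newtonDs A b s μ j / s j)

/-- `z` solves the Newton system with residual at most `ε`. -/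
def ResidualPrecise {m n : ℕ} (A : Matrix (Fin m) (Fin n) ℝ) (b : Fin m → ℝ)
    (s : Fin n → ℝ) (μ ε : ℝ) (z : Fin n ⊕ Fin m → ℝ) : Prop :=
  l2norm (newtonMatrix A s *ᵥ z - newtonRhs A b s μ) ≤ ε

/-- `z` is within distance `ε` of a solution of the Newton system. -/
def ForwardPrecise {m n : ℕ} (A : Matrix (Fin m) (Fin n) ℝ) (b : Fin m → ℝ)
    (s : Fin n → ℝ) (μ ε : ℝ) (z : Fin n ⊕ Fin m → ℝ) : Prop :=
  ∃ z', newtonMatrix A s *ᵥ z' = newtonRhs A b s μ ∧ l2norm (z - z') ≤ ε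

/-! ### Integer data -/

/-- Integer data of a linear optimization problem in standard form. -/
structure IntLO (m n : ℕ) where
  A : Matrix (Fin m) (Fin n) ℤ
  b : Fin m → ℤ
  c : Fin n → ℤ

namespace IntLO

variable {m n : ℕ} (P : IntLO m n)

def realA : Matrix (Fin m) (Fin n) ℝ := P.A.map fun a => (a : ℝ)

def realb : Fin m → ℝ := fun i => (P.b i : ℝ)

def realc : Fin n → ℝ := fun j => (P.c j : ℝ)

/-- The binary length `L` of the data; `Nat.clog 2 k` is `⌈log₂ k⌉`. -/
def L : ℕ :=
  m * n + m + n + (∑ i, ∑ j, Nat.clog 2 ((P.A i j).natAbs + 1))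
    + (∑ j, Nat.clog 2 ((P.c j).natAbs + 1)) + ∑ i, Nat.clog 2 ((P.b i).natAbs + 1)

/-- The tolerance `2 ^ (-2L)` at which the loop stops. -/
def stopTol : ℝ := (2 : ℝ) ^ (-2 * (P.L : ℝ))

/-- The rounding threshold `2 ^ (-L)`. -/
def roundTol : ℝ := (2 : ℝ) ^ (-(P.L : ℝ))

/-- Feasible points of the least squares problem of the rounding procedure: the slacks
below the threshold are set to zero, and so is `x j` for every other index `j`. Apart
from these the constraints are the linear equations; no sign is imposed. -/
def roundingConstraints (s : Fin n → ℝ) :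
    Set ((Fin n → ℝ) × (Fin m → ℝ) × (Fin n → ℝ)) :=
  {w | P.realA *ᵥ w.1 = P.realb ∧ P.realAᵀ *ᵥ w.2.1 + w.2.2 = P.realc ∧
    (∀ j, s j < P.roundTol → w.2.2 j = 0) ∧ ∀ j, P.roundTol ≤ s j → w.1 j = 0}

/-- `w` is the result of rounding the pair `(x, s)`: the point of the constraint set
nearest to it. -/
def IsRounding (x s : Fin n → ℝ) (w : (Fin n → ℝ) × (Fin m → ℝ) × (Fin n → ℝ)) : Prop :=
  IsMinOn (fun w : (Fin n → ℝ) × (Fin m → ℝ) × (Fin n → ℝ) =>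
      l2norm (w.1 - x) ^ 2 + l2norm (w.2.2 - s) ^ 2) (P.roundingConstraints s) w ∧
    w ∈ P.roundingConstraints s

end IntLO

/-! ### The almost-exact method -/

/-- The iterates `(yᵏ, sᵏ)`, where `z k = (Δŝᵏ, Δyᵏ)` is the answer of the linear
system solver in iteration `k`: `yᵏ⁺¹ = yᵏ + Δyᵏ` and `sᵏ⁺¹ = sᵏ + (Sᵏ)² Δŝᵏ`. -/
def iterates {m n : ℕ} (y₀ : Fin m → ℝ) (s₀ : Fin n → ℝ) (z : ℕ → Fin n ⊕ Fin m → ℝ) :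
    ℕ → (Fin m → ℝ) × (Fin n → ℝ)
  | 0 => (y₀, s₀)
  | k + 1 =>
    let p := iterates y₀ s₀ z k
    (fun i => p.1 i + z k (Sum.inr i), fun j => p.2 j + p.2 j ^ 2 * z k (Sum.inl j))

/-- The barrier parameters `μᵏ = (1 - θ)ᵏ μ⁰`. -/
def barrier (μ₀ θ : ℝ) (k : ℕ) : ℝ := (1 - θ) ^ k * μ₀

/-- `rᵏ = Aᵀyᵏ + sᵏ - c`, the perturbation of `c` accumulated after `k` steps. -/
def perturbation {m n : ℕ} (A : Matrix (Fin m) (Fin n) ℝ) (c : Fin n → ℝ)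
    (p : (Fin m → ℝ) × (Fin n → ℝ)) : Fin n → ℝ :=
  Aᵀ *ᵥ p.1 + p.2 - c

end

/-! ### Euclidean norm estimates -/

section EuclideanNorm

variable {ι : Type*} [Fintype ι]

/-! One orthogonality drives the whole proof: differences of solutions of `A x = b` lie in the
kernel of `A`, differences of slacks for the same objective lie in the range of `Aᵀ`. After scaling
by `s` it makes `δ(s, μ)` the distance from `e` to the vectors `s x / μ` with `A x = b`
(`proximity_le`). With `d = S⁻¹ Δs`, testing the new slack `s (1 + d + e')` against the old point
`x(s, μ)`, for which `s x / μ = 1 - d`, leaves only `(1 - d) e' - d² + θ`. So Newton's method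
converges quadratically, and `δ < 1/2` survives the update of `μ` as long as the relative error `e'`
is small (`proximity_step_le`).

The real work is to turn the absolute precision `2^(-tL)` into a small relative error. Near the
central path of a slightly perturbed problem all `x j` and `s j` are at most `Γ = 2^L g / 4`, where
`g = 2^(max(κ,1) L)` (`primalPoint_le_and_slack_le`); since `s j x j ≥ μ / 2`, also `s j ≥ μ /
(2Γ)`. These bounds come from pairing with basic solutions of integer systems, whose entries are
quotients of minors (`exists_basic_solution`). Minors are bounded by products of row sums, and these
fit into `2^L` with a factor `8 n²` to spare (`sq_mul_bounds_le`). The error of an inexact step is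
then controlled by `newton_step_error`, and an induction (`run_invariants`) keeps all iterates
central while `r` grows by at most `ε (Γ² + 2^L / 8)` per step, over `O(√n L)` steps.

For the single perturbed problem, `s k` is shifted by `r K - r k`. This is tiny relative to `s k`,
and the Newton direction depends on the slack in a Lipschitz way (`l2norm_newtonDs_sub_le`).

For the rounding, a strictly complementary solution exists because the iterates of the exact method
have a limit point (`exists_strictly_complementary`). If `j ∈ B`, some basic optimal solution has
`j`-th entry at least `1 / d` with `d` a bounded minor, so `s j ≤ (8/5) d n μ` (`gap_bound`), and
centrality forces `x j ≥ 5 / (16 n d)`; on `N` the roles are exchanged. For `μ ≤ 2^(-2L)` the two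
bounds lie on different sides of `2^(-L)`. The projection moves the large entries no more than an
explicit feasible correction does, and Cramer's rule bounds that correction with the same
denominator `d`; hence large entries stay positive (`rounding_spec`). -/

theorem l2norm_sq (v : ι → ℝ) : l2norm v ^ 2 = ∑ i, v i ^ 2 := by
  simp [l2norm, EuclideanSpace.norm_sq_eq]

theorem l2norm_nonneg (v : ι → ℝ) : 0 ≤ l2norm v := norm_nonneg _

theorem l2norm_zero : l2norm (0 : ι → ℝ) = 0 := by simp [l2norm]

theorem l2norm_add_le (v w : ι → ℝ) : l2norm (v + w) ≤ l2norm v + l2norm w := by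
  simpa [l2norm] using norm_add_le (WithLp.toLp 2 v) (WithLp.toLp 2 w)

theorem l2norm_neg (v : ι → ℝ) : l2norm (-v) = l2norm v := by
  simp [l2norm]

theorem l2norm_sub_le (v w : ι → ℝ) : l2norm (v - w) ≤ l2norm v + l2norm w := by
  simpa [l2norm] using norm_sub_le (WithLp.toLp 2 v) (WithLp.toLp 2 w)

theorem l2norm_smul (a : ℝ) (v : ι → ℝ) : l2norm (a • v) = |a| * l2norm v := by
  simp [l2norm, norm_smul]

theorem l2norm_le_of_sq_le {v : ι → ℝ} {a : ℝ} (ha : 0 ≤ a) (h : ∑ i, v i ^ 2 ≤ a ^ 2) :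
    l2norm v ≤ a := by
  rw [← l2norm_sq] at h
  exact abs_le_of_sq_le_sq' h ha |>.2

theorem l2norm_mono {v w : ι → ℝ} (h : ∀ i, |v i| ≤ |w i|) : l2norm v ≤ l2norm w := by
  refine l2norm_le_of_sq_le (l2norm_nonneg w) ?_
  rw [l2norm_sq]
  exact Finset.sum_le_sum fun i _ => sq_le_sq.2 (h i)

theorem abs_le_l2norm (v : ι → ℝ) (i : ι) : |v i| ≤ l2norm v := by
  refine abs_le_of_sq_le_sq ?_ (l2norm_nonneg v)
  rw [l2norm_sq]
  exact Finset.single_le_sum (f := fun i => v i ^ 2) (fun i _ => sq_nonneg _) (Finset.mem_univ i)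

theorem l2norm_le_sum_abs (v : ι → ℝ) : l2norm v ≤ ∑ i, |v i| := by
  refine l2norm_le_of_sq_le (Finset.sum_nonneg fun i _ => abs_nonneg _) ?_
  calc ∑ i, v i ^ 2 = ∑ i, |v i| ^ 2 := by simp
    _ ≤ (∑ i, |v i|) ^ 2 := Finset.sum_sq_le_sq_sum_of_nonneg fun i _ => abs_nonneg _

theorem l2norm_mul_le {a v : ι → ℝ} {c : ℝ} (h : ∀ i, |a i| ≤ c) :
    l2norm (fun i => a i * v i) ≤ c * l2norm v := by
  -- Over an empty index type `h` does not force `0 ≤ c`, but both norms vanish.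
  rcases isEmpty_or_nonempty ι with hι | ⟨⟨i₀⟩⟩
  · have h0 : ∀ v : ι → ℝ, l2norm v = 0 := fun v => by
      rw [Subsingleton.elim v 0, l2norm_zero]
    simp [h0]
  · have hc : 0 ≤ c := (abs_nonneg _).trans (h i₀)
    rw [← abs_of_nonneg hc, ← l2norm_smul]
    refine l2norm_mono fun i => ?_
    rw [Pi.smul_apply, smul_eq_mul, abs_mul, abs_mul, abs_of_nonneg hc]
    exact mul_le_mul_of_nonneg_right (h i) (abs_nonneg _)

theorem l2norm_sq_apply_le (v : ι → ℝ) : l2norm (fun i => v i ^ 2) ≤ l2norm v ^ 2 := by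
  have h := l2norm_mul_le (a := v) (v := v) (abs_le_l2norm v)
  simpa [sq] using h

theorem l2norm_const (c : ℝ) : l2norm (fun _ : ι => c) = |c| * √(Fintype.card ι) := by
  rw [← abs_of_nonneg (l2norm_nonneg _), ← Real.sqrt_sq_eq_abs, l2norm_sq]
  simp [Real.sqrt_sq_eq_abs, mul_comm]

/-- Orthogonal vectors: a leg is not longer than the hypotenuse. -/
theorem l2norm_le_of_dotProduct_add_eq_zero {d v : ι → ℝ} (h : d ⬝ᵥ (v + d) = 0) :
    l2norm d ≤ l2norm v := by
  refine l2norm_le_of_sq_le (l2norm_nonneg v) ?_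
  rw [l2norm_sq]
  have h' : ∑ i, v i ^ 2 = ∑ i, (v + d) i ^ 2 - 2 * (d ⬝ᵥ (v + d)) + ∑ i, d i ^ 2 := by
    simp only [dotProduct, Finset.mul_sum, ← Finset.sum_sub_distrib, ← Finset.sum_add_distrib]
    refine Finset.sum_congr rfl fun i _ => ?_
    simp only [Pi.add_apply]; ring
  rw [h', h]
  have : 0 ≤ ∑ i, (v + d) i ^ 2 := Finset.sum_nonneg fun i _ => sq_nonneg _
  linarith

/-- A point on the sphere with diameter `p q` has norm at most `‖p‖ + ‖q‖`. -/
theorem l2norm_le_of_dotProduct_sub_sub_eq_zero {e p q : ι → ℝ} (h : (e - p) ⬝ᵥ (e - q) = 0) :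
    l2norm e ≤ l2norm p + l2norm q := by
  have h3 : l2norm ((2 : ℝ) • e - (p + q)) = l2norm (p - q) := by
    have : ∀ a b : ι → ℝ, l2norm a ^ 2 = l2norm b ^ 2 → l2norm a = l2norm b := fun a b hab =>
      (sq_eq_sq₀ (l2norm_nonneg a) (l2norm_nonneg b)).1 hab
    apply this
    rw [l2norm_sq, l2norm_sq]
    have h' : ∑ i, ((2 : ℝ) • e - (p + q)) i ^ 2 =
        4 * ((e - p) ⬝ᵥ (e - q)) + ∑ i, (p - q) i ^ 2 := by
      simp only [dotProduct, Finset.mul_sum, ← Finset.sum_add_distrib]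
      refine Finset.sum_congr rfl fun i _ => ?_
      simp only [Pi.add_apply, Pi.sub_apply, Pi.smul_apply, smul_eq_mul]; ring
    rw [h', h]; ring
  have h4 : 2 * l2norm e ≤ 2 * (l2norm p + l2norm q) := by
    calc 2 * l2norm e = l2norm ((2 : ℝ) • e) := by rw [l2norm_smul]; norm_num
      _ = l2norm (((2 : ℝ) • e - (p + q)) + (p + q)) := by rw [sub_add_cancel]
      _ ≤ _ := l2norm_add_le _ _
      _ ≤ l2norm (p - q) + l2norm (p + q) := by rw [h3]
      _ ≤ (l2norm p + l2norm q) + (l2norm p + l2norm q) :=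
        add_le_add (l2norm_sub_le _ _) (l2norm_add_le _ _)
      _ = _ := by ring
  linarith

end EuclideanNorm

/-! ### Exact Newton steps and the proximity measure -/

section Newton

variable {m n : ℕ} {A : Matrix (Fin m) (Fin n) ℝ} {b : Fin m → ℝ} {s : Fin n → ℝ} {μ : ℝ}

theorem Matrix.transpose_mulVec_eq_zero_of_rank (hA : A.rank = m) {w : Fin m → ℝ}
    (hw : Aᵀ *ᵥ w = 0) : w = 0 := by
  have h : LinearIndependent ℝ A.row := by
    rw [linearIndependent_iff_card_eq_finrank_span, Set.finrank, ← Matrix.rank_eq_finrank_span_row,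
      hA, Fintype.card_fin]
  have := Matrix.vecMul_injective_iff.2 h
  apply this
  simpa [Matrix.mulVec_transpose] using hw

theorem Matrix.exists_mulVec_eq_of_rank (hA : A.rank = m) (v : Fin m → ℝ) : ∃ u, A *ᵥ u = v := by
  have h : LinearMap.range A.mulVecLin = ⊤ := by
    apply Submodule.eq_top_of_finrank_eq
    rw [Module.finrank_fin_fun]
    exact hA
  have : v ∈ LinearMap.range A.mulVecLin := by rw [h]; trivial
  simpa using this

theorem transpose_mulVec_dotProduct (w : Fin m → ℝ) (x : Fin n → ℝ) :
    (Aᵀ *ᵥ w) ⬝ᵥ x = w ⬝ᵥ (A *ᵥ x) := by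
  rw [Matrix.mulVec_transpose, Matrix.dotProduct_mulVec]

/-- A kernel vector `w` has `‖S⁻¹ Aᵀ w‖² = 0`, so `Aᵀ w = 0`, and full row rank gives `w = 0`. -/
theorem normalMatrix_isUnit_det (hA : A.rank = m) (hs : ∀ j, 0 < s j) :
    IsUnit (A * Matrix.diagonal (fun j => (s j ^ 2)⁻¹) * Aᵀ).det := by
  rw [isUnit_iff_ne_zero]
  intro h
  obtain ⟨w, hw0, hw⟩ := Matrix.exists_mulVec_eq_zero_iff.2 h
  apply hw0
  apply Matrix.transpose_mulVec_eq_zero_of_rank hA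
  have h1 : w ⬝ᵥ ((A * Matrix.diagonal (fun j => (s j ^ 2)⁻¹) * Aᵀ) *ᵥ w) = 0 := by simp [hw]
  rw [← Matrix.mulVec_mulVec, ← Matrix.mulVec_mulVec, ← transpose_mulVec_dotProduct] at h1
  have h2 : ∀ j ∈ Finset.univ, (Aᵀ *ᵥ w) j * ((s j ^ 2)⁻¹ * (Aᵀ *ᵥ w) j) = 0 := by
    rw [← Finset.sum_eq_zero_iff_of_nonneg]
    · simpa [dotProduct, Matrix.mulVec_diagonal] using h1
    · intro j _
      have := hs j
      have h3 : (Aᵀ *ᵥ w) j * ((s j ^ 2)⁻¹ * (Aᵀ *ᵥ w) j) = (s j ^ 2)⁻¹ * (Aᵀ *ᵥ w) j ^ 2 := by ring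
      rw [h3]; positivity
  funext j
  have h3 := h2 j (Finset.mem_univ j)
  have := (hs j).ne'
  simpa [this] using h3

theorem newtonDs_mem_range (A : Matrix (Fin m) (Fin n) ℝ) (b : Fin m → ℝ) (s : Fin n → ℝ) (μ : ℝ) :
    ∃ w, newtonDs A b s μ = Aᵀ *ᵥ w :=
  ⟨_, by rw [newtonDs, ← Matrix.mulVec_neg]⟩

/-- By the normal equations the Newton term of `x(s, μ)` contributes exactly `b - μ A S⁻¹ e`. No
closeness to the central path is needed; only positivity of `x(s, μ)` depends on that. -/
theorem mulVec_primalPoint (hA : A.rank = m) (hs : ∀ j, 0 < s j) (hμ : 0 < μ) :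
    A *ᵥ primalPoint A b s μ = b := by
  have h1 : primalPoint A b s μ = μ • (fun j => (s j)⁻¹) -
      μ • (Matrix.diagonal (fun j => (s j ^ 2)⁻¹) *ᵥ newtonDs A b s μ) := by
    funext j
    have := (hs j).ne'
    simp only [primalPoint, Pi.sub_apply, Pi.smul_apply, smul_eq_mul, Matrix.mulVec_diagonal]
    field_simp
  have h2 : A *ᵥ (Matrix.diagonal (fun j => (s j ^ 2)⁻¹) *ᵥ newtonDs A b s μ) =
      -(μ⁻¹ • (b - μ • (A *ᵥ fun j => (s j)⁻¹))) := by
    rw [newtonDs, Matrix.mulVec_neg, Matrix.mulVec_neg, Matrix.mulVec_mulVec, Matrix.mulVec_mulVec,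
      Matrix.mulVec_mulVec, Matrix.mul_nonsing_inv _ (normalMatrix_isUnit_det hA hs),
      Matrix.one_mulVec]
  rw [h1, Matrix.mulVec_sub, Matrix.mulVec_smul, Matrix.mulVec_smul, h2, smul_neg, smul_smul,
    mul_inv_cancel₀ hμ.ne', one_smul]
  abel

/-- The proximity measure is the distance of `e` to the scaled primal affine space. -/
theorem proximity_le (hA : A.rank = m) (hs : ∀ j, 0 < s j) (hμ : 0 < μ) {x : Fin n → ℝ}
    (hx : A *ᵥ x = b) : proximity A b s μ ≤ l2norm fun j => s j * x j / μ - 1 := by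
  -- With `d = S⁻¹ Δs`, the sum `(s x / μ - 1) + d` equals `s (x - x(s, μ)) / μ`, a scaled kernel
  -- vector, while `d` is a scaled range vector: `δ` is a leg of a right triangle.
  refine l2norm_le_of_dotProduct_add_eq_zero ?_
  obtain ⟨w, hw⟩ := newtonDs_mem_range A b s μ
  have h1 : newtonDs A b s μ ⬝ᵥ (x - primalPoint A b s μ) = 0 := by
    rw [hw, transpose_mulVec_dotProduct, Matrix.mulVec_sub, hx, mulVec_primalPoint hA hs hμ]
    simp
  have h2 : (fun j => newtonDs A b s μ j / s j) ⬝ᵥ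
      ((fun j => s j * x j / μ - 1) + fun j => newtonDs A b s μ j / s j) =
      μ⁻¹ * (newtonDs A b s μ ⬝ᵥ (x - primalPoint A b s μ)) := by
    simp only [dotProduct, Finset.mul_sum]
    refine Finset.sum_congr rfl fun j _ => ?_
    have := (hs j).ne'
    simp only [Pi.add_apply, Pi.sub_apply, primalPoint]
    field_simp
    ring
  rw [h2, h1, mul_zero]

theorem mul_primalPoint_div (hs : ∀ j, 0 < s j) (hμ : 0 < μ) (j : Fin n) :
    s j * primalPoint A b s μ j / μ = 1 - newtonDs A b s μ j / s j := by
  have := (hs j).ne'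
  simp only [primalPoint]
  field_simp

theorem abs_newtonDs_div_le (A : Matrix (Fin m) (Fin n) ℝ) (b : Fin m → ℝ) (s : Fin n → ℝ) (μ : ℝ)
    (j : Fin n) : |newtonDs A b s μ j / s j| ≤ proximity A b s μ :=
  abs_le_l2norm (fun j => newtonDs A b s μ j / s j) j

/-- Here `s j x j = μ (1 - d j)` with `|d j| ≤ δ`. The upper bound controls the duality gap; the
lower one converts an upper bound on `x j` or `s j` into a lower bound on the other. -/
theorem mul_primalPoint_bounds (hs : ∀ j, 0 < s j) (hμ : 0 < μ)
    (hδ : proximity A b s μ < 1 / 2) (j : Fin n) :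
    μ / 2 ≤ s j * primalPoint A b s μ j ∧ s j * primalPoint A b s μ j ≤ 3 / 2 * μ := by
  have h1 := abs_le.1 ((abs_newtonDs_div_le A b s μ j).trans hδ.le)
  have h2 := mul_primalPoint_div (A := A) (b := b) hs hμ j
  rw [div_eq_iff hμ.ne'] at h2
  rw [h2]
  constructor <;> nlinarith

theorem primalPoint_pos (hs : ∀ j, 0 < s j) (hμ : 0 < μ)
    (hδ : proximity A b s μ < 1 / 2) (j : Fin n) : 0 < primalPoint A b s μ j := by
  have h1 := (mul_primalPoint_bounds hs hμ hδ j).1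
  exact pos_of_mul_pos_right (by linarith) (hs j).le

theorem primalPoint_dotProduct_le (hs : ∀ j, 0 < s j) (hμ : 0 < μ)
    (hδ : proximity A b s μ < 1 / 2) :
    primalPoint A b s μ ⬝ᵥ s ≤ 3 / 2 * n * μ := by
  calc primalPoint A b s μ ⬝ᵥ s ≤ ∑ _j : Fin n, 3 / 2 * μ := by
        refine Finset.sum_le_sum fun j _ => ?_
        rw [mul_comm]; exact (mul_primalPoint_bounds hs hμ hδ j).2
    _ = _ := by simp; ring

/-- A damped Newton step with relative error `e`, followed by an update of `μ`. -/
theorem proximity_step_le (hA : A.rank = m) (hs : ∀ j, 0 < s j) (hμ : 0 < μ)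
    (hδ : proximity A b s μ < 1 / 2) {e : Fin n → ℝ} {E : ℝ} (he : l2norm e ≤ E) (hE : E ≤ 1 / 4)
    {s' : Fin n → ℝ} (hs' : ∀ j, s' j = s j * (1 + newtonDs A b s μ j / s j + e j))
    {θ : ℝ} (hθ : θ < 1) (hθ0 : 0 ≤ θ) :
    (∀ j, 0 < s' j) ∧ (1 - θ) * proximity A b s' ((1 - θ) * μ) ≤ 1 / 4 + 3 / 2 * E + θ * √n := by
  have hd := fun j => abs_le.1 ((abs_newtonDs_div_le A b s μ j).trans hδ.le)
  have he' := fun j => abs_le.1 ((abs_le_l2norm e j).trans (he.trans hE))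
  have hpos : ∀ j, 0 < s' j := fun j => by
    rw [hs']
    exact mul_pos (hs j) (by linarith [(hd j).1, (he' j).1])
  refine ⟨hpos, ?_⟩
  have hθ' : 0 < 1 - θ := by linarith
  have h1 := proximity_le hA hpos (mul_pos hθ' hμ) (mulVec_primalPoint (b := b) hA hs hμ)
  set d : Fin n → ℝ := fun j => newtonDs A b s μ j / s j with hdd
  have hdn : l2norm d ≤ 1 / 2 := hδ.le
  -- `(1 + d + e)(1 - d) = 1 - d² + (1 - d) e`: the terms linear in `d` cancel, which is the
  -- quadratic convergence of Newton's method.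
  have h2 : (1 - θ) • (fun j => s' j * primalPoint A b s μ j / ((1 - θ) * μ) - 1) =
      ((fun j => (1 - d j) * e j) - fun j => d j ^ 2) + fun _ => θ := by
    funext j
    have h3 := mul_primalPoint_div (A := A) (b := b) hs hμ j
    have h4 : s' j * primalPoint A b s μ j / ((1 - θ) * μ) =
        (1 + d j + e j) * (1 - d j) / (1 - θ) := by
      simp only [hdd]; rw [← h3, hs']; field_simp
    simp only [Pi.add_apply, Pi.sub_apply, Pi.smul_apply, smul_eq_mul, h4]
    field_simp
    ring
  calc (1 - θ) * proximity A b s' ((1 - θ) * μ)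
      ≤ (1 - θ) * l2norm (fun j => s' j * primalPoint A b s μ j / ((1 - θ) * μ) - 1) :=
        mul_le_mul_of_nonneg_left h1 hθ'.le
    _ = l2norm (((fun j => (1 - d j) * e j) - fun j => d j ^ 2) + fun _ => θ) := by
        rw [← h2, l2norm_smul, abs_of_pos hθ']
    _ ≤ (l2norm (fun j => (1 - d j) * e j) + l2norm (fun j => d j ^ 2)) +
          l2norm (fun _ : Fin n => θ) :=
        (l2norm_add_le _ _).trans (add_le_add_left (l2norm_sub_le _ _) _)
    _ ≤ (3 / 2 * E + 1 / 4) + θ * √n := by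
        refine add_le_add (add_le_add ?_ ?_) ?_
        · refine (l2norm_mul_le (a := fun j => 1 - d j) (c := 3 / 2) fun j => ?_).trans
            (mul_le_mul_of_nonneg_left he (by norm_num))
          rw [abs_le]; constructor <;> linarith [(hd j).1, (hd j).2]
        · refine (l2norm_sq_apply_le d).trans ?_
          nlinarith [l2norm_nonneg d]
        · rw [l2norm_const, abs_of_nonneg hθ0, Fintype.card_fin]
    _ = _ := by ring

/-- The proximity measure after a small relative perturbation of `s`. -/
theorem proximity_perturb_le (hA : A.rank = m) (hs : ∀ j, 0 < s j) (hμ : 0 < μ)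
    (hδ : proximity A b s μ < 1 / 2) {s' : Fin n → ℝ} (hs' : ∀ j, 0 < s' j) :
    proximity A b s' μ ≤ 1 / 2 + 3 / 2 * l2norm (fun j => (s' j - s j) / s j) := by
  have hd := fun j => abs_le.1 ((abs_newtonDs_div_le A b s μ j).trans hδ.le)
  have h1 := proximity_le hA hs' hμ (mulVec_primalPoint (b := b) hA hs hμ)
  refine h1.trans ?_
  have h2 : (fun j => s' j * primalPoint A b s μ j / μ - 1) =
      (fun j => (1 - newtonDs A b s μ j / s j) * ((s' j - s j) / s j)) -
        fun j => newtonDs A b s μ j / s j := by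
    funext j
    have h3 := mul_primalPoint_div (A := A) (b := b) hs hμ j
    have h4 := (hs j).ne'
    simp only [Pi.sub_apply]
    rw [← h3]
    have h5 : newtonDs A b s μ j / s j = 1 - s j * primalPoint A b s μ j / μ := by linarith
    rw [h5]; field_simp; ring
  rw [h2]
  refine (l2norm_sub_le _ _).trans ?_
  rw [add_comm]
  refine add_le_add hδ.le (l2norm_mul_le fun j => ?_)
  rw [abs_le]; constructor <;> linarith [(hd j).1, (hd j).2]

/-- Lipschitz dependence of the Newton direction on the slack vector. -/
theorem l2norm_newtonDs_sub_le (hA : A.rank = m) (hs : ∀ j, 0 < s j) (hμ : 0 < μ)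
    {s' : Fin n → ℝ} (hs' : ∀ j, 0 < s' j) {ρ : ℝ}
    (hρ : l2norm (fun j => (s' j - s j) / s j) ≤ ρ) (hρ' : ρ ≤ 1 / 4)
    (hδ' : proximity A b s' μ ≤ 1) :
    l2norm (fun j => (newtonDs A b s μ j - newtonDs A b s' μ j) / s j) ≤ 10 * ρ := by
  obtain ⟨w, hw⟩ := newtonDs_mem_range A b s μ
  obtain ⟨w', hw'⟩ := newtonDs_mem_range A b s' μ
  have h1 : (newtonDs A b s μ - newtonDs A b s' μ) ⬝ᵥ
      (primalPoint A b s μ - primalPoint A b s' μ) = 0 := by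
    rw [hw, hw', ← Matrix.mulVec_sub, transpose_mulVec_dotProduct, Matrix.mulVec_sub,
      mulVec_primalPoint hA hs hμ, mulVec_primalPoint hA hs' hμ]
    simp
  set u : Fin n → ℝ := fun j => (newtonDs A b s μ j - newtonDs A b s' μ j) / s j with hu
  set τ : Fin n → ℝ := fun j => (s' j - s j) / s j with hτ
  have hτj : ∀ j, |τ j| ≤ 1 / 4 := fun j => (abs_le_l2norm τ j).trans (hρ.trans hρ')
  set d' : Fin n → ℝ := fun j => newtonDs A b s' μ j / s' j with hd'
  have hdj : ∀ j, |d' j| ≤ 1 := fun j => (abs_newtonDs_div_le A b s' μ j).trans hδ'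
  have hs'e : ∀ j, s' j = s j * (1 + τ j) := fun j => by
    have := (hs j).ne'
    simp only [hτ]; field_simp; ring
  have hpos : ∀ j, 0 < 1 + τ j := fun j => by linarith [(abs_le.1 (hτj j)).1]
  -- Expanding, `x(s, μ) - x(s', μ) = (μ / s)(f τ - u)`, so orthogonality makes `u` a leg of a
  -- triangle with hypotenuse `f τ`. From `|d'| ≤ 1` and `|τ| ≤ 1/4` follows `|f| ≤ (13/4) / (3/4)`;
  -- the constant 10 is generous.
  let f : Fin n → ℝ := fun j => (1 - d' j * (2 + τ j)) / (1 + τ j)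
  have h2 : u ⬝ᵥ ((-fun j => f j * τ j) + u) = 0 := by
    have : u ⬝ᵥ ((-fun j => f j * τ j) + u) = -μ⁻¹ * ((newtonDs A b s μ - newtonDs A b s' μ) ⬝ᵥ
      (primalPoint A b s μ - primalPoint A b s' μ)) := by
      simp only [dotProduct, Finset.mul_sum]
      refine Finset.sum_congr rfl fun j _ => ?_
      have e1 := (hs j).ne'
      have e2 := (hpos j).ne'
      have e3 : newtonDs A b s' μ j = d' j * (s j * (1 + τ j)) := by
        rw [← hs'e]; simp only [hd']; rw [div_mul_cancel₀ _ (hs' j).ne']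
      have e4 : newtonDs A b s μ j = u j * s j + d' j * (s j * (1 + τ j)) := by
        rw [← e3]; simp only [hu]; field_simp; ring
      simp only [Pi.add_apply, Pi.sub_apply, Pi.neg_apply, primalPoint, f, e3, e4, hs'e]
      field_simp
      ring
    rw [this, h1, mul_zero]
  refine (l2norm_le_of_dotProduct_add_eq_zero h2).trans ?_
  rw [l2norm_neg]
  refine (l2norm_mul_le (c := 10) fun j => ?_).trans (mul_le_mul_of_nonneg_left hρ (by norm_num))
  have a1 := abs_le.1 (hτj j)
  have a2 := abs_le.1 (hdj j)
  simp only [f]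
  rw [abs_div, abs_of_pos (hpos j), div_le_iff₀ (hpos j), abs_le]
  constructor <;> nlinarith

end Newton

/-! ### Determinants bounded by row sums -/

section Determinants

/-- In the Leibniz expansion the permutations are among all self-maps of the index set, and the sum
over all maps factors into row sums. -/
theorem Matrix.abs_det_le_prod_sum {α : Type*} [Fintype α] [DecidableEq α] (N : Matrix α α ℝ) :
    |N.det| ≤ ∏ i, ∑ j, |N i j| := by
  rw [← Matrix.det_transpose, Matrix.det_apply]
  calc |∑ σ : Equiv.Perm α, Equiv.Perm.sign σ • ∏ i, Nᵀ (σ i) i|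
      ≤ ∑ σ : Equiv.Perm α, |Equiv.Perm.sign σ • ∏ i, Nᵀ (σ i) i| := Finset.abs_sum_le_sum_abs _ _
    _ = ∑ σ : Equiv.Perm α, ∏ i, |N i (σ i)| := by
        refine Finset.sum_congr rfl fun σ _ => ?_
        rcases Int.units_eq_one_or (Equiv.Perm.sign σ) with h | h <;>
          simp [h, Finset.abs_prod]
    _ = ∑ φ ∈ Finset.univ.image (fun σ : Equiv.Perm α => (σ : α → α)), ∏ i, |N i (φ i)| := by
        rw [Finset.sum_image]
        intro σ _ τ _ h
        exact DFunLike.coe_injective h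
    _ ≤ ∑ φ : α → α, ∏ i, |N i (φ i)| :=
        Finset.sum_le_sum_of_subset_of_nonneg (Finset.subset_univ _)
          fun φ _ _ => Finset.prod_nonneg fun i _ => abs_nonneg _
    _ = ∏ i, ∑ j, |N i j| := by
        rw [Finset.prod_univ_sum, Fintype.piFinset_univ]

theorem Finset.prod_comp_le_of_one_le {α ι : Type*} [Fintype α] [Fintype ι] {f : α → ι}
    (hf : Function.Injective f) {β : ι → ℝ} (hβ : ∀ i, 1 ≤ β i) : ∏ a, β (f a) ≤ ∏ i, β i := by
  classical
  rw [← Finset.prod_image (s := Finset.univ) (g := f) (f := β) (fun a _ b _ h => hf h)]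
  rw [← Finset.prod_mul_prod_compl (Finset.univ.image f) β]
  refine le_mul_of_one_le_right (Finset.prod_nonneg fun i _ => zero_le_one.trans (hβ i)) ?_
  calc (1 : ℝ) = ∏ i ∈ (Finset.univ.image f)ᶜ, 1 := by simp
    _ ≤ _ := Finset.prod_le_prod (fun _ _ => zero_le_one) fun i _ => hβ i

/-- Omitted rows contribute factors at least 1, so one product over all rows serves every square
submatrix, whichever rows it selects. -/
theorem Matrix.abs_det_le_of_row_sum_le {α ι : Type*} [Fintype α] [DecidableEq α] [Fintype ι]
    (N : Matrix α α ℝ) {f : α → ι} (hf : Function.Injective f) {β : ι → ℝ} (hβ : ∀ i, 1 ≤ β i)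
    (h : ∀ a, ∑ c, |N a c| ≤ β (f a)) : |N.det| ≤ ∏ i, β i :=
  (N.abs_det_le_prod_sum.trans (Finset.prod_le_prod
    (fun _ _ => Finset.sum_nonneg fun _ _ => abs_nonneg _) fun a _ => h a)).trans
    (Finset.prod_comp_le_of_one_le hf hβ)

variable {ι κ : Type*} [Fintype κ]

theorem sum_abs_submatrix_le {p : ℕ} (M : Matrix ι κ ℝ) {g : Fin p → κ}
    (hg : Function.Injective g) (i : ι) : ∑ a, |M i (g a)| ≤ ∑ k, |M i k| := by
  classical
  rw [← Finset.sum_image (s := Finset.univ) (g := g) (f := fun k => |M i k|) (fun a _ b _ h => hg h)]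
  exact Finset.sum_le_sum_of_subset_of_nonneg (Finset.subset_univ _) fun _ _ _ => abs_nonneg _

/-- The column replaced in Cramer's rule leaves the row sum. Erasing it matters: when it holds `b`
or `c`, the numerator is bounded without them. -/
theorem sum_abs_updateCol_le [DecidableEq κ] {p : ℕ} (M : Matrix ι κ ℝ) (f : Fin p → ι) {g : Fin p → κ}
    (hg : Function.Injective g) (a : Fin p) (w : ι → ℝ) (c : Fin p) :
    ∑ e, |(M.submatrix f g).updateCol a (w ∘ f) c e| ≤
      ∑ k ∈ Finset.univ.erase (g a), |M (f c) k| + |w (f c)| := by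
  rw [← Finset.sum_erase_add _ _ (Finset.mem_univ a)]
  refine add_le_add ?_ (by simp)
  calc ∑ e ∈ Finset.univ.erase a, |(M.submatrix f g).updateCol a (w ∘ f) c e|
      = ∑ e ∈ Finset.univ.erase a, |M (f c) (g e)| := by
        refine Finset.sum_congr rfl fun e he => ?_
        rw [Matrix.updateCol_ne (Finset.ne_of_mem_erase he), Matrix.submatrix_apply]
    _ = ∑ k ∈ (Finset.univ.erase a).image g, |M (f c) k| := by
        rw [Finset.sum_image fun a _ b _ h => hg h]
    _ ≤ _ := by
        refine Finset.sum_le_sum_of_subset_of_nonneg ?_ fun _ _ _ => abs_nonneg _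
        intro k hk
        obtain ⟨e, he, rfl⟩ := Finset.mem_image.1 hk
        exact Finset.mem_erase.2 ⟨fun h => Finset.ne_of_mem_erase he (hg h), Finset.mem_univ _⟩

end Determinants

/-! ### Basic solutions and Cramer's rule -/

section BasicSolutions

variable {ι κ : Type} [Fintype κ]

/-- Linearly independent columns extend to a basis of the column space, which has a
nonsingular square submatrix. -/
theorem exists_column_basis [Fintype ι] (M : Matrix ι κ ℝ) {T : Set κ} (hT : LinearIndepOn ℝ M.col T) :
    ∃ (p : ℕ) (f : Fin p → ι) (g : Fin p → κ), Function.Injective f ∧ Function.Injective g ∧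
      T ⊆ Set.range g ∧ (∀ k, M.col k ∈ Submodule.span ℝ (Set.range (M.col ∘ g))) ∧
      (M.submatrix f g).det ≠ 0 := by
  classical
  obtain ⟨T', -, hTT', hspan, hli⟩ := exists_linearIndepOn_extension hT (Set.subset_univ T)
  have : Fintype T' := Fintype.ofFinite T'
  let p := Fintype.card T'
  let eq : Fin p ≃ T' := (Fintype.equivFin T').symm
  let g : Fin p → κ := fun a => (eq a : κ)
  have hg : Function.Injective g := Subtype.val_injective.comp eq.injective
  have hrange : Set.range g = T' := by
    ext k; constructor
    · rintro ⟨a, rfl⟩; exact (eq a).2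
    · intro hk; exact ⟨eq.symm ⟨k, hk⟩, by simp [g]⟩
  have hlig : LinearIndependent ℝ (M.col ∘ g) := hli.comp eq eq.injective
  let Q : Matrix ι (Fin p) ℝ := M.submatrix id g
  have hQ : Q.rank = p := by
    rw [Matrix.rank_eq_finrank_span_cols]
    have := linearIndependent_iff_card_eq_finrank_span.1 hlig
    rw [Fintype.card_fin] at this
    exact this.symm
  -- Row rank equals column rank, so `p` independent rows of `Q` exist.
  obtain ⟨κ', a, ha, hsp, hind⟩ := exists_linearIndependent' ℝ Q.row
  have : Finite κ' := Finite.of_injective a ha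
  have : Fintype κ' := Fintype.ofFinite κ'
  have hcard : Fintype.card κ' = p := by
    rw [linearIndependent_iff_card_eq_finrank_span.1 hind, Set.finrank, hsp,
      ← Matrix.rank_eq_finrank_span_row, hQ]
  let e2 : Fin p ≃ κ' := (Fintype.equivFinOfCardEq hcard).symm
  refine ⟨p, a ∘ e2, g, ha.comp e2.injective, hg, hrange ▸ hTT', ?_, ?_⟩
  · intro k
    have := hspan (Set.mem_image_of_mem M.col (Set.mem_univ k))
    rwa [← hrange, ← Set.range_comp] at this
  · have h1 : LinearIndependent ℝ (M.submatrix (a ∘ e2) g).row := hind.comp e2 e2.injective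
    rw [Matrix.linearIndependent_rows_iff_isUnit, Matrix.isUnit_iff_isUnit_det] at h1
    exact h1.ne_zero

/-- A conformal solution of smallest support is basic: if its columns were dependent, moving along a
kernel vector `h` until the first coordinate vanishes would shrink the support. To keep the
coordinate in `F` nonzero, the sign of `h` is chosen so that this coordinate does not move towards
zero. If it moves at all, some other coordinate must decrease, since otherwise `h` would be a ray
excluded by `hray`. -/
theorem exists_min_support (M : Matrix ι κ ℝ) (q : ι → ℝ) (z : κ → ℝ) (hz : M *ᵥ z = q)
    (F : Set κ) (hF : F.Subsingleton) (hF0 : ∀ i ∈ F, z i ≠ 0)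
    (hray : ∀ h, M *ᵥ h = 0 → (∀ k, z k = 0 → h k = 0) → (∀ k, 0 ≤ h k * z k) → ∀ i ∈ F, h i = 0) :
    ∃ z', M *ᵥ z' = q ∧ (∀ k, z k = 0 → z' k = 0) ∧ (∀ k, 0 ≤ z' k * z k) ∧
      (∀ i ∈ F, z' i ≠ 0) ∧ LinearIndepOn ℝ M.col {k | z' k ≠ 0} := by
  classical
  let S : Set (κ → ℝ) := {z' | M *ᵥ z' = q ∧ (∀ k, z k = 0 → z' k = 0) ∧ (∀ k, 0 ≤ z' k * z k) ∧
      (∀ i ∈ F, z' i ≠ 0)}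
  have hS : S.Nonempty := ⟨z, hz, fun _ h => h, fun k => mul_self_nonneg _, hF0⟩
  obtain ⟨z', hz', hmin⟩ := WellFounded.has_min
    (measure fun w : κ → ℝ => (Finset.univ.filter fun k => w k ≠ 0).card).wf S hS
  obtain ⟨hMz', hsupp, hconf, hF'⟩ := hz'
  refine ⟨z', hMz', hsupp, hconf, hF', ?_⟩
  by_contra hdep
  rw [linearIndepOn_iff'] at hdep
  push Not at hdep
  obtain ⟨t, c, htS, hsum, i₀, hi₀t, hi₀⟩ := hdep
  let h : κ → ℝ := fun k => if k ∈ t then c k else 0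
  have hMh : M *ᵥ h = 0 := by
    rw [← hsum]
    funext i
    simp only [Matrix.mulVec, dotProduct, h, mul_ite, mul_zero, Finset.sum_ite_mem,
      Finset.univ_inter, Finset.sum_apply, Pi.smul_apply, Matrix.col_apply, smul_eq_mul]
    exact Finset.sum_congr rfl fun k _ => mul_comm _ _
  have hh : ∀ k, h k ≠ 0 → z' k ≠ 0 := fun k hk => by
    by_cases hkt : k ∈ t
    · exact htS hkt
    · simp [h, hkt] at hk
  have hi₀h : h i₀ ≠ 0 := by simpa [h, hi₀t] using hi₀
  have key : ∀ k, z' k ≠ 0 → 0 < z' k * z k := fun k hk =>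
    lt_of_le_of_ne (hconf k) (mul_ne_zero hk fun h0 => hk (hsupp k h0)).symm
  have main : ∀ h : κ → ℝ, M *ᵥ h = 0 → (∀ k, h k ≠ 0 → z' k ≠ 0) →
      (∀ i ∈ F, 0 ≤ h i * z' i) → ∀ l, h l * z' l < 0 → False := by
    intro h hMh hh hFh l hl
    -- Ratio test: the quotient is `-z' l / h l`, written so that its sign is visible; its minimum
    -- is the first time a coordinate of `z' + T h` vanishes.
    obtain ⟨l₀, hl₀, hl₀min⟩ := Finset.exists_min_image
      (Finset.univ.filter fun l => h l * z' l < 0) (fun l => z' l ^ 2 / (-(h l * z' l)))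
      ⟨l, by simpa using hl⟩
    rw [Finset.mem_filter] at hl₀
    set T := z' l₀ ^ 2 / (-(h l₀ * z' l₀)) with hT
    have hT0 : 0 ≤ T := div_nonneg (sq_nonneg _) (by linarith [hl₀.2])
    have hz'' : ∀ k, 0 ≤ (z' k + T * h k) * z' k := by
      intro k
      by_cases hk : h k * z' k < 0
      · have := hl₀min k (by simpa using hk)
        rw [le_div_iff₀ (by linarith)] at this
        nlinarith
      · nlinarith [mul_nonneg hT0 (not_lt.1 hk), sq_nonneg (z' k)]
    have hz0 : ∀ k, z' k = 0 → z' k + T * h k = 0 := fun k hk => by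
      have : h k = 0 := by by_contra h0; exact hh k h0 hk
      simp [hk, this]
    refine hmin (fun k => z' k + T * h k) ⟨?_, ?_, ?_, ?_⟩ ?_
    · have : (fun k => z' k + T * h k) = z' + T • h := by funext k; simp
      rw [this, Matrix.mulVec_add, Matrix.mulVec_smul, hMh, hMz']; simp
    · exact fun k hk => hz0 k (hsupp k hk)
    · intro k
      by_cases hk : z' k = 0
      · simp [hz0 k hk]
      · have h1 := key k hk
        have h2 : 0 < z' k ^ 2 := by positivity
        have h3 := mul_nonneg (hz'' k) h1.le
        have h4 : 0 ≤ z' k ^ 2 * ((z' k + T * h k) * z k) := by nlinarith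
        exact nonneg_of_mul_nonneg_right h4 h2
    · intro i hi h0
      have h1 : 0 < z' i ^ 2 := by have := hF' i hi; positivity
      have h2 : (z' i + T * h i) * z' i = 0 := by simp [h0]
      nlinarith [mul_nonneg hT0 (hFh i hi)]
    · refine Finset.card_lt_card (Finset.ssubset_iff_subset_ne.2 ⟨?_, ?_⟩)
      · intro k hk
        simp only [Finset.mem_filter, Finset.mem_univ, true_and] at hk ⊢
        exact fun h0 => hk (hz0 k h0)
      · intro heq
        have h1 : l₀ ∈ Finset.univ.filter fun k => z' k ≠ 0 := by
          simp only [Finset.mem_filter, Finset.mem_univ, true_and]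
          intro h0; simp [h0] at hl₀
        rw [← heq] at h1
        simp only [Finset.mem_filter, Finset.mem_univ, true_and] at h1
        apply h1
        have h2 : h l₀ ≠ 0 := fun h0 => by simp [h0] at hl₀
        have h3 : z' l₀ ≠ 0 := hh _ h2
        rw [hT]; field_simp; ring
  by_cases hFz : ∃ i ∈ F, h i ≠ 0
  · obtain ⟨i, hi, hhi⟩ := hFz
    have gen : ∀ h : κ → ℝ, M *ᵥ h = 0 → (∀ k, h k ≠ 0 → z' k ≠ 0) → 0 < h i * z' i → False := by
      intro h hMh hh hpos
      by_cases hneg : ∃ l, h l * z' l < 0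
      · obtain ⟨l, hl⟩ := hneg
        refine main h hMh hh (fun i' hi' => ?_) l hl
        rw [hF hi' hi]; exact hpos.le
      · push Not at hneg
        have h0 : h i = 0 := by
          refine hray h hMh (fun k hk => ?_) (fun k => ?_) i hi
          · by_contra h0; exact hh k h0 (hsupp k hk)
          · by_cases hk : h k = 0
            · simp [hk]
            · have h1 := key k (hh k hk)
              have h2 := mul_nonneg (hneg k) h1.le
              have h3 : 0 < z' k ^ 2 := by have := hh k hk; positivity
              have h4 : 0 ≤ z' k ^ 2 * (h k * z k) := by nlinarith
              exact nonneg_of_mul_nonneg_right h4 h3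
        simp [h0] at hpos
    rcases lt_or_gt_of_ne (mul_ne_zero hhi (hF' i hi)) with hlt | hgt
    · refine gen (-h) (by simp [Matrix.mulVec_neg, hMh]) (fun k hk => hh k (by simpa using hk)) ?_
      simpa using hlt
    · exact gen h hMh hh hgt
  · push Not at hFz
    rcases lt_or_gt_of_ne (mul_ne_zero hi₀h (hh i₀ hi₀h)) with hlt | hgt
    · exact main h hMh hh (fun i hi => by simp [hFz i hi]) i₀ hlt
    · refine main (-h) (by simp [Matrix.mulVec_neg, hMh]) (fun k hk => hh k (by simpa using hk))
        (fun i hi => by simp [hFz i hi]) i₀ ?_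
      simpa using hgt

/-- Basic solutions of integer linear systems: a solution `z` can be replaced by a conformal one
whose entries are quotients of minors with a common denominator `d`, and so can, with the
same denominator, solutions for other right-hand sides. A coordinate that is not zero on any
conformal ray can be kept different from zero. -/
theorem exists_basic_solution [Fintype ι] [DecidableEq κ] (M : Matrix ι κ ℤ) (q : ι → ℤ) (z : κ → ℝ)
    (hz : M.map (Int.cast : ℤ → ℝ) *ᵥ z = fun i => (q i : ℝ))
    (F : Set κ) (hF : F.Subsingleton) (hF0 : ∀ i ∈ F, z i ≠ 0)
    (hray : ∀ h, M.map (Int.cast : ℤ → ℝ) *ᵥ h = 0 → (∀ k, z k = 0 → h k = 0) →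
      (∀ k, 0 ≤ h k * z k) → ∀ i ∈ F, h i = 0) :
    ∃ (d : ℝ) (z' : κ → ℝ), 1 ≤ d ∧ M.map (Int.cast : ℤ → ℝ) *ᵥ z' = (fun i => (q i : ℝ)) ∧
      (∀ k, z k = 0 → z' k = 0) ∧ (∀ k, 0 ≤ z' k * z k) ∧ (∀ i ∈ F, 1 ≤ d * |z' i|) ∧
      (∀ β : ι → ℝ, (∀ i, 1 ≤ β i) → (∀ i, ∑ k, |(M i k : ℝ)| ≤ β i) → d ≤ ∏ i, β i) ∧
      (∀ k, ∀ β : ι → ℝ, (∀ i, 1 ≤ β i) →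
        (∀ i, ∑ l ∈ Finset.univ.erase k, |(M i l : ℝ)| + |(q i : ℝ)| ≤ β i) →
          d * |z' k| ≤ ∏ i, β i) ∧
      (∀ {N : ℕ} (W : Matrix ι (Fin N) ℤ) (ζ : Fin N → ℝ) (β : ι → ℝ), (∀ i, 1 ≤ β i) →
        (∀ i j, ∑ l, |(M i l : ℝ)| + |(W i j : ℝ)| ≤ β i) →
        (∃ u₀, M.map (Int.cast : ℤ → ℝ) *ᵥ u₀ = W.map (Int.cast : ℤ → ℝ) *ᵥ ζ) →
        ∃ u, M.map (Int.cast : ℤ → ℝ) *ᵥ u = W.map (Int.cast : ℤ → ℝ) *ᵥ ζ ∧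
          ∀ l, d * |u l| ≤ (∏ i, β i) * ∑ j, |ζ j|) := by
  set Mr := M.map (Int.cast : ℤ → ℝ) with hMr
  obtain ⟨z', hz', hsupp, hconf, hF', hli⟩ := exists_min_support Mr _ z hz F hF hF0 hray
  obtain ⟨p, f, g, hf, hg, hTg, hspan, hdet⟩ := exists_column_basis Mr hli
  set N := Mr.submatrix f g with hN
  have hdetZ : N.det = ((M.submatrix f g).det : ℝ) := by
    have : N = (M.submatrix f g).map (Int.cast : ℤ → ℝ) := rfl
    rw [this]
    exact ((Int.castRingHom ℝ).map_det (M.submatrix f g)).symm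
  -- A nonzero integer determinant has absolute value at least 1. Applied to Cramer's numerator, the
  -- same fact later gives `1 ≤ d * |z' i|` on `F`.
  have hd1 : 1 ≤ |N.det| := by
    rw [hdetZ, ← Int.cast_abs]
    rw [hdetZ] at hdet
    exact_mod_cast Int.one_le_abs (by exact_mod_cast hdet)
  -- extension by zero of a vector on the basis columns
  have hext : ∀ u : κ → ℝ, (∀ k, k ∉ Set.range g → u k = 0) → ∀ i,
      (Mr *ᵥ u) i = ∑ a, Mr i (g a) * u (g a) := by
    intro u hu i
    rw [Matrix.mulVec, dotProduct, ← Finset.sum_image (s := Finset.univ) (g := g)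
      (f := fun k => Mr i k * u k) (fun a _ b _ h => hg h)]
    symm
    refine Finset.sum_subset (Finset.subset_univ _) fun k _ hk => ?_
    rw [hu k, mul_zero]
    simpa using hk
  have hcramer : ∀ (u : κ → ℝ) (v : ι → ℝ), (∀ k, k ∉ Set.range g → u k = 0) → Mr *ᵥ u = v →
      ∀ a, N.det * u (g a) = (N.updateCol a (v ∘ f)).det := by
    intro u v hu huv a
    have h1 : N *ᵥ (u ∘ g) = v ∘ f := by
      funext c
      rw [Function.comp_apply, ← huv, hext u hu]
      rfl
    rw [← Matrix.cramer_apply, ← h1, Matrix.cramer_eq_adjugate_mulVec, Matrix.mulVec_mulVec,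
      Matrix.adjugate_mul, Matrix.smul_mulVec, Matrix.one_mulVec]
    simp
  have hz'0 : ∀ k, k ∉ Set.range g → z' k = 0 := fun k hk => by
    by_contra h0; exact hk (hTg h0)
  refine ⟨|N.det|, z', hd1, hz', hsupp, hconf, ?_, ?_, ?_, ?_⟩
  · intro i hi
    obtain ⟨a, rfl⟩ := hTg (hF' i hi)
    rw [← abs_mul, hcramer z' _ hz'0 hz' a]
    have h0 : (N.updateCol a ((fun i => (q i : ℝ)) ∘ f)).det ≠ 0 := by
      rw [← hcramer z' _ hz'0 hz' a]
      exact mul_ne_zero hdet (hF' _ hi)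
    have h1 : (N.updateCol a ((fun i => (q i : ℝ)) ∘ f)).det =
        (((M.submatrix f g).updateCol a (q ∘ f)).det : ℝ) := by
      have : N.updateCol a ((fun i => (q i : ℝ)) ∘ f) =
          ((M.submatrix f g).updateCol a (q ∘ f)).map (Int.cast : ℤ → ℝ) := by
        rw [Matrix.map_updateCol]; rfl
      rw [this]
      exact ((Int.castRingHom ℝ).map_det _).symm
    rw [h1] at h0 ⊢
    rw [← Int.cast_abs]
    exact_mod_cast Int.one_le_abs (by exact_mod_cast h0)
  · intro β hβ h
    refine N.abs_det_le_of_row_sum_le hf hβ fun a => ?_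
    refine (sum_abs_submatrix_le Mr hg (f a)).trans ?_
    simpa [hMr] using h (f a)
  · intro k β hβ h
    by_cases hk : k ∈ Set.range g
    · obtain ⟨a, rfl⟩ := hk
      rw [← abs_mul, hcramer z' _ hz'0 hz' a]
      refine Matrix.abs_det_le_of_row_sum_le _ hf hβ fun c => ?_
      exact (sum_abs_updateCol_le Mr f hg a _ c).trans (by simpa [hMr] using h (f c))
    · rw [hz'0 k hk, abs_zero, mul_zero]
      exact Finset.prod_nonneg fun i _ => zero_le_one.trans (hβ i)
  · intro N' W ζ β hβ h ⟨u₀, hu₀⟩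
    have hv : W.map (Int.cast : ℤ → ℝ) *ᵥ ζ ∈ Submodule.span ℝ (Set.range (Mr.col ∘ g)) := by
      rw [← hu₀, Matrix.mulVec_eq_sum]
      refine Submodule.sum_mem _ fun k _ => ?_
      have h2 := Submodule.smul_mem _ (u₀ k) (hspan k)
      convert h2 using 1
      exact op_smul_eq_smul _ _
    rw [Submodule.mem_span_range_iff_exists_fun] at hv
    obtain ⟨c, hc⟩ := hv
    let u : κ → ℝ := Function.extend g c 0
    have hug : ∀ a, u (g a) = c a := fun a => hg.extend_apply _ _ _
    have hu0 : ∀ k, k ∉ Set.range g → u k = 0 := fun k hk => by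
      simp only [u]
      rw [Function.extend_apply' _ _ _ (by simpa using hk)]; rfl
    have hMu : Mr *ᵥ u = W.map (Int.cast : ℤ → ℝ) *ᵥ ζ := by
      rw [← hc]
      funext i
      rw [hext u hu0, Finset.sum_apply]
      refine Finset.sum_congr rfl fun a _ => ?_
      simp [hug, mul_comm]
    have hprod : 0 ≤ ∏ i, β i := Finset.prod_nonneg fun i _ => zero_le_one.trans (hβ i)
    refine ⟨u, hMu, fun k => ?_⟩
    by_cases hk : k ∈ Set.range g
    · obtain ⟨a, rfl⟩ := hk
      rw [← abs_mul, hcramer u _ hu0 hMu a]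
      -- The numerator is linear in the replaced column, so only determinants with integer columns
      -- of `W` have to be bounded and the real coefficients `ζ` come out.
      have h1 : (N.updateCol a ((W.map (Int.cast : ℤ → ℝ) *ᵥ ζ) ∘ f)).det =
          ∑ j, ζ j * (N.updateCol a ((fun i => (W i j : ℝ)) ∘ f)).det := by
        simp only [← Matrix.cramer_apply]
        have : (W.map (Int.cast : ℤ → ℝ) *ᵥ ζ) ∘ f =
            ∑ j, ζ j • ((fun i => (W i j : ℝ)) ∘ f) := by
          funext c
          simp [Matrix.mulVec, dotProduct, mul_comm]
        rw [this, map_sum, Finset.sum_apply]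
        simp
      rw [h1, Finset.mul_sum]
      refine (Finset.abs_sum_le_sum_abs _ _).trans (Finset.sum_le_sum fun j _ => ?_)
      rw [abs_mul, mul_comm]
      refine mul_le_mul_of_nonneg_right ?_ (abs_nonneg _)
      refine Matrix.abs_det_le_of_row_sum_le _ hf hβ fun c => ?_
      refine (sum_abs_updateCol_le Mr f hg a _ c).trans (le_trans ?_ (h (f c) j))
      refine add_le_add ?_ le_rfl
      exact Finset.sum_le_sum_of_subset_of_nonneg (Finset.subset_univ _) fun _ _ _ => abs_nonneg _
    · rw [hu0 k hk, abs_zero, mul_zero]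
      exact mul_nonneg hprod (Finset.sum_nonneg fun _ _ => abs_nonneg _)

end BasicSolutions

/-! ### Strict complementarity from the central path -/

section StrictComplementarity

variable {m n : ℕ} {A : Matrix (Fin m) (Fin n) ℝ} {b : Fin m → ℝ} {c : Fin n → ℝ}

/-- Applied to differences of feasible points, this is the orthogonality behind every duality
estimate below. -/
theorem dotProduct_eq_zero_of_mulVec_eq_zero {x s : Fin n → ℝ} {w : Fin m → ℝ}
    (hx : A *ᵥ x = 0) (hs : Aᵀ *ᵥ w = s) : x ⬝ᵥ s = 0 := by
  rw [dotProduct_comm, ← hs, transpose_mulVec_dotProduct, hx, dotProduct_zero]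

/-- Exact Newton steps follow the central path. -/
theorem exists_central_sequence (hA : A.rank = m) (hn : 0 < n) {y₀ : Fin m → ℝ} {s₀ : Fin n → ℝ}
    {μ₀ : ℝ} (h0 : StrictDualFeasible A c y₀ s₀) (hμ₀ : 0 < μ₀)
    (hδ : proximity A b s₀ μ₀ < 1 / 2) (k : ℕ) :
    ∃ y s, StrictDualFeasible A c y s ∧
      proximity A b s (barrier μ₀ (1 / (8 * √n)) k) < 1 / 2 := by
  have hn1 : 1 ≤ √(n : ℝ) := Real.one_le_sqrt.2 (by exact_mod_cast hn)
  have hθ : 1 / (8 * √(n : ℝ)) ≤ 1 / 8 :=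
    one_div_le_one_div_of_le (by norm_num) (by linarith)
  have hθ0 : 0 ≤ 1 / (8 * √(n : ℝ)) := by positivity
  have hθn : 1 / (8 * √(n : ℝ)) * √n = 1 / 8 := by field_simp
  induction k with
  | zero => exact ⟨y₀, s₀, h0, by simpa [barrier] using hδ⟩
  | succ k ih =>
    obtain ⟨y, s, ⟨hfeas, hs⟩, hδk⟩ := ih
    have hμ : 0 < barrier μ₀ (1 / (8 * √n)) k := mul_pos (pow_pos (by linarith) _) hμ₀
    have hstep := proximity_step_le (e := 0) (E := 0) hA hs hμ hδk l2norm_zero.le (by norm_num)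
      (s' := fun j => s j * (1 + newtonDs A b s (barrier μ₀ (1 / (8 * √n)) k) j / s j + 0))
      (fun j => rfl) (θ := 1 / (8 * √n)) (by linarith) hθ0
    obtain ⟨w, hw⟩ := newtonDs_mem_range A b s (barrier μ₀ (1 / (8 * √n)) k)
    refine ⟨y - w, _, ⟨?_, hstep.1⟩, ?_⟩
    · rw [← hfeas, Matrix.mulVec_sub, ← hw]
      funext j
      have := (hs j).ne'
      simp only [Pi.add_apply, Pi.sub_apply]
      field_simp
      ring
    · have h2 := hstep.2
      rw [hθn] at h2
      have h3 : barrier μ₀ (1 / (8 * √n)) (k + 1) =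
          (1 - 1 / (8 * √n)) * barrier μ₀ (1 / (8 * √n)) k := by simp only [barrier]; ring
      rw [h3]
      -- `1/4 + 1/8 < 7/16 ≤ (1 - θ) / 2`, since `θ ≤ 1/8`.
      nlinarith

/-- The theorem of Goldman and Tucker for problems with an interior. -/
theorem exists_strictly_complementary (hA : A.rank = m) (hn : 0 < n) {y₀ : Fin m → ℝ}
    {s₀ : Fin n → ℝ} {μ₀ : ℝ} (h0 : StrictDualFeasible A c y₀ s₀) (hμ₀ : 0 < μ₀)
    (hδ : proximity A b s₀ μ₀ < 1 / 2) :
    ∃ w ∈ optimalSet A b c, ∀ j, 0 < w.1 j ∨ 0 < w.2.2 j := by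
  set θ := 1 / (8 * √(n : ℝ)) with hθdef
  have hn1 : 1 ≤ √(n : ℝ) := Real.one_le_sqrt.2 (by exact_mod_cast hn)
  have hθ : θ ≤ 1 / 8 := one_div_le_one_div_of_le (by norm_num) (by linarith)
  have hθ0 : 0 < θ := by positivity
  choose y s hfeas hprox using exists_central_sequence hA hn h0 hμ₀ hδ
  set μ := barrier μ₀ θ with hμdef
  have hμ : ∀ k, 0 < μ k := fun k => mul_pos (pow_pos (by linarith) _) hμ₀
  have hμle : ∀ k, μ k ≤ μ₀ := fun k =>
    mul_le_of_le_one_left hμ₀.le (pow_le_one₀ (by linarith) (by linarith))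
  have hμlim : Filter.Tendsto μ Filter.atTop (nhds 0) := by
    have := (tendsto_pow_atTop_nhds_zero_of_lt_one (r := 1 - θ) (by linarith)
      (by linarith)).mul_const μ₀
    rw [zero_mul] at this
    exact this
  let x : ℕ → Fin n → ℝ := fun k => primalPoint A b (s k) (μ k)
  have hx : ∀ k, A *ᵥ x k = b := fun k => mulVec_primalPoint hA (hfeas k).2 (hμ k)
  have hxpos : ∀ k j, 0 < x k j := fun k j => primalPoint_pos (hfeas k).2 (hμ k) (hprox k) j
  have hgap : ∀ k, x k ⬝ᵥ s k ≤ 3 / 2 * n * μ k := fun k =>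
    primalPoint_dotProduct_le (hfeas k).2 (hμ k) (hprox k)
  have hgap0 : ∀ k, 0 ≤ x k ⬝ᵥ s k := fun k =>
    Finset.sum_nonneg fun j _ => mul_nonneg (hxpos k j).le ((hfeas k).2 j).le
  -- Orthogonality to the starting pair bounds both mixed products; as `x 0` and `s 0` are positive,
  -- all pairs stay in one box.
  have hbd : ∀ k, x k ⬝ᵥ s 0 + x 0 ⬝ᵥ s k ≤ 3 * n * μ₀ := by
    intro k
    have h1 : (x k - x 0) ⬝ᵥ (s k - s 0) = 0 := by
      refine dotProduct_eq_zero_of_mulVec_eq_zero (A := A) (w := y 0 - y k) ?_ ?_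
      · rw [Matrix.mulVec_sub, hx, hx, sub_self]
      · rw [Matrix.mulVec_sub, eq_sub_of_add_eq (hfeas 0).1, eq_sub_of_add_eq (hfeas k).1]; abel
    simp only [sub_dotProduct, dotProduct_sub] at h1
    have h2 := hgap k
    have h3 := hgap 0
    have h4 : 3 / 2 * n * μ k ≤ 3 / 2 * n * μ₀ := mul_le_mul_of_nonneg_left (hμle k) (by positivity)
    have h5 : 3 / 2 * n * μ 0 ≤ 3 / 2 * n * μ₀ := mul_le_mul_of_nonneg_left (hμle 0) (by positivity)
    linarith
  have term : ∀ (u v : Fin n → ℝ), (∀ j, 0 ≤ u j) → (∀ j, 0 ≤ v j) → ∀ j, u j * v j ≤ u ⬝ᵥ v :=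
    fun u v hu hv j => Finset.single_le_sum (f := fun j => u j * v j)
      (fun i _ => mul_nonneg (hu i) (hv i)) (Finset.mem_univ j)
  have nn : ∀ k, 0 ≤ x k ⬝ᵥ s 0 ∧ 0 ≤ x 0 ⬝ᵥ s k := fun k =>
    ⟨Finset.sum_nonneg fun j _ => mul_nonneg (hxpos k j).le ((hfeas 0).2 j).le,
      Finset.sum_nonneg fun j _ => mul_nonneg (hxpos 0 j).le ((hfeas k).2 j).le⟩
  let Bx : Fin n → ℝ := fun j => 3 * n * μ₀ / s 0 j
  let Bs : Fin n → ℝ := fun j => 3 * n * μ₀ / x 0 j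
  have hmem : ∀ k, (x k, s k) ∈ Set.Icc (0 : (Fin n → ℝ) × (Fin n → ℝ)) (Bx, Bs) := by
    intro k
    refine ⟨⟨fun j => (hxpos k j).le, fun j => ((hfeas k).2 j).le⟩, fun j => ?_, fun j => ?_⟩
    · simp only [Bx]
      rw [le_div_iff₀ ((hfeas 0).2 j)]
      have := term (x k) (s 0) (fun j => (hxpos k j).le) (fun j => ((hfeas 0).2 j).le) j
      linarith [hbd k, (nn k).2]
    · simp only [Bs]
      rw [le_div_iff₀ (hxpos 0 j)]
      have := term (x 0) (s k) (fun j => (hxpos 0 j).le) (fun j => ((hfeas k).2 j).le) j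
      linarith [hbd k, (nn k).1]
  obtain ⟨⟨x', s'⟩, hlimmem, φ, hφ, hlim⟩ := (isCompact_Icc).tendsto_subseq hmem
  have hxl : Filter.Tendsto (fun k => x (φ k)) Filter.atTop (nhds x') :=
    (continuous_fst.tendsto _).comp hlim
  have hsl : Filter.Tendsto (fun k => s (φ k)) Filter.atTop (nhds s') :=
    (continuous_snd.tendsto _).comp hlim
  have hAx' : A *ᵥ x' = b := by
    have h1 : Filter.Tendsto (fun k => A *ᵥ x (φ k)) Filter.atTop (nhds (A *ᵥ x')) :=
      ((continuous_const.matrix_mulVec continuous_id).tendsto x').comp hxl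
    simp only [hx] at h1
    exact tendsto_nhds_unique h1 tendsto_const_nhds |>.symm ▸ rfl
  -- Only the slacks are known to converge; closedness of the range of `Aᵀ` supplies `y'`.
  obtain ⟨y', hy'⟩ : ∃ y', Aᵀ *ᵥ y' + s' = c := by
    have hcl : IsClosed ((LinearMap.range Aᵀ.mulVecLin : Submodule ℝ (Fin n → ℝ)) : Set (Fin n → ℝ)) :=
      Submodule.closed_of_finiteDimensional _
    have h1 : c - s' ∈ (LinearMap.range Aᵀ.mulVecLin : Submodule ℝ (Fin n → ℝ)) := by
      refine hcl.mem_of_tendsto (tendsto_const_nhds.sub hsl) (Filter.Eventually.of_forall fun k => ?_)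
      exact ⟨y (φ k), by
        rw [Matrix.mulVecLin_apply, ← (hfeas (φ k)).1, add_sub_cancel_right]⟩
    obtain ⟨y', hy'⟩ := h1
    refine ⟨y', ?_⟩
    rw [Matrix.mulVecLin_apply] at hy'
    rw [hy']; simp
  have hx'0 : ∀ j, 0 ≤ x' j := hlimmem.1.1
  have hs'0 : ∀ j, 0 ≤ s' j := hlimmem.1.2
  have hcomp : x' ⬝ᵥ s' = 0 := by
    have h1 : Filter.Tendsto (fun k => x (φ k) ⬝ᵥ s (φ k)) Filter.atTop (nhds (x' ⬝ᵥ s')) :=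
      ((continuous_fst.dotProduct continuous_snd).tendsto (x', s')).comp hlim
    have h2 : Filter.Tendsto (fun k => 3 / 2 * n * μ (φ k)) Filter.atTop (nhds (3 / 2 * n * 0)) :=
      (hμlim.comp hφ.tendsto_atTop).const_mul _
    rw [mul_zero] at h2
    exact tendsto_nhds_unique h1 (squeeze_zero (fun k => hgap0 _) (fun k => hgap _) h2)
  refine ⟨(x', y', s'), ⟨hAx', hy', hcomp, hx'0, hs'0⟩, fun j₀ => ?_⟩
  by_contra hcon
  push Not at hcon
  have hx0 : x' j₀ = 0 := le_antisymm hcon.1 (hx'0 j₀)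
  have hs0 : s' j₀ = 0 := le_antisymm hcon.2 (hs'0 j₀)
  -- eventually the limit is componentwise at most slightly larger than the iterates
  set ε : ℝ := 1 / (4 * n) with hε
  have hn0 : (0 : ℝ) < n := by exact_mod_cast hn
  have hε0 : 0 < ε := by positivity
  have hev : ∀ (u : ℕ → Fin n → ℝ) (u' : Fin n → ℝ), (∀ k j, 0 < u k j) → (∀ j, 0 ≤ u' j) →
      Filter.Tendsto u Filter.atTop (nhds u') →
      ∀ᶠ k in Filter.atTop, ∀ j, u' j ≤ (1 + ε) * u k j := by
    intro u u' hu hu' hlim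
    rw [Filter.eventually_all]
    intro j
    rcases (hu' j).eq_or_lt with h | h
    · exact Filter.Eventually.of_forall fun k => by rw [← h]; have := hu k j; positivity
    · have h1 : Filter.Tendsto (fun k => (1 + ε) * u k j) Filter.atTop (nhds ((1 + ε) * u' j)) :=
        ((tendsto_pi_nhds.1 hlim) j).const_mul _
      exact (h1.eventually (lt_mem_nhds (show u' j < (1 + ε) * u' j by nlinarith))).mono
        fun k hk => hk.le
  obtain ⟨k, hk1, hk2⟩ := ((hev _ x' (fun k j => hxpos _ j) hx'0 hxl).and
    (hev _ s' (fun k j => (hfeas _).2 j) hs'0 hsl)).exists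
  set K := φ k
  have h1 : (x K - x') ⬝ᵥ (s K - s') = 0 := by
    refine dotProduct_eq_zero_of_mulVec_eq_zero (A := A) (w := y' - y K) ?_ ?_
    · rw [Matrix.mulVec_sub, hx, hAx', sub_self]
    · rw [Matrix.mulVec_sub, eq_sub_of_add_eq hy', eq_sub_of_add_eq (hfeas K).1]; abel
  simp only [sub_dotProduct, dotProduct_sub, hcomp] at h1
  have hprod : ∀ j, x' j * s' j = 0 := by
    intro j
    have := term x' s' hx'0 hs'0 j
    rw [hcomp] at this
    exact le_antisymm this (mul_nonneg (hx'0 j) (hs'0 j))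
  -- By `h1` the left side is the whole gap `x K ⬝ᵥ s K`. On the right `j₀` is missing, because both
  -- limits vanish there; for every other index at least one limit vanishes and the other exceeds
  -- its iterate by at most the factor `1 + ε`.
  have h2 : x K ⬝ᵥ s' + x' ⬝ᵥ s K ≤ (1 + ε) * (x K ⬝ᵥ s K - x K j₀ * s K j₀) := by
    simp only [dotProduct, ← Finset.sum_add_distrib]
    rw [← Finset.sum_erase_add _ _ (Finset.mem_univ j₀),
      ← Finset.sum_erase_add _ (fun j => x K j * s K j) (Finset.mem_univ j₀)]
    rw [hx0, hs0, add_sub_cancel_right, Finset.mul_sum]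
    simp only [mul_zero, zero_mul, add_zero]
    refine Finset.sum_le_sum fun j _ => ?_
    have a1 := hxpos K j
    have a2 := (hfeas K).2 j
    rcases mul_eq_zero.1 (hprod j) with h | h
    · rw [h, zero_mul, add_zero]
      nlinarith [hk2 j]
    · rw [h, mul_zero, zero_add]
      nlinarith [hk1 j]
  have h3 := (mul_primalPoint_bounds (hfeas K).2 (hμ K) (hprox K) j₀).1
  have h4 := hgap K
  -- Reason for `ε = 1 / (4 n)`: the factor `1 + ε` gains at most `3/8 μ`, while the missing index
  -- costs at least `μ / 2`.
  have h5 : ε * (3 / 2 * n * μ K) = 3 / 8 * μ K := by rw [hε]; field_simp; ring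
  have h6 : ε * (x K ⬝ᵥ s K) ≤ ε * (3 / 2 * n * μ K) := mul_le_mul_of_nonneg_left h4 hε0.le
  have h7 : μ K / 2 ≤ x K j₀ * s K j₀ := by rw [mul_comm]; exact h3
  nlinarith [hμ K, mul_pos hε0 (mul_pos (hxpos K j₀) ((hfeas K).2 j₀))]

end StrictComplementarity

/-! ### Basic solutions bounded by the integer data -/

theorem Finset.one_add_sum_le_prod_one_add {ι : Type*} (s : Finset ι) {v : ι → ℝ}
    (hv : ∀ i, 0 ≤ v i) : 1 + ∑ i ∈ s, v i ≤ ∏ i ∈ s, (1 + v i) := by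
  classical
  induction s using Finset.induction_on with
  | empty => simp
  | insert a s ha ih =>
    rw [Finset.sum_insert ha, Finset.prod_insert ha]
    have h1 : 0 ≤ ∑ i ∈ s, v i := Finset.sum_nonneg fun i _ => hv i
    nlinarith [hv a, mul_nonneg (hv a) h1]

theorem Finset.one_le_prod_one_add {ι : Type*} (s : Finset ι) {v : ι → ℝ}
    (hv : ∀ i, 0 ≤ v i) : 1 ≤ ∏ i ∈ s, (1 + v i) :=
  (le_add_of_nonneg_right (Finset.sum_nonneg fun i _ => hv i)).trans
    (s.one_add_sum_le_prod_one_add hv)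

namespace IntLO

noncomputable section

variable {m n : ℕ} (P : IntLO m n)

/-- A bound for the minors of `A`. -/
def boundA : ℝ := ∏ i, ∏ j, (1 + |(P.A i j : ℝ)|)

def boundB : ℝ := ∏ i, (1 + |(P.b i : ℝ)|)

def boundC : ℝ := ∏ j, (1 + |(P.c j : ℝ)|)

theorem boundA_eq : P.boundA = ∏ j, ∏ i, (1 + |(P.A i j : ℝ)|) := Finset.prod_comm

theorem boundA_mul_boundB :
    P.boundA * P.boundB = ∏ i, ((∏ j, (1 + |(P.A i j : ℝ)|)) * (1 + |(P.b i : ℝ)|)) :=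
  Finset.prod_mul_distrib.symm

theorem boundA_mul_boundC :
    P.boundA * P.boundC = ∏ j, ((∏ i, (1 + |(P.A i j : ℝ)|)) * (1 + |(P.c j : ℝ)|)) := by
  rw [boundA_eq]; exact Finset.prod_mul_distrib.symm

theorem one_le_rowA (i : Fin m) : 1 ≤ ∏ j, (1 + |(P.A i j : ℝ)|) :=
  Finset.one_le_prod_one_add _ fun _ => abs_nonneg _

theorem one_le_colA (j : Fin n) : 1 ≤ ∏ i, (1 + |(P.A i j : ℝ)|) :=
  Finset.one_le_prod_one_add _ fun _ => abs_nonneg _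

theorem rowA_le (i : Fin m) : 1 + ∑ j, |(P.A i j : ℝ)| ≤ ∏ j, (1 + |(P.A i j : ℝ)|) :=
  Finset.one_add_sum_le_prod_one_add _ fun _ => abs_nonneg _

theorem colA_le (j : Fin n) : 1 + ∑ i, |(P.A i j : ℝ)| ≤ ∏ i, (1 + |(P.A i j : ℝ)|) :=
  Finset.one_add_sum_le_prod_one_add _ fun _ => abs_nonneg _

theorem one_le_rowAB (i : Fin m) :
    1 ≤ (∏ j, (1 + |(P.A i j : ℝ)|)) * (1 + |(P.b i : ℝ)|) :=
  one_le_mul_of_one_le_of_one_le (P.one_le_rowA i) (by simp)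

theorem one_le_colAC (j : Fin n) :
    1 ≤ (∏ i, (1 + |(P.A i j : ℝ)|)) * (1 + |(P.c j : ℝ)|) :=
  one_le_mul_of_one_le_of_one_le (P.one_le_colA j) (by simp)

theorem rowAB_le (i : Fin m) : ∑ j, |(P.A i j : ℝ)| + |(P.b i : ℝ)| ≤
    (∏ j, (1 + |(P.A i j : ℝ)|)) * (1 + |(P.b i : ℝ)|) := by
  nlinarith [P.rowA_le i, P.one_le_rowA i, abs_nonneg (P.b i : ℝ)]

theorem colAC_le (j : Fin n) : 1 + ∑ i, |(P.A i j : ℝ)| + |(P.c j : ℝ)| ≤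
    (∏ i, (1 + |(P.A i j : ℝ)|)) * (1 + |(P.c j : ℝ)|) := by
  nlinarith [P.colA_le j, P.one_le_colA j, abs_nonneg (P.c j : ℝ)]

theorem one_le_boundA : 1 ≤ P.boundA := by
  calc (1 : ℝ) = ∏ _i : Fin m, (1 : ℝ) := by simp
    _ ≤ _ := Finset.prod_le_prod (fun _ _ => zero_le_one) fun i _ => P.one_le_rowA i

theorem one_le_boundB : 1 ≤ P.boundB := Finset.one_le_prod_one_add _ fun _ => abs_nonneg _

theorem one_le_boundC : 1 ≤ P.boundC := Finset.one_le_prod_one_add _ fun _ => abs_nonneg _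

theorem le_of_one_le_mul {d x c : ℝ} (hd : 1 ≤ d) (h : d * |x| ≤ c) : x ≤ c := by
  nlinarith [le_abs_self x, abs_nonneg x]

/-- Preimages under `A` of small vectors. -/
theorem exists_small_preimage (hA : P.realA.rank = m) (v : Fin m → ℝ) :
    ∃ u, P.realA *ᵥ u = v ∧ ∀ l, |u l| ≤ P.boundA * ∑ i, |v i| := by
  -- The zero right-hand side and empty `F` serve only to fix a column basis; the clause on further
  -- right-hand sides is used with `W = 1`.
  obtain ⟨d, -, hd, -, -, -, -, -, -, hW⟩ := exists_basic_solution P.A 0 0 (by simp; rfl) ∅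
    Set.subsingleton_empty (by simp) (by simp)
  obtain ⟨u₀, hu₀⟩ := Matrix.exists_mulVec_eq_of_rank hA v
  have hone : (1 : Matrix (Fin m) (Fin m) ℤ).map (Int.cast : ℤ → ℝ) = 1 := by simp
  obtain ⟨u, hu, hul⟩ := hW (1 : Matrix (Fin m) (Fin m) ℤ) v (fun i => ∏ j, (1 + |(P.A i j : ℝ)|))
    P.one_le_rowA (fun i j => by
      refine le_trans ?_ (P.rowA_le i)
      rw [add_comm]
      refine add_le_add ?_ le_rfl
      by_cases h : i = j <;> simp [Matrix.one_apply, h])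
    ⟨u₀, by rw [hone, Matrix.one_mulVec]; exact hu₀⟩
  rw [hone, Matrix.one_mulVec] at hu
  refine ⟨u, hu, fun l => ?_⟩
  have h1 := hul l
  have h2 : |u l| ≤ d * |u l| := le_mul_of_one_le_left (abs_nonneg _) hd
  exact h2.trans h1

/-- A bounded point of the cone over the primal feasible set with `x j = 1`. -/
theorem exists_normalized_primal {x₀ : Fin n → ℝ} (hx₀ : ∀ k, 0 < x₀ k)
    (hAx₀ : P.realA *ᵥ x₀ = P.realb) (j : Fin n) :
    ∃ (g : Fin n → ℝ) (τ : ℝ), P.realA *ᵥ g = τ • P.realb ∧ (∀ k, 0 ≤ g k) ∧ g j = 1 ∧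
      (∀ k, g k ≤ P.boundA * P.boundB) ∧ 0 ≤ τ ∧ τ ≤ P.boundA := by
  -- Unknowns are the `g k` with `k ≠ j` and `τ`. The normalization `g j = 1` moves column `j` to
  -- the right-hand side, leaving a zero column; `x₀ / x₀ j` with `τ = 1 / x₀ j` solves the system.
  let M : Matrix (Fin m) (Fin n ⊕ Unit) ℤ := fun i => Sum.elim
    (fun k => if k = j then 0 else P.A i k) fun _ => -P.b i
  have hMl : ∀ i k, M i (Sum.inl k) = if k = j then 0 else P.A i k := fun _ _ => rfl
  have hMr : ∀ i k, M i (Sum.inr k) = -P.b i := fun _ _ => rfl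
  have hMv : ∀ (v : Fin n ⊕ Unit → ℝ) i, (M.map (Int.cast : ℤ → ℝ) *ᵥ v) i =
      (P.realA *ᵥ fun k => if k = j then 0 else v (Sum.inl k)) i - v (Sum.inr ()) * P.b i := by
    intro v i
    simp only [Matrix.mulVec, dotProduct, Fintype.sum_sum_type, Matrix.map_apply, hMl, hMr,
      Finset.univ_unique, Finset.sum_singleton, IntLO.realA]
    rw [sub_eq_add_neg]
    congr 1
    · refine Finset.sum_congr rfl fun k _ => ?_
      split_ifs <;> simp
    · push_cast; rw [neg_mul, mul_comm]
  let v₀ : Fin n ⊕ Unit → ℝ := Sum.elim (fun k => x₀ k / x₀ j) fun _ => 1 / x₀ j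
  have hsplit : ∀ (g : Fin n → ℝ) i, (P.realA *ᵥ g) i =
      (P.realA *ᵥ fun k => if k = j then 0 else g k) i + P.A i j * g j := by
    intro g i
    simp only [Matrix.mulVec, dotProduct]
    rw [← Finset.sum_erase_add _ _ (Finset.mem_univ j),
      ← Finset.sum_erase_add (a := j) _ (fun k => P.realA i k * if k = j then 0 else g k)
        (Finset.mem_univ j)]
    simp only [if_true, mul_zero, add_zero]
    congr 1
    refine Finset.sum_congr rfl fun k hk => ?_
    rw [if_neg (Finset.ne_of_mem_erase hk)]
  have hv₀ : M.map (Int.cast : ℤ → ℝ) *ᵥ v₀ = fun i => ((-P.A i j : ℤ) : ℝ) := by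
    funext i
    rw [hMv]
    have h1 := hsplit (fun k => x₀ k / x₀ j) i
    have h2 : (P.realA *ᵥ fun k => x₀ k / x₀ j) = (1 / x₀ j) • P.realb := by
      rw [← hAx₀, ← Matrix.mulVec_smul]
      congr 1; funext k; simp [div_eq_inv_mul]
    rw [h2] at h1
    simp only [Pi.smul_apply, smul_eq_mul, IntLO.realb, div_self (hx₀ j).ne', mul_one] at h1
    simp only [v₀, Sum.elim_inl, Sum.elim_inr]
    push_cast
    linarith
  obtain ⟨d, z, hd, hz, -, hconf, -, -, hbd, -⟩ := exists_basic_solution M (fun i => -P.A i j) v₀ hv₀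
    ∅ Set.subsingleton_empty (by simp) (by simp)
  have hpos : ∀ k, 0 < v₀ k := by
    rintro (k | k)
    · exact div_pos (hx₀ k) (hx₀ j)
    · exact one_div_pos.2 (hx₀ j)
  have hz0 : ∀ k, 0 ≤ z k := fun k => nonneg_of_mul_nonneg_left (hconf k) (hpos k)
  have hsum : ∀ i, ∑ k, |((if k = j then 0 else P.A i k : ℤ) : ℝ)| + |((-P.A i j : ℤ) : ℝ)| =
      ∑ k, |(P.A i k : ℝ)| := by
    intro i
    rw [← Finset.sum_erase_add _ _ (Finset.mem_univ j),
      ← Finset.sum_erase_add (a := j) _ (fun k => |(P.A i k : ℝ)|) (Finset.mem_univ j)]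
    simp only [if_true, Int.cast_zero, abs_zero, add_zero, Int.cast_neg, abs_neg]
    congr 1
    refine Finset.sum_congr rfl fun k hk => ?_
    rw [if_neg (Finset.ne_of_mem_erase hk)]
  refine ⟨fun k => if k = j then 1 else z (Sum.inl k), z (Sum.inr ()), ?_, ?_, by simp, ?_,
    hz0 _, ?_⟩
  · funext i
    rw [hsplit]
    have h1 := congrFun hz i
    rw [hMv] at h1
    have h2 : (fun k => if k = j then (0 : ℝ) else if k = j then 1 else z (Sum.inl k)) =
        fun k => if k = j then 0 else z (Sum.inl k) := by
      funext k; split_ifs <;> rfl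
    rw [h2]
    simp only [Pi.smul_apply, smul_eq_mul, IntLO.realb, if_true]
    push_cast at h1
    linarith
  · intro k
    simp only
    split_ifs
    · exact zero_le_one
    · exact hz0 _
  · intro k
    simp only
    split_ifs
    · exact one_le_mul_of_one_le_of_one_le P.one_le_boundA P.one_le_boundB
    · rw [boundA_mul_boundB]
      refine le_of_one_le_mul hd (hbd (Sum.inl k) _ P.one_le_rowAB fun i => ?_)
      refine le_trans ?_ (P.rowAB_le i)
      rw [← hsum i]
      have h1 : ∑ l ∈ Finset.univ.erase (Sum.inl k), |(M i l : ℝ)| ≤ ∑ l, |(M i l : ℝ)| :=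
        Finset.sum_le_sum_of_subset_of_nonneg (Finset.subset_univ _) fun _ _ _ => abs_nonneg _
      have h2 : ∑ l, |(M i l : ℝ)| =
          ∑ k, |((if k = j then 0 else P.A i k : ℤ) : ℝ)| + |(P.b i : ℝ)| := by
        simp [Fintype.sum_sum_type, M]
      linarith
  -- For `τ` Cramer's rule replaces the column `-b`, so the bound is free of `b`.
  · refine le_of_one_le_mul hd (hbd (Sum.inr ()) _ P.one_le_rowA fun i => ?_)
    have h2 : ∑ l ∈ Finset.univ.erase (Sum.inr ()), |(M i l : ℝ)| =
        ∑ k, |((if k = j then 0 else P.A i k : ℤ) : ℝ)| := by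
      have h3 := Finset.sum_erase_add Finset.univ (fun l => |(M i l : ℝ)|)
        (Finset.mem_univ (Sum.inr () : Fin n ⊕ Unit))
      simp only [Fintype.sum_sum_type, Finset.univ_unique, Finset.sum_singleton] at h3
      have h4 := add_right_cancel h3
      rw [h4]
      simp [M]
    rw [h2, hsum]
    linarith [P.rowA_le i]

/-- A bounded point of the cone over the dual feasible set with `s j = 1`. -/
theorem exists_normalized_dual {y₀ : Fin m → ℝ} {s₀ : Fin n → ℝ}
    (h0 : StrictDualFeasible P.realA P.realc y₀ s₀) (j : Fin n) :
    ∃ (y : Fin m → ℝ) (h : Fin n → ℝ) (τ : ℝ), P.realAᵀ *ᵥ y + h = τ • P.realc ∧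
      (∀ k, 0 ≤ h k) ∧ h j = 1 ∧ (∀ k, h k ≤ P.boundA * P.boundC) ∧ 0 ≤ τ ∧ τ ≤ P.boundA := by
  obtain ⟨hfeas, hs₀⟩ := h0
  let M : Matrix (Fin n) (Fin m ⊕ (Fin n ⊕ Unit)) ℤ := fun i => Sum.elim
    (fun k => P.A k i) (Sum.elim (fun k => if i = k ∧ k ≠ j then 1 else 0) fun _ => -P.c i)
  have hMl : ∀ i k, M i (Sum.inl k) = P.A k i := fun _ _ => rfl
  have hMm : ∀ i k, M i (Sum.inr (Sum.inl k)) = if i = k ∧ k ≠ j then 1 else 0 := fun _ _ => rfl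
  have hMr : ∀ i k, M i (Sum.inr (Sum.inr k)) = -P.c i := fun _ _ => rfl
  have hMv : ∀ (v : Fin m ⊕ (Fin n ⊕ Unit) → ℝ) i, (M.map (Int.cast : ℤ → ℝ) *ᵥ v) i =
      (P.realAᵀ *ᵥ fun k => v (Sum.inl k)) i + (if i = j then 0 else v (Sum.inr (Sum.inl i))) -
        v (Sum.inr (Sum.inr ())) * P.c i := by
    intro v i
    simp only [Matrix.mulVec, dotProduct, Fintype.sum_sum_type, Matrix.map_apply, hMl, hMm, hMr,
      Finset.univ_unique, Finset.sum_singleton, IntLO.realA, Matrix.transpose_apply]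
    rw [← add_assoc, sub_eq_add_neg]
    congr 1
    · congr 1
      rw [Finset.sum_eq_single i]
      · by_cases h : i = j <;> simp [h]
      · intro k _ hk
        simp [hk.symm]
      · simp
    · push_cast; rw [neg_mul, mul_comm]
  let v₀ : Fin m ⊕ (Fin n ⊕ Unit) → ℝ := Sum.elim (fun k => y₀ k / s₀ j)
    (Sum.elim (fun k => s₀ k / s₀ j) fun _ => 1 / s₀ j)
  have hv₀ : M.map (Int.cast : ℤ → ℝ) *ᵥ v₀ = fun i => ((if i = j then -1 else 0 : ℤ) : ℝ) := by
    funext i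
    rw [hMv]
    have h2 : (P.realAᵀ *ᵥ fun k => y₀ k / s₀ j) = (1 / s₀ j) • (P.realc - s₀) := by
      rw [← hfeas, add_sub_cancel_right, ← Matrix.mulVec_smul]
      congr 1; funext k; simp [div_eq_inv_mul]
    have := (hs₀ j).ne'
    simp only [v₀, Sum.elim_inl, Sum.elim_inr, h2, Pi.smul_apply, Pi.sub_apply, smul_eq_mul,
      IntLO.realc]
    split_ifs with h
    · subst h; push_cast; field_simp; ring
    · push_cast; field_simp; ring
  obtain ⟨d, z, hd, hz, -, hconf, -, -, hbd, -⟩ := exists_basic_solution M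
    (fun i => if i = j then -1 else 0) v₀ hv₀ ∅ Set.subsingleton_empty (by simp) (by simp)
  have hpos : ∀ k, 0 < v₀ (Sum.inr k) := by
    rintro (k | k)
    · exact div_pos (hs₀ k) (hs₀ j)
    · exact one_div_pos.2 (hs₀ j)
  have hz0 : ∀ k, 0 ≤ z (Sum.inr k) := fun k => nonneg_of_mul_nonneg_left (hconf _) (hpos k)
  -- The identity block, with column `j` deleted, and the right-hand side `-e_j` together contribute
  -- exactly 1 to each row.
  have hsum : ∀ i, ∑ k, |((if i = k ∧ k ≠ j then 1 else 0 : ℤ) : ℝ)| +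
      |((if i = j then -1 else 0 : ℤ) : ℝ)| = 1 := by
    intro i
    rw [Finset.sum_eq_single i]
    · by_cases h : i = j <;> simp [h]
    · intro k _ hk
      simp [hk.symm]
    · simp
  refine ⟨fun k => z (Sum.inl k), fun k => if k = j then 1 else z (Sum.inr (Sum.inl k)),
    z (Sum.inr (Sum.inr ())), ?_, ?_, by simp, ?_, hz0 _, ?_⟩
  · funext i
    have h1 := congrFun hz i
    rw [hMv] at h1
    simp only [Pi.add_apply, Pi.smul_apply, smul_eq_mul, IntLO.realc]
    split_ifs at h1 ⊢ <;> push_cast at h1 <;> linarith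
  · intro k
    simp only
    split_ifs
    · exact zero_le_one
    · exact hz0 _
  · intro k
    simp only
    split_ifs
    · exact one_le_mul_of_one_le_of_one_le P.one_le_boundA P.one_le_boundC
    · rw [boundA_mul_boundC]
      refine le_of_one_le_mul hd (hbd (Sum.inr (Sum.inl k)) _ P.one_le_colAC fun i => ?_)
      refine le_trans ?_ (P.colAC_le i)
      have h0 := hsum i
      have h1 : ∑ l ∈ Finset.univ.erase (Sum.inr (Sum.inl k)), |(M i l : ℝ)| ≤
          ∑ l, |(M i l : ℝ)| :=
        Finset.sum_le_sum_of_subset_of_nonneg (Finset.subset_univ _) fun _ _ _ => abs_nonneg _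
      have h2 : ∑ l, |(M i l : ℝ)| = ∑ k, |(P.A k i : ℝ)| +
          (∑ k, |((if i = k ∧ k ≠ j then 1 else 0 : ℤ) : ℝ)| + |(P.c i : ℝ)|) := by
        simp only [Fintype.sum_sum_type, M, Sum.elim_inl, Sum.elim_inr, Finset.univ_unique,
          Finset.sum_singleton, Int.cast_neg, abs_neg]
      linarith
  · rw [boundA_eq]
    refine le_of_one_le_mul hd (hbd (Sum.inr (Sum.inr ())) _ P.one_le_colA fun i => ?_)
    have h2 : ∑ l ∈ Finset.univ.erase (Sum.inr (Sum.inr ())), |(M i l : ℝ)| =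
        ∑ k, |(P.A k i : ℝ)| + ∑ k, |((if i = k ∧ k ≠ j then 1 else 0 : ℤ) : ℝ)| := by
      have h3 := Finset.sum_erase_add Finset.univ (fun l => |(M i l : ℝ)|)
        (Finset.mem_univ (Sum.inr (Sum.inr ()) : Fin m ⊕ (Fin n ⊕ Unit)))
      simp only [Fintype.sum_sum_type, Finset.univ_unique, Finset.sum_singleton] at h3
      rw [← add_assoc] at h3
      have h4 := add_right_cancel h3
      rw [h4]
      rfl
    rw [h2]
    linarith [P.colA_le i, hsum i]

/-- Basic optimal solutions on the primal side, with small corrections inside the optimal face. -/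
theorem exists_basic_primal {y₀ : Fin m → ℝ} {s₀ : Fin n → ℝ}
    (h0 : StrictDualFeasible P.realA P.realc y₀ s₀)
    {w : (Fin n → ℝ) × (Fin m → ℝ) × (Fin n → ℝ)}
    (hw : w ∈ optimalSet P.realA P.realb P.realc) {j : Fin n} (hj : 0 < w.1 j) :
    ∃ (d : ℝ) (x : Fin n → ℝ), 1 ≤ d ∧ d ≤ P.boundA ∧ P.realA *ᵥ x = P.realb ∧
      (∀ k, 0 ≤ x k) ∧ (∀ k, w.1 k = 0 → x k = 0) ∧ 1 ≤ d * x j ∧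
      (∀ k, x k ≤ P.boundA * P.boundB) ∧
      ∀ ζ : Fin n → ℝ, (∀ k, w.1 k ≠ 0 → ζ k = 0) →
        (∃ u₀, P.realA *ᵥ u₀ = P.realA *ᵥ ζ ∧ ∀ k, w.1 k = 0 → u₀ k = 0) →
        ∃ u, P.realA *ᵥ u = P.realA *ᵥ ζ ∧ (∀ k, w.1 k = 0 → u k = 0) ∧
          ∀ l, d * |u l| ≤ P.boundA * ∑ k, |ζ k| := by
  classical
  obtain ⟨hAx, hAy, hcomp, hx0, hs0⟩ := hw
  let M : Matrix (Fin m) (Fin n) ℤ := fun i k => if w.1 k = 0 then 0 else P.A i k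
  let W : Matrix (Fin m) (Fin n) ℤ := fun i k => if w.1 k = 0 then P.A i k else 0
  have hMv : ∀ v : Fin n → ℝ, (∀ k, w.1 k = 0 → v k = 0) →
      M.map (Int.cast : ℤ → ℝ) *ᵥ v = P.realA *ᵥ v := by
    intro v hv
    funext i
    simp only [Matrix.mulVec, dotProduct]
    refine Finset.sum_congr rfl fun k _ => ?_
    change ((M i k : ℤ) : ℝ) * v k = (P.A i k : ℝ) * v k
    by_cases hk : w.1 k = 0 <;> simp [M, hk, hv]
  have hWv : ∀ v : Fin n → ℝ, (∀ k, w.1 k ≠ 0 → v k = 0) →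
      W.map (Int.cast : ℤ → ℝ) *ᵥ v = P.realA *ᵥ v := by
    intro v hv
    funext i
    simp only [Matrix.mulVec, dotProduct]
    refine Finset.sum_congr rfl fun k _ => ?_
    change ((W i k : ℤ) : ℝ) * v k = (P.A i k : ℝ) * v k
    by_cases hk : w.1 k = 0 <;> simp [W, hk, hv]
  have hMle : ∀ i, ∑ k, |(M i k : ℝ)| ≤ ∑ k, |(P.A i k : ℝ)| := fun i =>
    Finset.sum_le_sum fun k _ => by by_cases hk : w.1 k = 0 <;> simp [M, hk]
  obtain ⟨d, x, hd, hx, hsupp, hconf, hF, hdle, hbd, hW⟩ := exists_basic_solution M P.b w.1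
    (by rw [hMv _ fun _ h => h, hAx]; rfl) {j} Set.subsingleton_singleton
    (by simpa using hj.ne') (by
      -- The optimal face is bounded: a ray `h` in it is orthogonal to `w.2.2` by complementarity
      -- and to `s₀ - w.2.2` by feasibility, hence to `s₀ > 0`.
      intro h hMh hsupp hconf i hi
      rw [Set.mem_singleton_iff] at hi
      subst hi
      rw [hMv h hsupp] at hMh
      have hh0 : ∀ k, 0 ≤ h k := fun k => by
        rcases (hx0 k).eq_or_lt with h1 | h1
        · rw [hsupp k h1.symm]
        · exact nonneg_of_mul_nonneg_left (hconf k) h1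
      have e1 : h ⬝ᵥ w.2.2 = 0 := by
        refine Finset.sum_eq_zero fun k _ => ?_
        have hk : w.1 k * w.2.2 k = 0 :=
          (Finset.sum_eq_zero_iff_of_nonneg fun k _ => mul_nonneg (hx0 k) (hs0 k)).1 hcomp k
            (Finset.mem_univ k)
        rcases mul_eq_zero.1 hk with h1 | h1
        · rw [hsupp k h1, zero_mul]
        · rw [h1, mul_zero]
      have e2 : h ⬝ᵥ (s₀ - w.2.2) = 0 :=
        dotProduct_eq_zero_of_mulVec_eq_zero (A := P.realA) (w := w.2.1 - y₀) hMh (by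
          rw [Matrix.mulVec_sub, eq_sub_of_add_eq hAy, eq_sub_of_add_eq h0.1]; abel)
      rw [dotProduct_sub, e1, sub_zero] at e2
      have e3 := (Finset.sum_eq_zero_iff_of_nonneg
        fun k _ => mul_nonneg (hh0 k) (h0.2 k).le).1 e2 i (Finset.mem_univ i)
      exact (mul_eq_zero.1 e3).resolve_right (h0.2 i).ne')
  have hxn : ∀ k, 0 ≤ x k := fun k => by
    rcases (hx0 k).eq_or_lt with h1 | h1
    · rw [hsupp k h1.symm]
    · exact nonneg_of_mul_nonneg_left (hconf k) h1
  refine ⟨d, x, hd, ?_, ?_, hxn, hsupp, ?_, ?_, ?_⟩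
  · exact hdle _ P.one_le_rowA fun i => (hMle i).trans (by linarith [P.rowA_le i])
  · rw [← hMv x hsupp, hx]; rfl
  · have := hF j rfl
    rwa [abs_of_nonneg (hxn j)] at this
  · intro k
    rw [boundA_mul_boundB]
    refine le_of_one_le_mul hd (hbd k _ P.one_le_rowAB fun i => ?_)
    refine le_trans (add_le_add (le_trans ?_ (hMle i)) le_rfl) (P.rowAB_le i)
    exact Finset.sum_le_sum_of_subset_of_nonneg (Finset.subset_univ _) fun _ _ _ => abs_nonneg _
  · rintro ζ hζ ⟨u₀, hu₀, hu₀s⟩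
    obtain ⟨u, hu, hul⟩ := hW W ζ _ P.one_le_rowA (fun i l => by
      refine le_trans ?_ (show ∑ k, |(P.A i k : ℝ)| ≤ _ by linarith [P.rowA_le i])
      rw [← Finset.sum_erase_add _ _ (Finset.mem_univ l),
        ← Finset.sum_erase_add (a := l) _ (fun k => |(P.A i k : ℝ)|) (Finset.mem_univ l), add_assoc]
      refine add_le_add (Finset.sum_le_sum fun k _ => ?_) ?_
      · by_cases hk : w.1 k = 0 <;> simp [M, hk]
      · by_cases hk : w.1 l = 0 <;> simp [M, W, hk])
      ⟨u₀, by rw [hMv u₀ hu₀s, hWv ζ hζ, hu₀]⟩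
    refine ⟨fun k => if w.1 k = 0 then 0 else u k, ?_, fun k hk => by simp [hk], fun l => ?_⟩
    · rw [← hWv ζ hζ, ← hu, ← hMv _ fun k hk => by simp [hk]]
      funext i
      simp only [Matrix.mulVec, dotProduct]
      refine Finset.sum_congr rfl fun k _ => ?_
      change ((M i k : ℤ) : ℝ) * _ = ((M i k : ℤ) : ℝ) * _
      by_cases hk : w.1 k = 0 <;> simp [M, hk]
    · refine le_trans ?_ (hul l)
      refine mul_le_mul_of_nonneg_left ?_ (by linarith)
      by_cases hk : w.1 l = 0 <;> simp [hk]

/-- Basic optimal solutions on the dual side, with small corrections inside the optimal face. -/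
theorem exists_basic_dual {x₀ : Fin n → ℝ} (hx₀ : ∀ k, 0 < x₀ k)
    (hAx₀ : P.realA *ᵥ x₀ = P.realb)
    {w : (Fin n → ℝ) × (Fin m → ℝ) × (Fin n → ℝ)}
    (hw : w ∈ optimalSet P.realA P.realb P.realc) {j : Fin n} (hj : 0 < w.2.2 j) :
    ∃ (d : ℝ) (y : Fin m → ℝ) (s : Fin n → ℝ), 1 ≤ d ∧ d ≤ P.boundA ∧
      P.realAᵀ *ᵥ y + s = P.realc ∧
      (∀ k, 0 ≤ s k) ∧ (∀ k, w.2.2 k = 0 → s k = 0) ∧ 1 ≤ d * s j ∧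
      (∀ k, s k ≤ P.boundA * P.boundC) ∧
      ∀ ζ : Fin n → ℝ,
        (∃ v₀ u₀, P.realAᵀ *ᵥ v₀ + u₀ = ζ ∧ ∀ k, w.2.2 k = 0 → u₀ k = 0) →
        ∃ v u, P.realAᵀ *ᵥ v + u = ζ ∧ (∀ k, w.2.2 k = 0 → u k = 0) ∧
          ∀ l, d * |u l| ≤ P.boundA * ∑ k, |ζ k| := by
  classical
  obtain ⟨hAx, hAy, hcomp, hx0, hs0⟩ := hw
  let M : Matrix (Fin n) (Fin m ⊕ Fin n) ℤ := fun i => Sum.elim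
    (fun k => P.A k i) (fun k => if i = k ∧ w.2.2 k ≠ 0 then 1 else 0)
  have hMl : ∀ i k, M i (Sum.inl k) = P.A k i := fun _ _ => rfl
  have hMr : ∀ i k, M i (Sum.inr k) = if i = k ∧ w.2.2 k ≠ 0 then 1 else 0 := fun _ _ => rfl
  let W : Matrix (Fin n) (Fin n) ℤ := fun i k => if i = k ∧ w.2.2 k = 0 then 1 else 0
  have hWe : ∀ i k, W i k = if i = k ∧ w.2.2 k = 0 then 1 else 0 := fun _ _ => rfl
  have hMv : ∀ v : Fin m ⊕ Fin n → ℝ, M.map (Int.cast : ℤ → ℝ) *ᵥ v =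
      (P.realAᵀ *ᵥ fun k => v (Sum.inl k)) +
        fun k => if w.2.2 k = 0 then 0 else v (Sum.inr k) := by
    intro v
    funext i
    simp only [Matrix.mulVec, dotProduct, Fintype.sum_sum_type, Matrix.map_apply, hMl, hMr,
      IntLO.realA, Matrix.transpose_apply, Pi.add_apply]
    congr 1
    rw [Finset.sum_eq_single i]
    · by_cases h : w.2.2 i = 0 <;> simp [h]
    · intro k _ hk
      simp [hk.symm]
    · simp
  have hWv : ∀ v : Fin n → ℝ, W.map (Int.cast : ℤ → ℝ) *ᵥ v =
      fun k => if w.2.2 k = 0 then v k else 0 := by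
    intro v
    funext i
    simp only [Matrix.mulVec, dotProduct, Matrix.map_apply, hWe]
    rw [Finset.sum_eq_single i]
    · by_cases h : w.2.2 i = 0 <;> simp [h]
    · intro k _ hk
      simp [hk.symm]
    · simp
  have hMW : ∀ i l, ∑ k, |(M i k : ℝ)| + |(W i l : ℝ)| ≤ 1 + ∑ k, |(P.A k i : ℝ)| := by
    intro i l
    rw [Fintype.sum_sum_type, add_assoc, add_comm]
    refine add_le_add ?_ le_rfl
    rw [Finset.sum_eq_single i]
    · by_cases h : w.2.2 i = 0
      · by_cases hil : i = l <;> simp [M, W, h, hil]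
        subst hil; simp [h]
      · by_cases hil : i = l <;> simp [M, W, h, hil]
        subst hil; simp [h]
    · intro k _ hk
      simp [M, hk.symm]
    · simp
  have hMle : ∀ i, ∑ k, |(M i k : ℝ)| ≤ 1 + ∑ k, |(P.A k i : ℝ)| := fun i => by
    have h1 := hMW i i
    linarith [abs_nonneg (W i i : ℝ)]
  obtain ⟨d, z, hd, hz, hsupp, hconf, hF, hdle, hbd, hW⟩ := exists_basic_solution M P.c
    (Sum.elim w.2.1 w.2.2)
    (by
      rw [hMv]
      have h1 : (fun k => if w.2.2 k = 0 then 0 else Sum.elim w.2.1 w.2.2 (Sum.inr k)) = w.2.2 := by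
        funext k
        by_cases h : w.2.2 k = 0 <;> simp [h]
      rw [h1]
      exact hAy)
    {Sum.inr j} Set.subsingleton_singleton (by simpa using hj.ne') (by
      -- The slack part of a ray in the dual optimal face is orthogonal to `w.1` and to `x₀ - w.1`,
      -- hence to `x₀ > 0`.
      intro h hMh hsupp hconf i hi
      rw [Set.mem_singleton_iff] at hi
      subst hi
      have hsup : ∀ k, w.2.2 k = 0 → h (Sum.inr k) = 0 := fun k hk => hsupp (Sum.inr k) hk
      have hh0 : ∀ k, 0 ≤ h (Sum.inr k) := fun k => by
        rcases (hs0 k).eq_or_lt with h1 | h1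
        · rw [hsup k h1.symm]
        · exact nonneg_of_mul_nonneg_left (hconf (Sum.inr k)) h1
      have h2 : P.realAᵀ *ᵥ (-fun k => h (Sum.inl k)) = fun k => h (Sum.inr k) := by
        rw [hMv] at hMh
        rw [Matrix.mulVec_neg, neg_eq_iff_add_eq_zero, ← hMh]
        congr 1
        funext k
        by_cases hk : w.2.2 k = 0 <;> simp [hk, hsup]
      have e1 : (x₀ - w.1) ⬝ᵥ (fun k => h (Sum.inr k)) = 0 :=
        dotProduct_eq_zero_of_mulVec_eq_zero (A := P.realA)
          (by rw [Matrix.mulVec_sub, hAx₀, hAx, sub_self]) h2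
      have e2 : w.1 ⬝ᵥ (fun k => h (Sum.inr k)) = 0 := by
        refine Finset.sum_eq_zero fun k _ => ?_
        have hk : w.1 k * w.2.2 k = 0 :=
          (Finset.sum_eq_zero_iff_of_nonneg fun k _ => mul_nonneg (hx0 k) (hs0 k)).1 hcomp k
            (Finset.mem_univ k)
        rcases mul_eq_zero.1 hk with h1 | h1
        · rw [h1, zero_mul]
        · simp only [hsup k h1, mul_zero]
      rw [sub_dotProduct, e2, sub_zero] at e1
      have e3 := (Finset.sum_eq_zero_iff_of_nonneg
        fun k _ => mul_nonneg (hx₀ k).le (hh0 k)).1 e1 j (Finset.mem_univ j)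
      exact (mul_eq_zero.1 e3).resolve_left (hx₀ j).ne')
  have hsup : ∀ k, w.2.2 k = 0 → z (Sum.inr k) = 0 := fun k hk => hsupp (Sum.inr k) hk
  have hxn : ∀ k, 0 ≤ z (Sum.inr k) := fun k => by
    rcases (hs0 k).eq_or_lt with h1 | h1
    · rw [hsup k h1.symm]
    · exact nonneg_of_mul_nonneg_left (hconf (Sum.inr k)) h1
  refine ⟨d, fun k => z (Sum.inl k), fun k => z (Sum.inr k), hd, ?_, ?_, hxn, hsup, ?_, ?_, ?_⟩
  · rw [boundA_eq]
    exact hdle _ P.one_le_colA fun i => (hMle i).trans (P.colA_le i)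
  · rw [hMv] at hz
    have h1 : (fun k => z (Sum.inr k)) = fun k => if w.2.2 k = 0 then 0 else z (Sum.inr k) := by
      funext k
      by_cases hk : w.2.2 k = 0 <;> simp [hk, hsup]
    rw [h1, hz]; rfl
  · have := hF (Sum.inr j) rfl
    rwa [abs_of_nonneg (hxn j)] at this
  · intro k
    rw [boundA_mul_boundC]
    refine le_of_one_le_mul hd (hbd (Sum.inr k) _ P.one_le_colAC fun i => ?_)
    refine le_trans (add_le_add (le_trans ?_ (hMle i)) le_rfl) (P.colAC_le i)
    exact Finset.sum_le_sum_of_subset_of_nonneg (Finset.subset_univ _) fun _ _ _ => abs_nonneg _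
  · rintro ζ ⟨v₀, u₀, hu₀, hu₀s⟩
    have hζ : (fun k => if w.2.2 k = 0 then ζ k else 0) =
        ζ - fun k => if w.2.2 k = 0 then 0 else ζ k := by
      funext k
      by_cases hk : w.2.2 k = 0 <;> simp [hk]
    -- Only the part of `ζ` where `w.2.2` vanishes needs a linear system; the rest is absorbed by
    -- the free slacks at cost `d * |ζ l|`, and `d ≤ boundA`.
    obtain ⟨u, hu, hul⟩ := hW W (fun k => if w.2.2 k = 0 then ζ k else 0) _ P.one_le_colA
      (fun i l => (hMW i l).trans (P.colA_le i))
      ⟨Sum.elim v₀ fun k => if w.2.2 k = 0 then 0 else u₀ k - ζ k, by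
        rw [hMv, hWv]
        funext k
        have := congrFun hu₀ k
        by_cases hk : w.2.2 k = 0
        · simpa [hk, hu₀s] using this
        · simp only [Pi.add_apply] at this
          simp only [Pi.add_apply, Sum.elim_inl, Sum.elim_inr, if_neg hk]
          linarith⟩
    rw [hMv, hWv] at hu
    refine ⟨fun k => u (Sum.inl k), fun k => if w.2.2 k = 0 then 0 else u (Sum.inr k) + ζ k, ?_,
      fun k hk => by simp [hk], fun l => ?_⟩
    · funext k
      have := congrFun hu k
      by_cases hk : w.2.2 k = 0
      · simpa [hk] using this
      · simp only [Pi.add_apply, if_neg hk] at this ⊢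
        linarith
    · have hbA := P.one_le_boundA
      by_cases hl : w.2.2 l = 0
      · simp only [hl, if_true, abs_zero, mul_zero]
        exact mul_nonneg (by linarith) (Finset.sum_nonneg fun _ _ => abs_nonneg _)
      · simp only [hl, if_false]
        have h1 := hul (Sum.inr l)
        rw [← boundA_eq] at h1
        have h2 : d * |ζ l| ≤ P.boundA * |ζ l| := mul_le_mul_of_nonneg_right (by
          rw [boundA_eq]
          exact hdle _ P.one_le_colA fun i => (hMle i).trans (P.colA_le i)) (abs_nonneg _)
        have h3 : ∑ k, |if w.2.2 k = 0 then ζ k else 0| + |ζ l| ≤ ∑ k, |ζ k| := by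
          rw [← Finset.sum_erase_add _ _ (Finset.mem_univ l),
            ← Finset.sum_erase_add (a := l) _ (fun k => |ζ k|) (Finset.mem_univ l)]
          refine add_le_add ?_ le_rfl
          rw [if_neg hl, abs_zero, add_zero]
          refine Finset.sum_le_sum fun k _ => ?_
          by_cases hk : w.2.2 k = 0 <;> simp [hk]
        calc d * |u (Sum.inr l) + ζ l| ≤ d * (|u (Sum.inr l)| + |ζ l|) :=
              mul_le_mul_of_nonneg_left (abs_add_le _ _) (by linarith)
          _ = d * |u (Sum.inr l)| + d * |ζ l| := mul_add _ _ _
          _ ≤ P.boundA * ∑ k, |if w.2.2 k = 0 then ζ k else 0| + P.boundA * |ζ l| :=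
              add_le_add h1 h2
          _ = P.boundA * (∑ k, |if w.2.2 k = 0 then ζ k else 0| + |ζ l|) := by ring
          _ ≤ _ := mul_le_mul_of_nonneg_left h3 (by linarith)

end

end IntLO

/-! ### Bit length, and sizes of points near the central path -/

namespace IntLO

variable {m n : ℕ} (P : IntLO m n)

theorem one_add_abs_le_two_pow_clog (a : ℤ) :
    1 + |(a : ℝ)| ≤ (2 : ℝ) ^ Nat.clog 2 (a.natAbs + 1) := by
  have h := Nat.le_pow_clog (b := 2) one_lt_two (a.natAbs + 1)
  have h2 : ((a.natAbs + 1 : ℕ) : ℝ) ≤ ((2 ^ Nat.clog 2 (a.natAbs + 1) : ℕ) : ℝ) := by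
    exact_mod_cast h
  push_cast at h2
  rw [Nat.cast_natAbs, Int.cast_abs] at h2
  linarith

theorem boundA_le : P.boundA ≤ 2 ^ ∑ i, ∑ j, Nat.clog 2 ((P.A i j).natAbs + 1) := by
  rw [← Finset.prod_pow_eq_pow_sum]
  refine Finset.prod_le_prod (fun i _ => zero_le_one.trans (P.one_le_rowA i)) fun i _ => ?_
  rw [← Finset.prod_pow_eq_pow_sum]
  exact Finset.prod_le_prod (fun j _ => by positivity) fun j _ => one_add_abs_le_two_pow_clog _

theorem boundB_le : P.boundB ≤ 2 ^ ∑ i, Nat.clog 2 ((P.b i).natAbs + 1) := by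
  rw [← Finset.prod_pow_eq_pow_sum]
  exact Finset.prod_le_prod (fun j _ => by positivity) fun j _ => one_add_abs_le_two_pow_clog _

theorem boundC_le : P.boundC ≤ 2 ^ ∑ j, Nat.clog 2 ((P.c j).natAbs + 1) := by
  rw [← Finset.prod_pow_eq_pow_sum]
  exact Finset.prod_le_prod (fun j _ => by positivity) fun j _ => one_add_abs_le_two_pow_clog _

/-- The logarithms in `L` already pay for the three products; the summand `m n + m + n` remains as a
reserve for powers of `n`. -/
theorem two_pow_mul_bounds_le :
    (2 : ℝ) ^ (m * n + m + n) * (P.boundA * P.boundB * P.boundC) ≤ 2 ^ P.L := by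
  have hA := P.one_le_boundA
  have hB := P.one_le_boundB
  have hC := P.one_le_boundC
  have h1 : P.boundA * P.boundC * P.boundB ≤ _ :=
    mul_le_mul (mul_le_mul P.boundA_le P.boundC_le (by linarith) (by positivity)) P.boundB_le
      (by linarith) (by positivity)
  have hL : (2 : ℝ) ^ P.L = 2 ^ (m * n + m + n) *
      ((2 ^ ∑ i, ∑ j, Nat.clog 2 ((P.A i j).natAbs + 1)) *
        (2 ^ ∑ j, Nat.clog 2 ((P.c j).natAbs + 1)) *
        2 ^ ∑ i, Nat.clog 2 ((P.b i).natAbs + 1)) := by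
    rw [IntLO.L, pow_add, pow_add, pow_add (2 : ℝ) (m * n + m + n)]
    ring
  rw [hL]
  refine mul_le_mul_of_nonneg_left ?_ (by positivity)
  linarith

theorem eight_mul_sq_le (n : ℕ) : 8 * n ^ 2 ≤ 2 ^ (2 * n + 1) := by
  cases n with
  | zero => simp
  | succ k =>
    have h1 : k + 1 ≤ 2 ^ k := Nat.lt_two_pow_self
    calc 8 * (k + 1) ^ 2 ≤ 8 * (2 ^ k) ^ 2 := by gcongr
      _ = 2 ^ (2 * (k + 1) + 1) := by ring

theorem two_pow_dim_le (hm : 0 < m) : (2 : ℝ) ^ (2 * n + 1) ≤ 2 ^ (m * n + m + n) := by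
  refine pow_le_pow_right₀ one_le_two ?_
  nlinarith

/-- Since `m ≥ 1`, the reserve is at least `2 n + 1` bits, and `8 n² ≤ 2^(2n+1)`. Most later
estimates use `L` in this form: the powers of `n` come from summing over coordinates, the 8 is
numerical slack. -/
theorem sq_mul_bounds_le (hm : 0 < m) :
    (n : ℝ) ^ 2 * (P.boundA * P.boundB * P.boundC) ≤ 2 ^ P.L / 8 := by
  have h1 := P.two_pow_mul_bounds_le
  have h2 := two_pow_dim_le (n := n) hm
  have h3 : (8 : ℝ) * n ^ 2 ≤ 2 ^ (2 * n + 1) := by exact_mod_cast eight_mul_sq_le n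
  have h4 : 0 < P.boundA * P.boundB * P.boundC := by
    have hA := P.one_le_boundA
    have hB := P.one_le_boundB
    have hC := P.one_le_boundC
    positivity
  nlinarith

theorem two_le_boundA (hm : 0 < m) (hA : P.realA.rank = m) : 2 ≤ P.boundA := by
  obtain ⟨i, j, hij⟩ : ∃ i j, P.A i j ≠ 0 := by
    by_contra h
    push Not at h
    have : P.realA = 0 := by ext i j; simp [realA, h i j]
    rw [this, Matrix.rank_zero] at hA
    omega
  have h1 : (1 : ℝ) ≤ |(P.A i j : ℝ)| := by
    rw [← Int.cast_abs]; exact_mod_cast Int.one_le_abs hij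
  have h2 := P.rowA_le i
  have h3 : |(P.A i j : ℝ)| ≤ ∑ j, |(P.A i j : ℝ)| :=
    Finset.single_le_sum (f := fun j => |(P.A i j : ℝ)|) (fun _ _ => abs_nonneg _)
      (Finset.mem_univ j)
  have h4 := Finset.prod_comp_le_of_one_le (f := fun _ : Unit => i)
    (fun _ _ _ => Subsingleton.elim _ _) P.one_le_rowA
  simp only [Finset.univ_unique, Finset.prod_singleton] at h4
  have h5 : ∏ j, (1 + |(P.A i j : ℝ)|) ≤ P.boundA := h4
  linarith

/-- Full row rank forces a nonzero entry of `A`, which adds one bit to the `2 n + 1` of the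
dimensions. In particular `L ≥ 4`. -/
theorem le_length (hm : 0 < m) (hA : P.realA.rank = m) : 2 * n + 2 ≤ P.L := by
  have h1 := P.two_pow_mul_bounds_le
  have h2 := two_pow_dim_le (n := n) hm
  have h3 := P.two_le_boundA hm hA
  have hB := P.one_le_boundB
  have hC := P.one_le_boundC
  have h4 : 2 ≤ P.boundA * P.boundB * P.boundC := by
    have := one_le_mul_of_one_le_of_one_le hB hC
    rw [mul_assoc]
    nlinarith
  have h5 : (2 : ℝ) ^ (2 * n + 2) ≤ 2 ^ P.L := by
    have h6 : (2 : ℝ) ^ (2 * n + 2) = 2 ^ (2 * n + 1) * 2 := by ring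
    rw [h6]
    exact (mul_le_mul h2 h4 (by norm_num) (by positivity)).trans h1
  exact (pow_le_pow_iff_right₀ one_lt_two).1 h5

theorem dim_pos (hm : 0 < m) (hA : P.realA.rank = m) : 0 < n := by
  have := P.realA.rank_le_width
  omega

variable {P}

/-- Both halves of `w` are replaced by basic ones whose supports only shrink, so complementarity
survives. A half without positive entries is already zero. -/
theorem exists_bounded_optimal {y₀ : Fin m → ℝ} {s₀ : Fin n → ℝ}
    (h0 : StrictDualFeasible P.realA P.realc y₀ s₀) {x₀ : Fin n → ℝ} (hx₀ : ∀ k, 0 < x₀ k)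
    (hAx₀ : P.realA *ᵥ x₀ = P.realb) {w : (Fin n → ℝ) × (Fin m → ℝ) × (Fin n → ℝ)}
    (hw : w ∈ optimalSet P.realA P.realb P.realc) :
    ∃ v ∈ optimalSet P.realA P.realb P.realc, (∀ k, v.1 k ≤ P.boundA * P.boundB) ∧
      ∀ k, v.2.2 k ≤ P.boundA * P.boundC := by
  have hA := P.one_le_boundA
  have hB := P.one_le_boundB
  have hC := P.one_le_boundC
  have hcomp : ∀ k, w.1 k = 0 ∨ w.2.2 k = 0 := fun k => mul_eq_zero.1
    ((Finset.sum_eq_zero_iff_of_nonneg fun k _ => mul_nonneg (hw.2.2.2.1 k) (hw.2.2.2.2 k)).1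
      hw.2.2.1 k (Finset.mem_univ k))
  obtain ⟨x, hx1, hx2, hx3, hx4⟩ : ∃ x : Fin n → ℝ, P.realA *ᵥ x = P.realb ∧ (∀ k, 0 ≤ x k) ∧
      (∀ k, w.1 k = 0 → x k = 0) ∧ ∀ k, x k ≤ P.boundA * P.boundB := by
    by_cases h : ∃ j, 0 < w.1 j
    · obtain ⟨j, hj⟩ := h
      obtain ⟨d, x, -, -, h1, h2, h3, -, h4, -⟩ := P.exists_basic_primal h0 hw hj
      exact ⟨x, h1, h2, h3, h4⟩
    · push Not at h
      exact ⟨w.1, hw.1, hw.2.2.2.1, fun _ h => h, fun k => (h k).trans (by positivity)⟩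
  obtain ⟨y, s, hs1, hs2, hs3, hs4⟩ : ∃ (y : Fin m → ℝ) (s : Fin n → ℝ),
      P.realAᵀ *ᵥ y + s = P.realc ∧ (∀ k, 0 ≤ s k) ∧
      (∀ k, w.2.2 k = 0 → s k = 0) ∧ ∀ k, s k ≤ P.boundA * P.boundC := by
    by_cases h : ∃ j, 0 < w.2.2 j
    · obtain ⟨j, hj⟩ := h
      obtain ⟨d, y, s, -, -, h1, h2, h3, -, h4, -⟩ := P.exists_basic_dual hx₀ hAx₀ hw hj
      exact ⟨y, s, h1, h2, h3, h4⟩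
    · push Not at h
      exact ⟨w.2.1, w.2.2, hw.2.1, hw.2.2.2.2, fun _ h => h, fun k => (h k).trans (by positivity)⟩
  refine ⟨(x, y, s), ⟨hx1, hs1, Finset.sum_eq_zero fun k _ => ?_, hx2, hs2⟩, hx4, hs4⟩
  rcases hcomp k with h | h
  · simp [hx3 k h]
  · simp [hs3 k h]

theorem abs_dotProduct_le_of_le {r x : Fin n → ℝ} {R X : ℝ} (hr : ∀ j, |r j| ≤ R)
    (hx0 : ∀ j, 0 ≤ x j) (hx : ∀ j, x j ≤ X) : |x ⬝ᵥ r| ≤ n * (X * R) := by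
  refine (Finset.abs_sum_le_sum_abs _ _).trans ?_
  calc ∑ j, |x j * r j| ≤ ∑ _j : Fin n, X * R := by
        refine Finset.sum_le_sum fun j _ => ?_
        rw [abs_mul, abs_of_nonneg (hx0 j)]
        exact mul_le_mul (hx j) (hr j) (abs_nonneg _) ((hx0 j).trans (hx j))
    _ = _ := by simp

theorem dotProduct_le_of_le {r x : Fin n → ℝ} {R X : ℝ} (hr0 : ∀ j, 0 ≤ r j) (hr : ∀ j, r j ≤ R)
    (hx0 : ∀ j, 0 ≤ x j) (hx : ∀ j, x j ≤ X) : x ⬝ᵥ r ≤ n * (X * R) :=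
  (le_abs_self _).trans (abs_dotProduct_le_of_le (fun j => by rw [abs_of_nonneg (hr0 j)]; exact hr j)
    hx0 hx)

theorem apply_mul_le_dotProduct {u v : Fin n → ℝ} (hu : ∀ j, 0 ≤ u j) (hv : ∀ j, 0 ≤ v j)
    (j : Fin n) : u j * v j ≤ u ⬝ᵥ v :=
  Finset.single_le_sum (f := fun j => u j * v j) (fun i _ => mul_nonneg (hu i) (hv i))
    (Finset.mem_univ j)

/-- The arithmetic behind `primalPoint_le_and_slack_le`. -/
theorem bound_arith {N a b c G g μ R X : ℝ} (hN : 1 ≤ N) (ha : 1 ≤ a) (hb : 1 ≤ b) (hc : 1 ≤ c)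
    (hG : N ^ 2 * (a * b * c) ≤ G / 8) (hg : G ≤ g) (hμ0 : 0 < μ) (hμ : μ ≤ g)
    (hR0 : 0 ≤ R) (hR : R * G ≤ 1 / 4)
    (hX : X ≤ N * (a * b * (a * c)) +
      a * (3 / 2 * N * μ + N * (X * R) + N * (a * b * R))) :
    N * (a * b * (a * c)) + a * (3 / 2 * N * μ + N * (X * R) + N * (a * b * R)) ≤ G * g / 4 := by
  have hab : 1 ≤ a * b := one_le_mul_of_one_le_of_one_le ha hb
  have habc : 1 ≤ a * b * c := one_le_mul_of_one_le_of_one_le hab hc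
  have hp : a * b ≤ a * b * c := le_mul_of_one_le_right (by linarith) hc
  have hap : a ≤ a * b * c := (le_mul_of_one_le_right (by linarith) hb).trans hp
  have hN2 : N ≤ N ^ 2 := by nlinarith
  have h1 : N * (a * b * c) ≤ G / 8 := le_trans (mul_le_mul_of_nonneg_right hN2 (by linarith)) hG
  have h2 : N * a ≤ G / 8 := le_trans (mul_le_mul_of_nonneg_left hap (by linarith)) h1
  have h3 : a * b * c ≤ G / 8 := le_trans (le_mul_of_one_le_left (by linarith) hN) h1
  have hG8 : 8 ≤ G := by linarith
  have hG0 : 0 ≤ G / 8 := by linarith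
  have t1 : N * (a * b * (a * c)) ≤ G * g / 64 := by
    calc N * (a * b * (a * c)) = (N * a) * (a * b * c) := by ring
      _ ≤ (G / 8) * (G / 8) := mul_le_mul h2 h3 (by linarith) hG0
      _ ≤ _ := by nlinarith
  have t2 : a * (3 / 2 * N * μ) ≤ 3 / 16 * (G * g) := by
    calc a * (3 / 2 * N * μ) = 3 / 2 * ((N * a) * μ) := by ring
      _ ≤ 3 / 2 * ((G / 8) * g) :=
        mul_le_mul_of_nonneg_left (mul_le_mul h2 hμ hμ0.le hG0) (by norm_num)
      _ = _ := by ring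
  have hNaR : N * a * R ≤ 1 / 32 := by nlinarith
  have hNaR0 : 0 ≤ N * a * R := by positivity
  have t3 : N * a * R * (a * b) ≤ G * g / 256 := by
    calc N * a * R * (a * b) ≤ 1 / 32 * (G / 8) :=
          mul_le_mul hNaR (hp.trans h3) (by linarith) (by norm_num)
      _ ≤ _ := by nlinarith
  have hGg : 0 ≤ G * g := by nlinarith
  have e : N * (a * b * (a * c)) + a * (3 / 2 * N * μ + N * (X * R) + N * (a * b * R)) =
      N * (a * b * (a * c)) + a * (3 / 2 * N * μ) + N * a * R * X + N * a * R * (a * b) := by ring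
  rw [e] at hX ⊢
  rcases le_total X 0 with hX0 | hX0
  · have : N * a * R * X ≤ 0 := mul_nonpos_of_nonneg_of_nonpos hNaR0 hX0
    linarith
  · have : N * a * R * X ≤ 1 / 32 * X := mul_le_mul_of_nonneg_right hNaR hX0
    linarith

/-- Size bounds for points near the central path of a slightly perturbed problem. -/
theorem primalPoint_le_and_slack_le (hm : 0 < m) (hA : P.realA.rank = m)
    {w : (Fin n → ℝ) × (Fin m → ℝ) × (Fin n → ℝ)}
    (hw : w ∈ optimalSet P.realA P.realb P.realc) {y₀ : Fin m → ℝ} {s₀ : Fin n → ℝ}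
    (h0 : StrictDualFeasible P.realA P.realc y₀ s₀) {y : Fin m → ℝ} {s r : Fin n → ℝ} {μ g R : ℝ}
    (hfeas : StrictDualFeasible P.realA (P.realc + r) y s) (hμ : 0 < μ)
    (hδ : proximity P.realA P.realb s μ < 1 / 2) (hg : (2 : ℝ) ^ P.L ≤ g) (hμg : μ ≤ g)
    (hr : ∀ j, |r j| ≤ R) (hR : R * 2 ^ P.L ≤ 1 / 4) (j : Fin n) :
    primalPoint P.realA P.realb s μ j ≤ 2 ^ P.L * g / 4 ∧ s j ≤ 2 ^ P.L * g / 4 := by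
  obtain ⟨hAy, hs⟩ := hfeas
  set x := primalPoint P.realA P.realb s μ with hxdef
  have hAx : P.realA *ᵥ x = P.realb := mulVec_primalPoint hA hs hμ
  have hx : ∀ j, 0 < x j := primalPoint_pos hs hμ hδ
  have hxs : x ⬝ᵥ s ≤ 3 / 2 * n * μ := primalPoint_dotProduct_le hs hμ hδ
  obtain ⟨v, ⟨hv1, hv2, hv3, hv4, hv5⟩, hvx, hvs⟩ := exists_bounded_optimal h0 hx hAx hw
  have hR0 : 0 ≤ R := (abs_nonneg _).trans (hr j)
  have hbA := P.one_le_boundA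
  have hbB := P.one_le_boundB
  have hbC := P.one_le_boundC
  -- The bound for `x k` contains `x ⬝ᵥ r`, hence the maximum `X` itself; its coefficient `n *
  -- boundA * R` is at most `1/32`, so the inequality can be solved for `X`.
  obtain ⟨jm, -, hjm⟩ := Finset.exists_max_image Finset.univ x ⟨j, Finset.mem_univ j⟩
  set X := x jm with hX
  have hxX : ∀ k, x k ≤ X := fun k => hjm k (Finset.mem_univ k)
  have hxr := abs_le.1 (abs_dotProduct_le_of_le hr (fun k => (hx k).le) hxX)
  have hvr := abs_le.1 (abs_dotProduct_le_of_le hr hv4 hvx)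
  have hn : (1 : ℝ) ≤ n := by exact_mod_cast P.dim_pos hm hA
  have hXR : 0 ≤ (n : ℝ) * (X * R) := by have := hx jm; positivity
  have hsr : P.realAᵀ *ᵥ y = P.realc + r - s := eq_sub_of_add_eq hAy
  have hmain : ∀ k, x k ≤ n * (P.boundA * P.boundB * (P.boundA * P.boundC)) + P.boundA *
      (3 / 2 * n * μ + n * (X * R) + n * (P.boundA * P.boundB * R)) := by
    intro k
    obtain ⟨y', h, τ, hy', hh0, hhk, hhle, hτ0, hτ⟩ := P.exists_normalized_dual h0 k
    -- Both `h` and `τ (s - r)` are slacks for the objective `τ c`. As `h k = 1`, `x k ≤ x ⬝ᵥ h`,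
    -- and orthogonality expresses this by the gap, the perturbation and the bounded solution `v`.
    have e1 : (x - v.1) ⬝ᵥ (h - τ • (s - r)) = 0 :=
      dotProduct_eq_zero_of_mulVec_eq_zero (A := P.realA) (w := τ • y - y')
        (by rw [Matrix.mulVec_sub, hAx, hv1, sub_self]) (by
          rw [Matrix.mulVec_sub, Matrix.mulVec_smul, hsr, eq_sub_of_add_eq hy']
          module)
    simp only [sub_dotProduct, dotProduct_sub, dotProduct_smul, smul_eq_mul] at e1
    have e2 := apply_mul_le_dotProduct (fun k => (hx k).le) hh0 k
    rw [hhk, mul_one] at e2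
    have e3 := dotProduct_le_of_le hh0 hhle hv4 hvx
    have e4 : 0 ≤ v.1 ⬝ᵥ s := Finset.sum_nonneg fun k _ => mul_nonneg (hv4 k) (hs k).le
    have e5 : τ * (x ⬝ᵥ s - x ⬝ᵥ r - (v.1 ⬝ᵥ s - v.1 ⬝ᵥ r)) ≤ P.boundA *
        (3 / 2 * n * μ + n * (X * R) + n * (P.boundA * P.boundB * R)) := by
      refine (mul_le_mul_of_nonneg_left (b := x ⬝ᵥ s - x ⬝ᵥ r - (v.1 ⬝ᵥ s - v.1 ⬝ᵥ r))
        (c := 3 / 2 * n * μ + n * (X * R) + n * (P.boundA * P.boundB * R)) ?_ hτ0).trans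
        (mul_le_mul_of_nonneg_right hτ (by positivity))
      linarith [hxr.1, hvr.2]
    linarith
  have harith := bound_arith hn hbA hbB hbC (P.sq_mul_bounds_le hm) hg hμ hμg hR0 hR (hmain jm)
  refine ⟨(hmain j).trans harith, ?_⟩
  obtain ⟨q, τ, hq, hq0, hqj, hqle, hτ0, hτ⟩ := P.exists_normalized_primal hx hAx j
  refine le_trans ?_ harith
  have e1 : (q - τ • x) ⬝ᵥ (s - r - v.2.2) = 0 :=
    dotProduct_eq_zero_of_mulVec_eq_zero (A := P.realA) (w := v.2.1 - y)
      (by rw [Matrix.mulVec_sub, Matrix.mulVec_smul, hAx, hq, sub_self]) (by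
        rw [Matrix.mulVec_sub, hsr, eq_sub_of_add_eq hv2]
        abel)
  simp only [sub_dotProduct, dotProduct_sub, smul_dotProduct, smul_eq_mul] at e1
  have e2 := apply_mul_le_dotProduct hq0 (fun k => (hs k).le) j
  rw [hqj, one_mul] at e2
  have e3 := dotProduct_le_of_le hv5 hvs hq0 hqle
  have e4 : 0 ≤ x ⬝ᵥ v.2.2 := Finset.sum_nonneg fun k _ => mul_nonneg (hx k).le (hv5 k)
  have e6 := abs_le.1 (abs_dotProduct_le_of_le hr hq0 hqle)
  have e5 : τ * (x ⬝ᵥ s - x ⬝ᵥ r - x ⬝ᵥ v.2.2) ≤ P.boundA * (3 / 2 * n * μ + n * (X * R)) := by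
    refine (mul_le_mul_of_nonneg_left (b := x ⬝ᵥ s - x ⬝ᵥ r - x ⬝ᵥ v.2.2)
      (c := 3 / 2 * n * μ + n * (X * R)) ?_ hτ0).trans
      (mul_le_mul_of_nonneg_right hτ (by positivity))
    linarith [hxr.1]
  have e7 : n * (P.boundA * P.boundB * R) ≤ P.boundA * (n * (P.boundA * P.boundB * R)) :=
    le_mul_of_one_le_left (by positivity) hbA
  linarith [e6.2]

/-- Near the central path the variables that vanish at optimality are small. -/
theorem gap_bound {x y s r : _} {μ R Γ : ℝ} {w : (Fin n → ℝ) × (Fin m → ℝ) × (Fin n → ℝ)}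
    (hw : w ∈ optimalSet P.realA P.realb P.realc)
    (hfeas : StrictDualFeasible P.realA (P.realc + r) y s)
    (hx : StrictPrimalFeasible P.realA P.realb x) (hxs : x ⬝ᵥ s ≤ 3 / 2 * n * μ)
    (hr : ∀ j, |r j| ≤ R) (hxΓ : ∀ j, x j ≤ Γ) (hwΓ : ∀ j, w.1 j ≤ Γ)
    (hRΓ : Γ * R ≤ 1 / 20 * μ) (j : Fin n) :
    x j * w.2.2 j ≤ 8 / 5 * n * μ ∧ w.1 j * s j ≤ 8 / 5 * n * μ := by
  obtain ⟨h1, h2, h3, h4, h5⟩ := hw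
  -- This reads `x ⬝ᵥ w.2.2 + w.1 ⬝ᵥ s = x ⬝ᵥ s - (x - w.1) ⬝ᵥ r`: `3/2` from the gap and twice
  -- `1/20` from `r` make `8/5`.
  have e1 : (x - w.1) ⬝ᵥ (s - r - w.2.2) = 0 :=
    dotProduct_eq_zero_of_mulVec_eq_zero (A := P.realA) (w := w.2.1 - y)
      (by rw [Matrix.mulVec_sub, hx.1, h1, sub_self]) (by
        rw [Matrix.mulVec_sub, eq_sub_of_add_eq hfeas.1, eq_sub_of_add_eq h2]
        abel)
  simp only [sub_dotProduct, dotProduct_sub, h3] at e1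
  have hx0 : ∀ j, 0 ≤ x j := fun j => (hx.2 j).le
  have hs0 : ∀ j, 0 ≤ s j := fun j => (hfeas.2 j).le
  have a1 := abs_le.1 (abs_dotProduct_le_of_le hr hx0 hxΓ)
  have a2 := abs_le.1 (abs_dotProduct_le_of_le hr h4 hwΓ)
  have a3 : (n : ℝ) * (Γ * R) ≤ n * (1 / 20 * μ) :=
    mul_le_mul_of_nonneg_left hRΓ (Nat.cast_nonneg n)
  have b1 := apply_mul_le_dotProduct hx0 h5 j
  have b2 := apply_mul_le_dotProduct h4 hs0 j
  have c1 : 0 ≤ x ⬝ᵥ w.2.2 := Finset.sum_nonneg fun k _ => mul_nonneg (hx0 k) (h5 k)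
  have c2 : 0 ≤ w.1 ⬝ᵥ s := Finset.sum_nonneg fun k _ => mul_nonneg (h4 k) (hs0 k)
  constructor <;> linarith [a1.1, a2.2]

end IntLO

/-! ### The optimal partition -/

section Partition

variable {m n : ℕ} {A : Matrix (Fin m) (Fin n) ℝ} {b : Fin m → ℝ} {c : Fin n → ℝ}

/-- Orthogonality makes the nonnegative mixed products `v.1 ⬝ᵥ w.2.2` and `w.1 ⬝ᵥ v.2.2` sum to
zero. So one strictly complementary solution determines the partition. -/
theorem optimalSet_mul_eq_zero {v w : (Fin n → ℝ) × (Fin m → ℝ) × (Fin n → ℝ)}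
    (hv : v ∈ optimalSet A b c) (hw : w ∈ optimalSet A b c) (j : Fin n) :
    v.1 j * w.2.2 j = 0 := by
  obtain ⟨v1, v2, v3, v4, v5⟩ := hv
  obtain ⟨w1, w2, w3, w4, w5⟩ := hw
  have e1 : (v.1 - w.1) ⬝ᵥ (v.2.2 - w.2.2) = 0 :=
    dotProduct_eq_zero_of_mulVec_eq_zero (A := A) (w := w.2.1 - v.2.1)
      (by rw [Matrix.mulVec_sub, v1, w1, sub_self]) (by
        rw [Matrix.mulVec_sub, eq_sub_of_add_eq v2, eq_sub_of_add_eq w2]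
        abel)
  simp only [sub_dotProduct, dotProduct_sub, v3, w3] at e1
  have b1 := IntLO.apply_mul_le_dotProduct v4 w5 j
  have c2 : 0 ≤ w.1 ⬝ᵥ v.2.2 := Finset.sum_nonneg fun k _ => mul_nonneg (w4 k) (v5 k)
  exact le_antisymm (by linarith) (mul_nonneg (v4 j) (w5 j))

variable {w : (Fin n → ℝ) × (Fin m → ℝ) × (Fin n → ℝ)}

theorem mem_partB_iff (hw : w ∈ optimalSet A b c) (hsc : ∀ j, 0 < w.1 j ∨ 0 < w.2.2 j)
    (j : Fin n) : j ∈ partB A b c ↔ 0 < w.1 j := by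
  refine ⟨fun ⟨v, hv, hj⟩ => ?_, fun h => ⟨w, hw, h⟩⟩
  refine (hsc j).resolve_right fun h => ?_
  have := optimalSet_mul_eq_zero hv hw j
  exact (mul_pos hj h).ne' this

theorem mem_partN_iff (hw : w ∈ optimalSet A b c) (hsc : ∀ j, 0 < w.1 j ∨ 0 < w.2.2 j)
    (j : Fin n) : j ∈ partN A b c ↔ 0 < w.2.2 j := by
  refine ⟨fun ⟨v, hv, hj⟩ => ?_, fun h => ⟨w, hw, h⟩⟩
  refine (hsc j).resolve_left fun h => ?_
  have := optimalSet_mul_eq_zero hw hv j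
  exact (mul_pos h hj).ne' this

end Partition

/-! ### The least squares projection -/

section LeastSquares

variable {m n : ℕ}

/-- Orthogonal projection onto the affine set of the rounding procedure: Pythagoras. -/
theorem exists_nearest_point (A : Matrix (Fin m) (Fin n) ℝ) (b : Fin m → ℝ) (c : Fin n → ℝ)
    (I J : Set (Fin n)) (x s : Fin n → ℝ) (S : Set ((Fin n → ℝ) × (Fin m → ℝ) × (Fin n → ℝ)))
    (hS : ∀ w, w ∈ S ↔ A *ᵥ w.1 = b ∧ Aᵀ *ᵥ w.2.1 + w.2.2 = c ∧ (∀ j ∈ I, w.2.2 j = 0) ∧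
      ∀ j ∈ J, w.1 j = 0) (hne : S.Nonempty) :
    ∃ w ∈ S, ∀ w' ∈ S, l2norm (w'.1 - x) ^ 2 + l2norm (w'.2.2 - s) ^ 2 =
      l2norm (w.1 - x) ^ 2 + l2norm (w.2.2 - s) ^ 2 +
        (l2norm (w'.1 - w.1) ^ 2 + l2norm (w'.2.2 - w.2.2) ^ 2) := by
  obtain ⟨w₀, hw₀⟩ := hne
  rw [hS] at hw₀
  obtain ⟨h1, h2, h3, h4⟩ := hw₀
  -- Direction space of the constraints in the `(x, s)` variables. The objective ignores `y`, which
  -- therefore enters only existentially.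
  let V : Submodule ℝ (EuclideanSpace ℝ (Fin n ⊕ Fin n)) :=
    { carrier := {v | A *ᵥ (fun j => v (Sum.inl j)) = 0 ∧
        (∃ y, Aᵀ *ᵥ y + (fun j => v (Sum.inr j)) = 0) ∧ (∀ j ∈ I, v (Sum.inr j) = 0) ∧
        ∀ j ∈ J, v (Sum.inl j) = 0}
      add_mem' := by
        rintro u v ⟨u1, ⟨y, u2⟩, u3, u4⟩ ⟨v1, ⟨z, v2⟩, v3, v4⟩
        refine ⟨?_, ⟨y + z, ?_⟩, fun j hj => ?_, fun j hj => ?_⟩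
        · have : (fun j => (u + v) (Sum.inl j)) = (fun j => u (Sum.inl j)) + fun j => v (Sum.inl j) :=
            rfl
          rw [this, Matrix.mulVec_add, u1, v1, add_zero]
        · have : (fun j => (u + v) (Sum.inr j)) = (fun j => u (Sum.inr j)) + fun j => v (Sum.inr j) :=
            rfl
          rw [this, Matrix.mulVec_add, add_add_add_comm, u2, v2, add_zero]
        · simp [u3 j hj, v3 j hj]
        · simp [u4 j hj, v4 j hj]
      zero_mem' := by
        refine ⟨?_, ⟨0, ?_⟩, fun j _ => rfl, fun j _ => rfl⟩
        · exact Matrix.mulVec_zero A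
        · rw [Matrix.mulVec_zero, zero_add]; rfl
      smul_mem' := by
        rintro a v ⟨v1, ⟨z, v2⟩, v3, v4⟩
        refine ⟨?_, ⟨a • z, ?_⟩, fun j hj => ?_, fun j hj => ?_⟩
        · have : (fun j => (a • v) (Sum.inl j)) = a • fun j => v (Sum.inl j) := rfl
          rw [this, Matrix.mulVec_smul, v1, smul_zero]
        · have : (fun j => (a • v) (Sum.inr j)) = a • fun j => v (Sum.inr j) := rfl
          rw [this, Matrix.mulVec_smul, ← smul_add, v2, smul_zero]
        · simp [v3 j hj]
        · simp [v4 j hj] }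
  let p : EuclideanSpace ℝ (Fin n ⊕ Fin n) := WithLp.toLp 2 (Sum.elim (x - w₀.1) (s - w₀.2.2))
  obtain ⟨v, hv, z, hz, hvz⟩ := V.exists_add_mem_mem_orthogonal p
  obtain ⟨v1, ⟨y, v2⟩, v3, v4⟩ := hv
  refine ⟨(w₀.1 + fun j => v (Sum.inl j), w₀.2.1 + y, w₀.2.2 + fun j => v (Sum.inr j)), ?_, ?_⟩
  · rw [hS]
    refine ⟨?_, ?_, fun j hj => ?_, fun j hj => ?_⟩
    · rw [Matrix.mulVec_add, h1, v1, add_zero]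
    · rw [Matrix.mulVec_add, add_add_add_comm, h2, v2, add_zero]
    · simp [h3 j hj, v3 j hj]
    · simp [h4 j hj, v4 j hj]
  · intro w' hw'
    rw [hS] at hw'
    obtain ⟨k1, k2, k3, k4⟩ := hw'
    let u : EuclideanSpace ℝ (Fin n ⊕ Fin n) :=
      WithLp.toLp 2 (Sum.elim (w'.1 - w₀.1) (w'.2.2 - w₀.2.2)) - v
    have hu : u ∈ V := by
      refine V.sub_mem ⟨?_, ⟨w'.2.1 - w₀.2.1, ?_⟩, fun j hj => ?_, fun j hj => ?_⟩
        ⟨v1, ⟨y, v2⟩, v3, v4⟩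
      · change A *ᵥ (w'.1 - w₀.1) = 0
        rw [Matrix.mulVec_sub, k1, h1, sub_self]
      · change Aᵀ *ᵥ (w'.2.1 - w₀.2.1) + (w'.2.2 - w₀.2.2) = 0
        rw [Matrix.mulVec_sub, eq_sub_of_add_eq k2, eq_sub_of_add_eq h2]; abel
      · simp [k3 j hj, h3 j hj]
      · simp [k4 j hj, h4 j hj]
    have horth := (Submodule.mem_orthogonal V z).1 hz u hu
    have hzv : z = p - v := by rw [hvz]; abel
    rw [hzv] at horth
    have e1 : ∑ j, (w'.1 j - w₀.1 j - v (Sum.inl j)) * (x j - w₀.1 j - v (Sum.inl j)) +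
        ∑ j, (w'.2.2 j - w₀.2.2 j - v (Sum.inr j)) * (s j - w₀.2.2 j - v (Sum.inr j)) = 0 := by
      rw [← horth]
      simp only [PiLp.inner_apply, Fintype.sum_sum_type, u, p]
      simp [mul_comm]
    simp only [l2norm_sq, Pi.sub_apply, Pi.add_apply]
    -- `(a - q)² = (p - q)² + (a - p)² - 2 (a - p)(q - p)` with `p = a₀ + t`; the cross terms of the
    -- two blocks cancel by `e1`.
    have key : ∀ a a₀ t q : Fin n → ℝ, ∑ j, (a j - q j) ^ 2 = ∑ j, (a₀ j + t j - q j) ^ 2 +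
        ∑ j, (a j - (a₀ j + t j)) ^ 2 - 2 * ∑ j, (a j - a₀ j - t j) * (q j - a₀ j - t j) := by
      intro a a₀ t q
      rw [Finset.mul_sum, ← Finset.sum_add_distrib, ← Finset.sum_sub_distrib]
      exact Finset.sum_congr rfl fun j _ => by ring
    rw [key w'.1 w₀.1 (fun j => v (Sum.inl j)) x, key w'.2.2 w₀.2.2 (fun j => v (Sum.inr j)) s]
    linarith

/-- If `x'` is not farther from `x` than `x + u` on `I`, and they agree off `I`, then `x'` is
entrywise close to `x` on `I`. -/
theorem abs_sub_le_sum_of_l2norm_le {x x' x₂ u : Fin n → ℝ} {I : Set (Fin n)}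
    (h : l2norm (x' - x) ^ 2 ≤ l2norm (x₂ - x) ^ 2) (hI : ∀ j ∈ I, x₂ j = x j + u j)
    (hI' : ∀ j ∉ I, x' j = x₂ j) {i : Fin n} (hi : i ∈ I) : |x' i - x i| ≤ ∑ j, |u j| := by
  classical
  rw [l2norm_sq, l2norm_sq] at h
  have h1 : ∀ v : Fin n → ℝ, ∑ j, v j ^ 2 =
      ∑ j ∈ Finset.univ.filter (· ∈ I), v j ^ 2 + ∑ j ∈ Finset.univ.filter (· ∉ I), v j ^ 2 :=
    fun v => (Finset.sum_filter_add_sum_filter_not _ _ _).symm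
  rw [h1, h1 (x₂ - x)] at h
  have h2 : ∑ j ∈ Finset.univ.filter (· ∉ I), (x' - x) j ^ 2 =
      ∑ j ∈ Finset.univ.filter (· ∉ I), (x₂ - x) j ^ 2 :=
    Finset.sum_congr rfl fun j hj => by
      rw [Pi.sub_apply, Pi.sub_apply, hI' j (Finset.mem_filter.1 hj).2]
  have h3 : ∑ j ∈ Finset.univ.filter (· ∈ I), (x₂ - x) j ^ 2 ≤ ∑ j, u j ^ 2 := by
    calc _ = ∑ j ∈ Finset.univ.filter (· ∈ I), u j ^ 2 :=
          Finset.sum_congr rfl fun j hj => by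
            rw [Pi.sub_apply, hI j (Finset.mem_filter.1 hj).2, add_sub_cancel_left]
      _ ≤ _ := Finset.sum_le_sum_of_subset_of_nonneg (Finset.subset_univ _)
          fun _ _ _ => sq_nonneg _
  have h4 : (x' i - x i) ^ 2 ≤ ∑ j ∈ Finset.univ.filter (· ∈ I), (x' - x) j ^ 2 :=
    Finset.single_le_sum (f := fun j => (x' - x) j ^ 2) (fun _ _ => sq_nonneg _)
      (Finset.mem_filter.2 ⟨Finset.mem_univ i, hi⟩)
  have h5 : (x' i - x i) ^ 2 ≤ l2norm u ^ 2 := by rw [l2norm_sq]; linarith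
  exact (abs_le_of_sq_le_sq h5 (l2norm_nonneg u)).trans (l2norm_le_sum_abs u)

end LeastSquares

/-! ### Rounding to an optimal solution -/

namespace IntLO

variable {m n : ℕ} {P : IntLO m n}

/-- The arithmetic behind the positivity of the rounded solution. -/
theorem rounding_arith {N a p G μ d x T U : ℝ} (hN : 1 ≤ N) (ha : 1 ≤ a) (hap : a ≤ p)
    (hG : N ^ 2 * p ≤ G / 8) (hμ0 : 0 < μ) (hμ : μ * G ^ 2 ≤ 1) (hd : 1 ≤ d)
    (hx : 5 ≤ d * x * (16 * N)) (hT : T ≤ N * (83 / 50 * N * μ * a)) (hU : d * U ≤ N * (a * T)) :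
    U < x := by
  have h1 : N ^ 2 * a ≤ G / 8 := le_trans (mul_le_mul_of_nonneg_left hap (by positivity)) hG
  have h0 : 0 ≤ N ^ 2 * a := by positivity
  have h2 : (N ^ 2 * a) ^ 2 ≤ (G / 8) ^ 2 := pow_le_pow_left₀ h0 h1 2
  have h3 : d * U ≤ 83 / 50 * N ^ 3 * a ^ 2 * μ := by
    have : N * (a * T) ≤ N * (a * (N * (83 / 50 * N * μ * a))) := by gcongr
    calc d * U ≤ _ := hU
      _ ≤ _ := this
      _ = _ := by ring
  have h4 : (d * U) * (16 * N) ≤ 16 * 83 / 50 * ((N ^ 2 * a) ^ 2 * μ) := by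
    calc (d * U) * (16 * N) ≤ (83 / 50 * N ^ 3 * a ^ 2 * μ) * (16 * N) :=
          mul_le_mul_of_nonneg_right h3 (by linarith)
      _ = _ := by ring
  have h5 : (N ^ 2 * a) ^ 2 * μ ≤ 1 / 64 := by
    calc (N ^ 2 * a) ^ 2 * μ ≤ (G / 8) ^ 2 * μ := mul_le_mul_of_nonneg_right h2 hμ0.le
      _ = μ * G ^ 2 / 64 := by ring
      _ ≤ _ := by linarith
  -- `16 · 83/50 · 1/64 < 5`. The same `d` stands on both sides, so it cancels without being
  -- estimated.
  have h6 : (d * U) * (16 * N) < d * x * (16 * N) := by linarith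
  have h7 : d * U < d * x := lt_of_mul_lt_mul_right h6 (by linarith)
  exact lt_of_mul_lt_mul_left h7 (by linarith)

/-- The excess in Pythagoras vanishes only if `x` and `s` agree; injectivity of `Aᵀ` then fixes `y`.
-/
theorem isRounding_iff_of_pythagoras (hA : P.realA.rank = m) {x s : Fin n → ℝ}
    {q : (Fin n → ℝ) × (Fin m → ℝ) × (Fin n → ℝ)} (hq : q ∈ P.roundingConstraints s)
    (hpyth : ∀ w' ∈ P.roundingConstraints s, l2norm (w'.1 - x) ^ 2 + l2norm (w'.2.2 - s) ^ 2 =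
      l2norm (q.1 - x) ^ 2 + l2norm (q.2.2 - s) ^ 2 +
        (l2norm (w'.1 - q.1) ^ 2 + l2norm (w'.2.2 - q.2.2) ^ 2))
    (w' : (Fin n → ℝ) × (Fin m → ℝ) × (Fin n → ℝ)) : P.IsRounding x s w' ↔ w' = q := by
  constructor
  · rintro ⟨hmin, hw'⟩
    have h1 := hpyth w' hw'
    have h2 : l2norm (w'.1 - x) ^ 2 + l2norm (w'.2.2 - s) ^ 2 ≤
      l2norm (q.1 - x) ^ 2 + l2norm (q.2.2 - s) ^ 2 := hmin hq
    have n1 := sq_nonneg (l2norm (w'.1 - q.1))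
    have n2 := sq_nonneg (l2norm (w'.2.2 - q.2.2))
    have h3 : l2norm (w'.1 - q.1) ^ 2 = 0 := by linarith
    have h4 : l2norm (w'.2.2 - q.2.2) ^ 2 = 0 := by linarith
    have hz : ∀ u : Fin n → ℝ, l2norm u ^ 2 = 0 → u = 0 := fun u hu => by
      funext j
      have := abs_le_l2norm u j
      rw [pow_eq_zero_iff two_ne_zero] at hu
      rw [hu] at this
      exact abs_nonpos_iff.1 this
    have h5 : w'.1 = q.1 := sub_eq_zero.1 (hz _ h3)
    have h6 : w'.2.2 = q.2.2 := sub_eq_zero.1 (hz _ h4)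
    have h7 : w'.2.1 = q.2.1 := by
      refine sub_eq_zero.1 (Matrix.transpose_mulVec_eq_zero_of_rank hA ?_)
      have h8 := hw'.2.1
      rw [h6, ← hq.2.1] at h8
      rw [Matrix.mulVec_sub, add_right_cancel h8, sub_self]
    exact Prod.ext h5 (Prod.ext h7 h6)
  · rintro rfl
    refine ⟨fun v hv => ?_, hq⟩
    have h1 := hpyth v hv
    have n1 := sq_nonneg (l2norm (v.1 - w'.1))
    have n2 := sq_nonneg (l2norm (v.2.2 - w'.2.2))
    change l2norm (w'.1 - x) ^ 2 + l2norm (w'.2.2 - s) ^ 2 ≤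
      l2norm (v.1 - x) ^ 2 + l2norm (v.2.2 - s) ^ 2
    linarith

theorem IsRounding.le {x s a c : Fin n → ℝ} {b : Fin m → ℝ}
    {q : (Fin n → ℝ) × (Fin m → ℝ) × (Fin n → ℝ)} (h : P.IsRounding x s q)
    (hv : (a, b, c) ∈ P.roundingConstraints s) :
    l2norm (q.1 - x) ^ 2 + l2norm (q.2.2 - s) ^ 2 ≤ l2norm (a - x) ^ 2 + l2norm (c - s) ^ 2 := by
  have h1 := isMinOn_iff.1 h.1 _ hv
  dsimp only at h1
  exact h1

set_option maxHeartbeats 1000000 in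
/-- The rounding procedure, applied near the end of the central path. -/
theorem rounding_spec (hm : 0 < m) (hA : P.realA.rank = m)
    {w : (Fin n → ℝ) × (Fin m → ℝ) × (Fin n → ℝ)}
    (hw : w ∈ optimalSet P.realA P.realb P.realc) (hsc : ∀ j, 0 < w.1 j ∨ 0 < w.2.2 j)
    {y₀ : Fin m → ℝ} {s₀ : Fin n → ℝ} (h0 : StrictDualFeasible P.realA P.realc y₀ s₀)
    {y : Fin m → ℝ} {s r x : Fin n → ℝ} {μ R Γ : ℝ}
    (hfeas : StrictDualFeasible P.realA (P.realc + r) y s) (hμ : 0 < μ)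
    (hδ : proximity P.realA P.realb s μ < 1 / 2) (hμG : μ ≤ P.stopTol)
    (hr : ∀ j, |r j| ≤ R)
    (hxdef : x = primalPoint P.realA P.realb s μ) (hxΓ : ∀ j, x j ≤ Γ)
    (hΓ : (2 : ℝ) ^ P.L ≤ Γ) (hRΓ : Γ * R ≤ 1 / 20 * μ) :
    (∀ j, s j < P.roundTol ↔ j ∈ partB P.realA P.realb P.realc) ∧
      (∀ j, x j < P.roundTol ↔ j ∈ partN P.realA P.realb P.realc) ∧
      (∃! w, P.IsRounding x s w) ∧
      ∀ w, P.IsRounding x s w → w ∈ optimalSet P.realA P.realb P.realc := by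
  have hs := hfeas.2
  have hAx : P.realA *ᵥ x = P.realb := hxdef ▸ mulVec_primalPoint hA hs hμ
  have hx : ∀ j, 0 < x j := hxdef ▸ primalPoint_pos hs hμ hδ
  have hxs : x ⬝ᵥ s ≤ 3 / 2 * n * μ := hxdef ▸ primalPoint_dotProduct_le hs hμ hδ
  have hcen : ∀ j, μ / 2 ≤ s j * x j := fun j => hxdef ▸ (mul_primalPoint_bounds hs hμ hδ j).1
  have hbA := P.one_le_boundA
  have hbB := P.one_le_boundB
  have hbC := P.one_le_boundC
  have hn : (1 : ℝ) ≤ n := by exact_mod_cast P.dim_pos hm hA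
  have hR0 : 0 ≤ R := by
    have hn0 := P.dim_pos hm hA
    exact (abs_nonneg _).trans (hr ⟨0, hn0⟩)
  set G : ℝ := 2 ^ P.L with hGdef
  have hG0 : 0 < G := by positivity
  have hG1 : 1 ≤ G := one_le_pow₀ one_le_two
  have hround : P.roundTol = 1 / G := by
    rw [roundTol, Real.rpow_neg zero_le_two, Real.rpow_natCast, one_div]
  have hTol : P.stopTol = 1 / G ^ 2 := by
    rw [stopTol, show -2 * (P.L : ℝ) = -((P.L * 2 : ℕ) : ℝ) by push_cast; ring,
      Real.rpow_neg zero_le_two, Real.rpow_natCast, pow_mul, one_div]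
  have hμG2 : μ * G ^ 2 ≤ 1 := by
    rw [hTol] at hμG
    rwa [le_div_iff₀ (by positivity)] at hμG
  have hsize := P.sq_mul_bounds_le hm (n := n)
  rw [← hGdef] at hsize
  have hab : 1 ≤ P.boundA * P.boundB := one_le_mul_of_one_le_of_one_le hbA hbB
  have hp : P.boundA * P.boundB ≤ P.boundA * P.boundB * P.boundC :=
    le_mul_of_one_le_right (by linarith) hbC
  have hap : P.boundA ≤ P.boundA * P.boundB * P.boundC :=
    (le_mul_of_one_le_right (by linarith) hbB).trans hp
  have hN2 : (n : ℝ) ≤ n ^ 2 := by nlinarith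
  have hNp : n * (P.boundA * P.boundB * P.boundC) ≤ G / 8 :=
    le_trans (mul_le_mul_of_nonneg_right hN2 (by linarith)) hsize
  have hNa : n * P.boundA ≤ G / 8 := le_trans (mul_le_mul_of_nonneg_left hap (by linarith)) hNp
  have hpG : P.boundA * P.boundB ≤ Γ := by
    have := le_mul_of_one_le_left (show 0 ≤ P.boundA * P.boundB * P.boundC by linarith) hn
    linarith
  have hcomp : ∀ k, w.1 k = 0 ∨ w.2.2 k = 0 := fun k =>
    mul_eq_zero.1 (optimalSet_mul_eq_zero hw hw k)
  have hBN : ∀ k, w.2.2 k = 0 ↔ 0 < w.1 k := fun k =>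
    ⟨fun h => (hsc k).resolve_right (by rw [h]; exact lt_irrefl _),
      fun h => (hcomp k).resolve_left h.ne'⟩
  have hNB : ∀ k, w.1 k = 0 ↔ 0 < w.2.2 k := fun k =>
    ⟨fun h => (hsc k).resolve_left (by rw [h]; exact lt_irrefl _),
      fun h => (hcomp k).resolve_right h.ne'⟩
  obtain ⟨v, hv, hvx, hvs⟩ := exists_bounded_optimal h0 hx hAx hw
  -- basic optimal solutions for the two parts, and the resulting estimates
  have hB : ∀ j, 0 < w.1 j → ∃ d, 1 ≤ d ∧ d ≤ P.boundA ∧ s j ≤ d * (8 / 5 * n * μ) ∧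
      5 ≤ d * x j * (16 * n) ∧ ∀ ζ : Fin n → ℝ, (∀ k, w.1 k ≠ 0 → ζ k = 0) →
        (∃ u₀, P.realA *ᵥ u₀ = P.realA *ᵥ ζ ∧ ∀ k, w.1 k = 0 → u₀ k = 0) →
        ∃ u, P.realA *ᵥ u = P.realA *ᵥ ζ ∧ (∀ k, w.1 k = 0 → u k = 0) ∧
          ∀ l, d * |u l| ≤ P.boundA * ∑ k, |ζ k| := by
    intro j hj
    obtain ⟨d, x', hd, hdA, hx1, hx2, hx3, hx4, hx5, hu⟩ := P.exists_basic_primal h0 hw hj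
    have hopt : (x', w.2.1, w.2.2) ∈ optimalSet P.realA P.realb P.realc := by
      refine ⟨hx1, hw.2.1, Finset.sum_eq_zero fun k _ => ?_, hx2, hw.2.2.2.2⟩
      rcases hcomp k with h | h
      · simp [hx3 k h]
      · simp [h]
    have hgap := (gap_bound hopt hfeas ⟨hAx, hx⟩ hxs hr hxΓ (fun k => (hx5 k).trans hpG) hRΓ j).2
    have hsj : s j ≤ d * (8 / 5 * n * μ) := by
      calc s j ≤ (d * x' j) * s j := le_mul_of_one_le_left (hs j).le hx4
        _ = d * (x' j * s j) := by ring
        _ ≤ _ := mul_le_mul_of_nonneg_left hgap (by linarith)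
    refine ⟨d, hd, hdA, hsj, ?_, hu⟩
    -- Centrality turns the upper bound for `s j` into a lower bound for `x j`: `μ / 2 ≤ s j x j ≤ d
    -- (8/5) n μ x j`.
    have h1 := (hcen j).trans (mul_le_mul_of_nonneg_right hsj (hx j).le)
    have h2 : μ * 5 ≤ μ * (d * x j * (16 * n)) := by linarith
    exact le_of_mul_le_mul_left h2 hμ
  have hN : ∀ j, 0 < w.2.2 j → ∃ d, 1 ≤ d ∧ d ≤ P.boundA ∧ x j ≤ d * (8 / 5 * n * μ) ∧
      5 ≤ d * s j * (16 * n) ∧ ∀ ζ : Fin n → ℝ,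
        (∃ v₀ u₀, P.realAᵀ *ᵥ v₀ + u₀ = ζ ∧ ∀ k, w.2.2 k = 0 → u₀ k = 0) →
        ∃ v u, P.realAᵀ *ᵥ v + u = ζ ∧ (∀ k, w.2.2 k = 0 → u k = 0) ∧
          ∀ l, d * |u l| ≤ P.boundA * ∑ k, |ζ k| := by
    intro j hj
    obtain ⟨d, y', s', hd, hdA, hx1, hx2, hx3, hx4, -, hu⟩ := P.exists_basic_dual hx hAx hw hj
    have hopt : (v.1, y', s') ∈ optimalSet P.realA P.realb P.realc := by
      refine ⟨hv.1, hx1, Finset.sum_eq_zero fun k _ => ?_, hv.2.2.2.1, hx2⟩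
      rcases mul_eq_zero.1 (optimalSet_mul_eq_zero hv hw k) with h | h
      · simp [h]
      · simp [hx3 k h]
    have hgap := (gap_bound hopt hfeas ⟨hAx, hx⟩ hxs hr hxΓ (fun k => (hvx k).trans hpG) hRΓ j).1
    have hsj : x j ≤ d * (8 / 5 * n * μ) := by
      calc x j ≤ (d * s' j) * x j := le_mul_of_one_le_left (hx j).le hx4
        _ = d * (x j * s' j) := by ring
        _ ≤ _ := mul_le_mul_of_nonneg_left hgap (by linarith)
    refine ⟨d, hd, hdA, hsj, ?_, hu⟩
    have h1 := (hcen j).trans (mul_le_mul_of_nonneg_left hsj (hs j).le)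
    have h2 : μ * 5 ≤ μ * (d * s j * (16 * n)) := by linarith
    exact le_of_mul_le_mul_left h2 hμ
  -- small and large entries
  have hsmall : ∀ d t : ℝ, d ≤ P.boundA → t ≤ d * (8 / 5 * n * μ) → t < 1 / G := by
    intro d t hd ht
    rw [lt_div_iff₀ hG0]
    have h1 : d * (8 / 5 * n * μ) ≤ P.boundA * (8 / 5 * n * μ) :=
      mul_le_mul_of_nonneg_right hd (by positivity)
    have h2 : P.boundA * (8 / 5 * n * μ) ≤ 8 / 5 * (G / 8) * μ := by
      have := mul_le_mul_of_nonneg_right hNa hμ.le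
      linarith
    have h3 : t * G ≤ (8 / 5 * (G / 8) * μ) * G :=
      mul_le_mul_of_nonneg_right (ht.trans (h1.trans h2)) hG0.le
    have h4 : (8 / 5 * (G / 8) * μ) * G = 1 / 5 * (μ * G ^ 2) := by ring
    linarith
  -- Small entries are at most `1 / (5 G)` and large ones at least `5 / (2 G)`, so `1 / G` separates
  -- them.
  have hlarge : ∀ d t : ℝ, d ≤ P.boundA → 0 < t → 5 ≤ d * t * (16 * n) → 1 / G ≤ t := by
    intro d t hd ht h
    rw [div_le_iff₀ hG0]
    have h1 : d * t * (16 * n) ≤ P.boundA * t * (16 * n) := by gcongr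
    have h2 : (n * P.boundA) * t ≤ G / 8 * t := mul_le_mul_of_nonneg_right hNa ht.le
    linarith
  have hsB : ∀ j, s j < P.roundTol ↔ 0 < w.1 j := by
    intro j
    rw [hround]
    constructor
    · intro hlt
      refine (hsc j).resolve_right fun hj => ?_
      obtain ⟨d, -, hd, -, h5, -⟩ := hN j hj
      exact absurd hlt (not_lt.2 (hlarge d _ hd (hs j) h5))
    · intro hj
      obtain ⟨d, -, hd, h4, -⟩ := hB j hj
      exact hsmall d _ hd h4
  have hxN : ∀ j, x j < P.roundTol ↔ 0 < w.2.2 j := by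
    intro j
    rw [hround]
    constructor
    · intro hlt
      refine (hsc j).resolve_left fun hj => ?_
      obtain ⟨d, -, hd, -, h5, -⟩ := hB j hj
      exact absurd hlt (not_lt.2 (hlarge d _ hd (hx j) h5))
    · intro hj
      obtain ⟨d, -, hd, h4, -⟩ := hN j hj
      exact hsmall d _ hd h4
  have hsN : ∀ j, P.roundTol ≤ s j ↔ w.1 j = 0 := by
    intro j
    rw [← not_lt, hsB, not_lt]
    exact ⟨fun h => le_antisymm h (hw.2.2.2.1 j), fun h => h.le⟩
  -- the least squares problem
  have hSiff : ∀ w', w' ∈ P.roundingConstraints s ↔ P.realA *ᵥ w'.1 = P.realb ∧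
      P.realAᵀ *ᵥ w'.2.1 + w'.2.2 = P.realc ∧ (∀ j ∈ {j | w.2.2 j = 0}, w'.2.2 j = 0) ∧
      ∀ j ∈ {j | w.1 j = 0}, w'.1 j = 0 := by
    intro w'
    simp only [roundingConstraints, Set.mem_ofPred_eq, hsB, hsN, hBN]
  have hwS : w ∈ P.roundingConstraints s :=
    (hSiff w).2 ⟨hw.1, hw.2.1, fun _ h => h, fun _ h => h⟩
  obtain ⟨q, hq, hpyth⟩ := exists_nearest_point P.realA P.realb P.realc _ _ x s _ hSiff ⟨w, hwS⟩
  have hqS := (hSiff q).1 hq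
  obtain ⟨q1, q2, q3, q4⟩ := hqS
  have hrq := isRounding_iff_of_pythagoras hA hq hpyth
  have hround_q : P.IsRounding x s q := (hrq q).2 rfl
  have huniq : ∀ w', P.IsRounding x s w' → w' = q := fun w' => (hrq w').1
  have hnsum : ∀ (u : Fin n → ℝ) (d B : ℝ), (∀ l, d * |u l| ≤ B) → d * ∑ l, |u l| ≤ n * B := by
    intro u d B h
    rw [Finset.mul_sum]
    calc ∑ l, d * |u l| ≤ ∑ _l : Fin n, B := Finset.sum_le_sum fun l _ => h l
      _ = n * B := by simp
  -- Together with the `8/5` from small entries this stays below the `83/50` used for `ζ`.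
  have hRμ : R ≤ 1 / 20 * (n * μ * P.boundA) := by
    have h1 : R ≤ Γ * R := le_mul_of_one_le_left hR0 (hG1.trans hΓ)
    have h2 : μ ≤ n * μ * P.boundA := by
      calc μ = 1 * μ * 1 := by ring
        _ ≤ _ := by gcongr
    linarith
  have hqx : ∀ i, 0 < w.1 i → 0 < q.1 i := by
    classical
    intro i hi
    obtain ⟨d, hd, hdA, -, h5, hu⟩ := hB i hi
    -- Competitor for the projection: drop the entries of `x` outside `B` and repair `A x = b` by a
    -- small `u` supported on `B`. The constraints on `x` and on `(y, s)` are independent, so it may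
    -- be paired with the slacks of `q`.
    let ζ : Fin n → ℝ := fun k => if w.1 k = 0 then x k else 0
    have hxζ : x - ζ = fun k => if w.1 k = 0 then 0 else x k := by
      funext k; by_cases h : w.1 k = 0 <;> simp [ζ, h]
    obtain ⟨u, hu1, hu2, hu3⟩ := hu ζ (fun k hk => by simp [ζ, hk]) ⟨w.1 - (x - ζ), by
      rw [Matrix.mulVec_sub, Matrix.mulVec_sub, hw.1, hAx]; abel, fun k hk => by
      rw [hxζ]; simp [hk]⟩
    have hcand : (x - ζ + u, q.2.1, q.2.2) ∈ P.roundingConstraints s := by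
      refine (hSiff _).2 ⟨?_, q2, q3, fun k hk => ?_⟩
      · rw [Matrix.mulVec_add, Matrix.mulVec_sub, hAx, hu1, sub_add_cancel]
      · rw [Set.mem_ofPred_eq] at hk
        rw [hxζ]; simp [hk, hu2]
    have hmin : l2norm (q.1 - x) ^ 2 + l2norm (q.2.2 - s) ^ 2 ≤
      l2norm (x - ζ + u - x) ^ 2 + l2norm (q.2.2 - s) ^ 2 := hround_q.le hcand
    have hclose := abs_sub_le_sum_of_l2norm_le (I := {k | w.1 k ≠ 0}) (u := u)
      (show l2norm (q.1 - x) ^ 2 ≤ l2norm (x - ζ + u - x) ^ 2 by linarith)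
      (fun k hk => by rw [hxζ]; simp only [Set.mem_ofPred_eq] at hk; simp [hk])
      (fun k hk => by
        simp only [Set.mem_ofPred_eq, not_not] at hk
        rw [q4 k hk, hxζ]; simp [hk, hu2]) (show i ∈ {k | w.1 k ≠ 0} from hi.ne')
    have hT : ∑ k, |ζ k| ≤ n * (83 / 50 * n * μ * P.boundA) := by
      calc ∑ k, |ζ k| ≤ ∑ _k : Fin n, 83 / 50 * n * μ * P.boundA := by
            refine Finset.sum_le_sum fun k _ => ?_
            have hnn : 0 ≤ n * μ * P.boundA := by positivity
            by_cases hk : w.1 k = 0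
            · obtain ⟨d', -, hd', h', -⟩ := hN k ((hNB k).1 hk)
              simp only [ζ, hk, if_true]
              rw [abs_of_pos (hx k)]
              have := mul_le_mul_of_nonneg_right hd' (show 0 ≤ 8 / 5 * n * μ by positivity)
              linarith
            · simp only [ζ, hk, if_false, abs_zero]; linarith
        _ = _ := by simp
    have hlt := rounding_arith hn hbA hap hsize hμ hμG2 hd h5 hT (hnsum u d _ hu3)
    linarith [(abs_le.1 hclose).1]
  have hqs : ∀ i, 0 < w.2.2 i → 0 < q.2.2 i := by
    classical
    intro i hi
    obtain ⟨d, hd, hdA, -, h5, hu⟩ := hN i hi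
    -- The dual competitor must also remove the perturbation `r`.
    let ζ : Fin n → ℝ := fun k => (if w.2.2 k = 0 then s k else 0) - r k
    have hAy : P.realAᵀ *ᵥ y = P.realc + r - s := eq_sub_of_add_eq hfeas.1
    obtain ⟨v', u, hu1, hu2, hu3⟩ := hu ζ ⟨w.2.1 - y,
      w.2.2 - fun k => if w.2.2 k = 0 then 0 else s k, by
        rw [Matrix.mulVec_sub, hAy, eq_sub_of_add_eq hw.2.1]
        funext k
        by_cases h : w.2.2 k = 0
        · simp [ζ, h]; ring
        · simp only [ζ, h, if_false, Pi.add_apply, Pi.sub_apply]; ring, fun k hk => by simp [hk]⟩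
    have hcand : (q.1, y + v', (fun k => if w.2.2 k = 0 then 0 else s k) + u) ∈
        P.roundingConstraints s := by
      refine (hSiff _).2 ⟨q1, ?_, fun k hk => ?_, q4⟩
      · rw [Matrix.mulVec_add, hAy, eq_sub_of_add_eq hu1]
        funext k
        by_cases h : w.2.2 k = 0
        · simp [ζ, h]; ring
        · simp only [ζ, h, if_false, Pi.add_apply, Pi.sub_apply]; ring
      · rw [Set.mem_ofPred_eq] at hk
        simp [hk, hu2]
    have hmin : l2norm (q.1 - x) ^ 2 + l2norm (q.2.2 - s) ^ 2 ≤ l2norm (q.1 - x) ^ 2 +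
      l2norm ((fun k => if w.2.2 k = 0 then 0 else s k) + u - s) ^ 2 := hround_q.le hcand
    have hclose := abs_sub_le_sum_of_l2norm_le (I := {k | w.2.2 k ≠ 0}) (u := u)
      (show l2norm (q.2.2 - s) ^ 2 ≤
        l2norm ((fun k => if w.2.2 k = 0 then 0 else s k) + u - s) ^ 2 by linarith)
      (fun k hk => by simp only [Set.mem_ofPred_eq] at hk; simp [hk])
      (fun k hk => by
        simp only [Set.mem_ofPred_eq, not_not] at hk
        rw [q3 k hk]; simp [hk, hu2]) (show i ∈ {k | w.2.2 k ≠ 0} from hi.ne')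
    have hT : ∑ k, |ζ k| ≤ n * (83 / 50 * n * μ * P.boundA) := by
      calc ∑ k, |ζ k| ≤ ∑ _k : Fin n, 83 / 50 * n * μ * P.boundA := by
            refine Finset.sum_le_sum fun k _ => ?_
            have hnn : 0 ≤ n * μ * P.boundA := by positivity
            have hrk := hr k
            by_cases hk : w.2.2 k = 0
            · obtain ⟨d', -, hd', h', -⟩ := hB k ((hBN k).1 hk)
              simp only [ζ, hk, if_true]
              have h1 := abs_sub (s k) (r k)
              rw [abs_of_pos (hs k)] at h1
              have := mul_le_mul_of_nonneg_right hd' (show 0 ≤ 8 / 5 * n * μ by positivity)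
              linarith
            · simp only [ζ, hk, if_false, zero_sub, abs_neg]; linarith
        _ = _ := by simp
    have hlt := rounding_arith hn hbA hap hsize hμ hμG2 hd h5 hT (hnsum u d _ hu3)
    linarith [(abs_le.1 hclose).1]
  refine ⟨fun j => by rw [hsB, mem_partB_iff hw hsc], fun j => by rw [hxN, mem_partN_iff hw hsc],
    ⟨q, hround_q, huniq⟩, fun w' hw' => ?_⟩
  rw [huniq w' hw']
  refine ⟨q1, q2, Finset.sum_eq_zero fun k _ => ?_, fun k => ?_, fun k => ?_⟩
  · rcases hcomp k with h | h
    · rw [q4 k h, zero_mul]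
    · rw [q3 k h, mul_zero]
  · rcases (hw.2.2.2.1 k).eq_or_lt with h | h
    · rw [q4 k h.symm]
    · exact (hqx k h).le
  · rcases (hw.2.2.2.2 k).eq_or_lt with h | h
    · rw [q3 k h.symm]
    · exact (hqs k h).le

end IntLO

/-! ### Inexact Newton steps -/

section NewtonErrors

variable {m n : ℕ} {A : Matrix (Fin m) (Fin n) ℝ} {b : Fin m → ℝ} {s : Fin n → ℝ} {μ : ℝ}

theorem newtonMatrix_mulVec_inl (A : Matrix (Fin m) (Fin n) ℝ) (s : Fin n → ℝ)
    (z : Fin n ⊕ Fin m → ℝ) (j : Fin n) : (newtonMatrix A s *ᵥ z) (Sum.inl j) =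
      s j ^ 2 * z (Sum.inl j) + (Aᵀ *ᵥ fun i => z (Sum.inr i)) j := by
  rw [newtonMatrix, Matrix.fromBlocks_mulVec, Sum.elim_inl, Pi.add_apply, Matrix.mulVec_diagonal]
  rfl

theorem newtonMatrix_mulVec_inr (A : Matrix (Fin m) (Fin n) ℝ) (s : Fin n → ℝ)
    (z : Fin n ⊕ Fin m → ℝ) (i : Fin m) : (newtonMatrix A s *ᵥ z) (Sum.inr i) =
      (A *ᵥ fun j => z (Sum.inl j)) i := by
  rw [newtonMatrix, Matrix.fromBlocks_mulVec, Sum.elim_inr, Pi.add_apply, Matrix.zero_mulVec]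
  simp [Function.comp_def]

/-- The relative error of the Newton direction in terms of the two blocks of the residual. -/
theorem l2norm_newton_error_le (hA : A.rank = m) (hs : ∀ j, 0 < s j) (hμ : 0 < μ)
    (z : Fin n ⊕ Fin m → ℝ) {u : Fin n → ℝ}
    (hu : A *ᵥ u = fun i => (newtonMatrix A s *ᵥ z - newtonRhs A b s μ) (Sum.inr i)) :
    l2norm (fun j => s j * z (Sum.inl j) - newtonDs A b s μ j / s j) ≤
      l2norm (fun j => (newtonMatrix A s *ᵥ z - newtonRhs A b s μ) (Sum.inl j) / s j) +
        l2norm (fun j => s j * u j) := by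
  -- Let `e` be the error, `p` the scaled upper residual block and `q = S u`. Then `e - p = -S⁻¹ (Aᵀ
  -- Δy + Δs)` is a scaled range vector and `e - q` a scaled kernel vector, so `e` lies on the
  -- sphere with diameter `p q`.
  refine l2norm_le_of_dotProduct_sub_sub_eq_zero ?_
  obtain ⟨w, hw⟩ := newtonDs_mem_range A b s μ
  have h1 : A *ᵥ ((fun j => z (Sum.inl j)) - (fun j => newtonDs A b s μ j / s j ^ 2) - u) = 0 := by
    have h2 : (fun j => newtonDs A b s μ j / s j ^ 2) =
        (fun j => (s j)⁻¹) - μ⁻¹ • primalPoint A b s μ := by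
      funext j
      have := (hs j).ne'
      simp only [Pi.sub_apply, Pi.smul_apply, smul_eq_mul, primalPoint]
      field_simp
      ring
    rw [Matrix.mulVec_sub, Matrix.mulVec_sub, hu, h2, Matrix.mulVec_sub, Matrix.mulVec_smul,
      mulVec_primalPoint hA hs hμ]
    funext i
    simp only [Pi.sub_apply, newtonMatrix_mulVec_inr, newtonRhs, Sum.elim_inr, Pi.neg_apply,
      Pi.smul_apply, smul_eq_mul, Pi.zero_apply]
    field_simp
    ring
  have h3 : (Aᵀ *ᵥ ((fun i => z (Sum.inr i)) + w)) ⬝ᵥ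
      ((fun j => z (Sum.inl j)) - (fun j => newtonDs A b s μ j / s j ^ 2) - u) = 0 := by
    rw [transpose_mulVec_dotProduct, h1, dotProduct_zero]
  rw [Matrix.mulVec_add, ← hw] at h3
  rw [← neg_eq_zero, ← h3]
  simp only [dotProduct, ← Finset.sum_neg_distrib]
  refine Finset.sum_congr rfl fun j _ => ?_
  have := (hs j).ne'
  simp only [Pi.sub_apply, Pi.add_apply, newtonMatrix_mulVec_inl, newtonRhs, Sum.elim_inl,
    Pi.zero_apply, sub_zero]
  field_simp
  ring

theorem l2norm_inl_le (v : Fin n ⊕ Fin m → ℝ) : l2norm (fun j => v (Sum.inl j)) ≤ l2norm v := by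
  refine l2norm_le_of_sq_le (l2norm_nonneg v) ?_
  rw [l2norm_sq, Fintype.sum_sum_type]
  exact le_add_of_nonneg_right (Finset.sum_nonneg fun _ _ => sq_nonneg _)

/-- The slack moves by `S² Δŝ` and `y` by `Δy`, so dual feasibility is lost exactly by the upper
block of the residual, whose right-hand side is zero. -/
theorem iterate_increment (A : Matrix (Fin m) (Fin n) ℝ) (c : Fin n → ℝ) (y₀ : Fin m → ℝ)
    (s₀ : Fin n → ℝ) (z : ℕ → Fin n ⊕ Fin m → ℝ) (k : ℕ) :
    perturbation A c (iterates y₀ s₀ z (k + 1)) - perturbation A c (iterates y₀ s₀ z k) =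
      fun j => (newtonMatrix A (iterates y₀ s₀ z k).2 *ᵥ z k) (Sum.inl j) := by
  have h : (fun i => (iterates y₀ s₀ z k).1 i + z k (Sum.inr i)) =
      (iterates y₀ s₀ z k).1 + fun i => z k (Sum.inr i) := rfl
  funext j
  simp only [perturbation, iterates, h, Matrix.mulVec_add, newtonMatrix_mulVec_inl, Pi.add_apply,
    Pi.sub_apply]
  ring

end NewtonErrors

namespace IntLO

variable {m n : ℕ} {P : IntLO m n}

theorem l2norm_transpose_mulVec_le (f : Fin m → ℝ) {ε : ℝ} (hf : ∀ i, |f i| ≤ ε) (hε : 0 ≤ ε) :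
    l2norm (P.realAᵀ *ᵥ f) ≤ n * P.boundA * ε := by
  refine (l2norm_le_sum_abs _).trans ?_
  calc ∑ j, |(P.realAᵀ *ᵥ f) j| ≤ ∑ _j : Fin n, P.boundA * ε := by
        refine Finset.sum_le_sum fun j _ => ?_
        refine (Finset.abs_sum_le_sum_abs (fun i => P.realAᵀ j i * f i) Finset.univ).trans ?_
        calc ∑ i, |P.realAᵀ j i * f i| ≤ ∑ i, |(P.A i j : ℝ)| * ε := by
              refine Finset.sum_le_sum fun i _ => ?_
              rw [abs_mul]
              exact mul_le_mul_of_nonneg_left (hf i) (abs_nonneg _)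
          _ = (∑ i, |(P.A i j : ℝ)|) * ε := by rw [Finset.sum_mul]
          _ ≤ _ := by
              refine mul_le_mul_of_nonneg_right ?_ hε
              have h1 := P.colA_le j
              have h2 := Finset.prod_comp_le_of_one_le (f := fun _ : Unit => j)
                (fun _ _ _ => Subsingleton.elim _ _) P.one_le_colA
              simp only [Finset.univ_unique, Finset.prod_singleton] at h2
              rw [boundA_eq]
              linarith
    _ = _ := by simp; ring

/-- The error of one inexact Newton step: relative error of the direction, and violation of dual
feasibility. -/
theorem newton_step_error (hm : 0 < m) (hA : P.realA.rank = m) {s : Fin n → ℝ} {μ Γ ε : ℝ}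
    (hs : ∀ j, 0 < s j) (hμ : 0 < μ) (hsΓ : ∀ j, s j ≤ Γ) (hlow : ∀ j, μ ≤ 2 * Γ * s j)
    (hε : 0 ≤ ε) {z : Fin n ⊕ Fin m → ℝ}
    (hz : ResidualPrecise P.realA P.realb s μ ε z ∨ ForwardPrecise P.realA P.realb s μ ε z) :
    l2norm (fun j => s j * z (Sum.inl j) - newtonDs P.realA P.realb s μ j / s j) ≤
        ε * Γ * (2 / μ + 2 ^ P.L / 8) ∧
      l2norm (fun j => (newtonMatrix P.realA s *ᵥ z) (Sum.inl j)) ≤ ε * (Γ ^ 2 + 2 ^ P.L / 8) := by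
  have hbA := P.one_le_boundA
  have hbB := P.one_le_boundB
  have hbC := P.one_le_boundC
  have hn0 := P.dim_pos hm hA
  have hn : (1 : ℝ) ≤ n := by exact_mod_cast hn0
  have hΓ : 0 < Γ := (hs ⟨0, hn0⟩).trans_le (hsΓ ⟨0, hn0⟩)
  have hsize := P.sq_mul_bounds_le hm (n := n)
  have hap : P.boundA ≤ P.boundA * P.boundB * P.boundC := by
    have h1 := one_le_mul_of_one_le_of_one_le hbB hbC
    rw [mul_assoc]
    exact le_mul_of_one_le_right (by linarith) h1
  have hNNa : (n : ℝ) ^ 2 * P.boundA ≤ 2 ^ P.L / 8 :=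
    le_trans (mul_le_mul_of_nonneg_left hap (by positivity)) hsize
  have hNa : n * P.boundA ≤ 2 ^ P.L / 8 :=
    le_trans (mul_le_mul_of_nonneg_right (by nlinarith) (by linarith)) hNNa
  have hG1 : (1 : ℝ) ≤ 2 ^ P.L / 8 := le_trans (one_le_mul_of_one_le_of_one_le hn hbA) hNa
  rcases hz with hz | ⟨z', hz', hzz'⟩
  · have hinl := (l2norm_inl_le _).trans hz
    constructor
    -- Lifting the lower residual block costs `n² * boundA ≤ 2^L / 8`: one `n ≥ m` from summing the
    -- block, one from the norm of `u`.
    · obtain ⟨u, hu, hul⟩ := P.exists_small_preimage hA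
        (fun i => (newtonMatrix P.realA s *ᵥ z - newtonRhs P.realA P.realb s μ) (Sum.inr i))
      refine (l2norm_newton_error_le hA hs hμ z hu).trans ?_
      have h1 : l2norm (fun j => (newtonMatrix P.realA s *ᵥ z - newtonRhs P.realA P.realb s μ)
          (Sum.inl j) / s j) ≤ 2 * Γ / μ * ε := by
        have : (fun j => (newtonMatrix P.realA s *ᵥ z - newtonRhs P.realA P.realb s μ)
          (Sum.inl j) / s j) = fun j => (s j)⁻¹ * (newtonMatrix P.realA s *ᵥ z -
            newtonRhs P.realA P.realb s μ) (Sum.inl j) := by funext j; rw [div_eq_inv_mul]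
        rw [this]
        refine (l2norm_mul_le (c := 2 * Γ / μ) fun j => ?_).trans
          (mul_le_mul_of_nonneg_left hinl (by positivity))
        rw [abs_of_pos (inv_pos.2 (hs j)), inv_le_iff_one_le_mul₀ (hs j), div_mul_eq_mul_div,
          le_div_iff₀ hμ, one_mul]
        exact hlow j
      have hsum : ∑ i, |(newtonMatrix P.realA s *ᵥ z - newtonRhs P.realA P.realb s μ)
          (Sum.inr i)| ≤ n * ε := by
        calc _ ≤ ∑ _i : Fin m, ε := Finset.sum_le_sum fun i _ => (abs_le_l2norm _ _).trans hz
          _ = m * ε := by simp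
          _ ≤ n * ε := by
            have h2 := P.realA.rank_le_width
            rw [hA] at h2
            exact mul_le_mul_of_nonneg_right (by exact_mod_cast h2) hε
      have h2 : l2norm (fun j => s j * u j) ≤ Γ * (2 ^ P.L / 8 * ε) := by
        refine (l2norm_mul_le fun j => by rw [abs_of_pos (hs j)]; exact hsΓ j).trans
          (mul_le_mul_of_nonneg_left ?_ hΓ.le)
        calc l2norm u ≤ ∑ l, |u l| := l2norm_le_sum_abs u
          _ ≤ ∑ _l : Fin n, P.boundA * (n * ε) := Finset.sum_le_sum fun l _ =>
              (hul l).trans (mul_le_mul_of_nonneg_left hsum (by linarith))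
          _ = n ^ 2 * P.boundA * ε := by simp; ring
          _ ≤ _ := mul_le_mul_of_nonneg_right hNNa hε
      calc _ ≤ 2 * Γ / μ * ε + Γ * (2 ^ P.L / 8 * ε) := add_le_add h1 h2
        _ = _ := by ring
    · have h1 : (fun j => (newtonMatrix P.realA s *ᵥ z) (Sum.inl j)) = fun j =>
          (newtonMatrix P.realA s *ᵥ z - newtonRhs P.realA P.realb s μ) (Sum.inl j) := by
        funext j; simp [newtonRhs]
      rw [h1]
      refine hinl.trans (le_mul_of_one_le_right hε ?_)
      linarith [sq_nonneg Γ]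
  -- An exact solution reproduces the Newton direction, so only `z - z'` matters. Its upper block is
  -- multiplied by `S²`, which is where `Γ²` enters.
  · have hzero : newtonMatrix P.realA s *ᵥ z' - newtonRhs P.realA P.realb s μ = 0 :=
      sub_eq_zero.2 hz'
    have hd : l2norm (fun j => s j * z' (Sum.inl j) -
        newtonDs P.realA P.realb s μ j / s j) ≤ 0 := by
      have h1 := l2norm_newton_error_le (b := P.realb) hA hs hμ z' (u := 0) (by
        rw [hzero, Matrix.mulVec_zero]; rfl)
      rw [hzero] at h1
      have e1 : (fun j => (0 : Fin n ⊕ Fin m → ℝ) (Sum.inl j) / s j) = 0 := by funext j; simp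
      have e2 : (fun j => s j * (0 : Fin n → ℝ) j) = 0 := by funext j; simp
      rw [e1, e2, l2norm_zero, add_zero] at h1
      exact h1
    have hinl := (l2norm_inl_le (z - z')).trans hzz'
    constructor
    · have e1 : (fun j => s j * z (Sum.inl j) - newtonDs P.realA P.realb s μ j / s j) =
          (fun j => s j * z' (Sum.inl j) - newtonDs P.realA P.realb s μ j / s j) +
            fun j => s j * (z - z') (Sum.inl j) := by
        funext j; simp only [Pi.add_apply, Pi.sub_apply]; ring
      rw [e1]
      calc _ ≤ 0 + Γ * ε := (l2norm_add_le _ _).trans (add_le_add hd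
            ((l2norm_mul_le fun j => by rw [abs_of_pos (hs j)]; exact hsΓ j).trans
              (mul_le_mul_of_nonneg_left hinl hΓ.le)))
        _ = ε * Γ * 1 := by ring
        _ ≤ _ := by
          refine mul_le_mul_of_nonneg_left ?_ (by positivity)
          have : 0 < 2 / μ := by positivity
          linarith
    · have e1 : (fun j => (newtonMatrix P.realA s *ᵥ z) (Sum.inl j)) =
          (fun j => s j ^ 2 * (z - z') (Sum.inl j)) +
            (P.realAᵀ *ᵥ fun i => (z - z') (Sum.inr i)) := by
        funext j
        have h2 : (newtonMatrix P.realA s *ᵥ z') (Sum.inl j) = 0 := by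
          rw [hz']; simp [newtonRhs]
        have h3 : (newtonMatrix P.realA s *ᵥ z) (Sum.inl j) =
            (newtonMatrix P.realA s *ᵥ (z - z')) (Sum.inl j) := by
          rw [Matrix.mulVec_sub, Pi.sub_apply, h2, sub_zero]
        rw [h3, newtonMatrix_mulVec_inl, Pi.add_apply]
      rw [e1]
      have h4 := l2norm_transpose_mulVec_le (P := P) (fun i => (z - z') (Sum.inr i))
        (fun i => (abs_le_l2norm _ _).trans hzz') hε
      calc _ ≤ Γ ^ 2 * ε + n * P.boundA * ε := (l2norm_add_le _ _).trans (add_le_add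
            ((l2norm_mul_le fun j => by
              rw [abs_of_nonneg (sq_nonneg _)]
              exact pow_le_pow_left₀ (hs j).le (hsΓ j) 2).trans
              (mul_le_mul_of_nonneg_left hinl (by positivity))) h4)
        _ ≤ Γ ^ 2 * ε + 2 ^ P.L / 8 * ε :=
          add_le_add le_rfl (mul_le_mul_of_nonneg_right hNa hε)
        _ = _ := by ring

/-- The invariants of the inexact method over `K` iterations. -/
theorem run_invariants (hm : 0 < m) (hA : P.realA.rank = m)
    {w : (Fin n → ℝ) × (Fin m → ℝ) × (Fin n → ℝ)}
    (hw : w ∈ optimalSet P.realA P.realb P.realc) {y₀ : Fin m → ℝ} {s₀ : Fin n → ℝ}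
    (h0 : StrictDualFeasible P.realA P.realc y₀ s₀) {μ₀ η θ g ε R Γ : ℝ} (hμ₀ : 0 < μ₀)
    (hδ : proximity P.realA P.realb s₀ μ₀ < 1 / 2) (hη : 0 < η) (hη' : η ≤ 1 / 8)
    (hθ : θ = η / √(n : ℝ)) (hg : (2 : ℝ) ^ P.L ≤ g) (hμg : μ₀ ≤ g)
    (hΓ : Γ = 2 ^ P.L * g / 4) (hε : 0 ≤ ε) {z : ℕ → Fin n ⊕ Fin m → ℝ}
    {y : ℕ → Fin m → ℝ} {s : ℕ → Fin n → ℝ} (hit : ∀ k, (y k, s k) = iterates y₀ s₀ z k) {K : ℕ}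
    (hK : ∀ k < K, 1 / (2 ^ P.L) ^ 2 < barrier μ₀ θ k)
    (hz : ∀ k < K, ResidualPrecise P.realA P.realb (s k) (barrier μ₀ θ k) ε (z k) ∨
      ForwardPrecise P.realA P.realb (s k) (barrier μ₀ θ k) ε (z k))
    {r : ℕ → Fin n → ℝ} (hr : ∀ k, r k = perturbation P.realA P.realc (y k, s k))
    (hR : R * 2 ^ P.L ≤ 1 / 4) (hKR : K * (ε * (Γ ^ 2 + 2 ^ P.L / 8)) ≤ R)
    (hE : ε * Γ * (2 * (2 ^ P.L) ^ 2 + 2 ^ P.L / 8) ≤ 1 / 100) (k : ℕ) (hk : k ≤ K) :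
    StrictDualFeasible P.realA (P.realc + r k) (y k) (s k) ∧
      proximity P.realA P.realb (s k) (barrier μ₀ θ k) < 1 / 2 ∧
      l2norm (r k) ≤ k * (ε * (Γ ^ 2 + 2 ^ P.L / 8)) ∧
      (∀ j, primalPoint P.realA P.realb (s k) (barrier μ₀ θ k) j ≤ Γ ∧ s k j ≤ Γ) ∧
      (∀ j, barrier μ₀ θ k ≤ 2 * Γ * s k j) ∧
      (k < K → l2norm (r (k + 1) - r k) ≤ ε * (Γ ^ 2 + 2 ^ P.L / 8) ∧
        ∃ e : Fin n → ℝ, l2norm e ≤ ε * Γ * (2 * (2 ^ P.L) ^ 2 + 2 ^ P.L / 8) ∧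
          ∀ j, s (k + 1) j = s k j *
            (1 + newtonDs P.realA P.realb (s k) (barrier μ₀ θ k) j / s k j + e j)) := by
  have hn0 := P.dim_pos hm hA
  have hn : (1 : ℝ) ≤ √n := Real.one_le_sqrt.2 (by exact_mod_cast hn0)
  have hθ0 : 0 ≤ θ := by rw [hθ]; positivity
  have hθ8 : θ ≤ 1 / 8 := by
    rw [hθ]
    exact (div_le_self hη.le hn).trans hη'
  have hθn : θ * √n = η := by rw [hθ]; field_simp
  have hμ : ∀ k, 0 < barrier μ₀ θ k := fun k => mul_pos (pow_pos (by linarith) _) hμ₀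
  have hμle : ∀ k, barrier μ₀ θ k ≤ g := fun k =>
    (mul_le_of_le_one_left hμ₀.le (pow_le_one₀ (by linarith) (by linarith))).trans hμg
  have hD0 : 0 ≤ ε * (Γ ^ 2 + 2 ^ P.L / 8) := by positivity
  have hG0 : (0 : ℝ) < 2 ^ P.L := by positivity
  have hfeas : ∀ k, P.realAᵀ *ᵥ y k + s k = P.realc + r k := fun k => by
    rw [hr, perturbation]; abel
  -- consequences of the invariants at `k`
  have hstep : ∀ k ≤ K, (∀ j, 0 < s k j) →
      proximity P.realA P.realb (s k) (barrier μ₀ θ k) < 1 / 2 →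
      l2norm (r k) ≤ k * (ε * (Γ ^ 2 + 2 ^ P.L / 8)) →
      (∀ j, primalPoint P.realA P.realb (s k) (barrier μ₀ θ k) j ≤ Γ ∧ s k j ≤ Γ) ∧
      (∀ j, barrier μ₀ θ k ≤ 2 * Γ * s k j) ∧
      (k < K → l2norm (r (k + 1) - r k) ≤ ε * (Γ ^ 2 + 2 ^ P.L / 8) ∧
        ∃ e : Fin n → ℝ, l2norm e ≤ ε * Γ * (2 * (2 ^ P.L) ^ 2 + 2 ^ P.L / 8) ∧
          ∀ j, s (k + 1) j = s k j *
            (1 + newtonDs P.realA P.realb (s k) (barrier μ₀ θ k) j / s k j + e j)) := by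
    intro k hk hs hprox hrk
    have hrR : ∀ j, |r k j| ≤ R := fun j => by
      refine (abs_le_l2norm (r k) j).trans (hrk.trans (le_trans ?_ hKR))
      exact mul_le_mul_of_nonneg_right (by exact_mod_cast hk) hD0
    have hb : ∀ j, primalPoint P.realA P.realb (s k) (barrier μ₀ θ k) j ≤ Γ ∧ s k j ≤ Γ := by
      intro j
      rw [hΓ]
      exact primalPoint_le_and_slack_le hm hA hw h0 ⟨hfeas k, hs⟩ (hμ k) hprox hg (hμle k) hrR hR j
    have hlow : ∀ j, barrier μ₀ θ k ≤ 2 * Γ * s k j := by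
      intro j
      have h1 := (mul_primalPoint_bounds hs (hμ k) hprox j).1
      have h2 := mul_le_mul_of_nonneg_left (hb j).1 (hs j).le
      linarith
    refine ⟨hb, hlow, fun hkK => ?_⟩
    obtain ⟨he, hinc⟩ := newton_step_error hm hA hs (hμ k) (fun j => (hb j).2) hlow hε (hz k hkK)
    have hsk : s k = (iterates y₀ s₀ z k).2 := by rw [← hit k]
    refine ⟨?_, _, he.trans ?_, fun j => ?_⟩
    · rw [hr, hr, hit, hit, iterate_increment, ← hsk]
      exact hinc
    · have h1 : 2 / barrier μ₀ θ k ≤ 2 * (2 ^ P.L) ^ 2 := by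
        rw [div_le_iff₀ (hμ k)]
        have := hK k hkK
        rw [div_lt_iff₀ (by positivity)] at this
        linarith
      have hΓ0 : 0 ≤ Γ := by
        have hg0 : 0 ≤ g := hG0.le.trans hg
        rw [hΓ]; positivity
      exact mul_le_mul_of_nonneg_left (by linarith) (by positivity)
    · have h1 : s (k + 1) = fun j => s k j + s k j ^ 2 * z k (Sum.inl j) := by
        have : s (k + 1) = (iterates y₀ s₀ z (k + 1)).2 := by rw [← hit (k + 1)]
        rw [this, hsk]; rfl
      rw [h1]
      have := (hs j).ne'
      field_simp
      ring
  have hinv : ∀ k ≤ K, (∀ j, 0 < s k j) ∧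
      proximity P.realA P.realb (s k) (barrier μ₀ θ k) < 1 / 2 ∧
      l2norm (r k) ≤ k * (ε * (Γ ^ 2 + 2 ^ P.L / 8)) := by
    intro k
    induction k with
    | zero =>
      intro _
      have h1 : (y 0, s 0) = (y₀, s₀) := hit 0
      have hy : y 0 = y₀ := congrArg Prod.fst h1
      have hs : s 0 = s₀ := congrArg Prod.snd h1
      refine ⟨fun j => hs ▸ h0.2 j, by rw [hs]; simpa [barrier] using hδ, ?_⟩
      rw [hr, hy, hs, perturbation]
      simp only [h0.1, sub_self, l2norm_zero]
      simp
    | succ k ih =>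
      intro hk
      obtain ⟨hs, hprox, hrk⟩ := ih (by omega)
      obtain ⟨-, -, hnext⟩ := hstep k (by omega) hs hprox hrk
      obtain ⟨hinc, e, he, hse⟩ := hnext (by omega)
      have h1 := proximity_step_le (θ := θ) hA hs (hμ k) hprox (he.trans hE) (by norm_num) hse
        (by linarith) hθ0
      refine ⟨h1.1, ?_, ?_⟩
      · have h2 := h1.2
        rw [hθn] at h2
        have h3 : barrier μ₀ θ (k + 1) = (1 - θ) * barrier μ₀ θ k := by
          simp only [barrier]; ring
        rw [h3]
        -- `1/4 + 3/200 + 1/8 < 7/16 ≤ (1 - θ) / 2`.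
        nlinarith
      · have h2 : r (k + 1) = r k + (r (k + 1) - r k) := by abel
        rw [h2]
        refine (l2norm_add_le _ _).trans ?_
        push_cast
        linarith
  obtain ⟨hs, hprox, hrk⟩ := hinv k hk
  exact ⟨⟨hfeas k, hs⟩, hprox, hrk, hstep k hk hs hprox hrk⟩

end IntLO

/-! ### The run as a feasible run for one perturbed problem -/

theorem l2norm_telescope_le {n : ℕ} {r : ℕ → Fin n → ℝ} {D : ℝ} {K : ℕ}
    (h : ∀ k < K, l2norm (r (k + 1) - r k) ≤ D) (k i : ℕ) (hi : k + i ≤ K) :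
    l2norm (r (k + i) - r k) ≤ i * D := by
  induction i with
  | zero => simp [l2norm_zero]
  | succ i ih =>
    have h1 := ih (by omega)
    have h2 := h (k + i) (by omega)
    have h3 : r (k + (i + 1)) - r k = (r (k + i + 1) - r (k + i)) + (r (k + i) - r k) := by
      rw [sub_add_sub_cancel]; rfl
    rw [h3]
    refine (l2norm_add_le _ _).trans ?_
    push_cast
    linarith

section Shifted

variable {m n : ℕ} {A : Matrix (Fin m) (Fin n) ℝ} {b : Fin m → ℝ} {s : Fin n → ℝ} {μ : ℝ}

theorem l2norm_div_le (hμ : 0 < μ) (hs : ∀ j, 0 < s j) {Γ : ℝ}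
    (hlow : ∀ j, μ ≤ 2 * Γ * s j) (v : Fin n → ℝ) :
    l2norm (fun j => v j / s j) ≤ 2 * Γ / μ * l2norm v := by
  have : (fun j => v j / s j) = fun j => (s j)⁻¹ * v j := by funext j; rw [div_eq_inv_mul]
  rw [this]
  refine l2norm_mul_le fun j => ?_
  rw [abs_of_pos (inv_pos.2 (hs j)), inv_le_iff_one_le_mul₀ (hs j), div_mul_eq_mul_div,
    le_div_iff₀ hμ, one_mul]
  exact hlow j

theorem shifted_pos (hs : ∀ j, 0 < s j) {a : Fin n → ℝ} {ρ : ℝ}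
    (ha : l2norm (fun j => a j / s j) ≤ ρ) (hρ : ρ ≤ 1 / 4) (j : Fin n) :
    3 / 4 * s j ≤ s j + a j := by
  have h1 := (abs_le_l2norm (fun j => a j / s j) j).trans (ha.trans hρ)
  have h2 := (abs_le.1 h1).1
  rw [le_div_iff₀ (hs j)] at h2
  linarith

/-- The shift costs `3/2 · 1/4`, and `1/2 + 3/8 < 1`; this is why the shifted run is only claimed to
have proximity below 1. -/
theorem proximity_shifted_lt (hA : A.rank = m) (hs : ∀ j, 0 < s j) (hμ : 0 < μ)
    (hδ : proximity A b s μ < 1 / 2) {a : Fin n → ℝ} {ρ : ℝ}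
    (ha : l2norm (fun j => a j / s j) ≤ ρ) (hρ : ρ ≤ 1 / 4) :
    proximity A b (s + a) μ < 1 := by
  have hpos : ∀ j, 0 < (s + a) j := fun j => by
    have := shifted_pos hs ha hρ j
    have := hs j
    simp only [Pi.add_apply]
    linarith
  have h1 := proximity_perturb_le hA hs hμ hδ hpos
  have h2 : (fun j => ((s + a) j - s j) / s j) = fun j => a j / s j := by
    funext j; simp
  rw [h2] at h1
  linarith

/-- A Newton step with relative error `e`, seen from slightly shifted iterates. -/
theorem shifted_step_error_le (hA : A.rank = m) (hs : ∀ j, 0 < s j) (hμ : 0 < μ)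
    (hδ : proximity A b s μ < 1 / 2) {a a' e s' : Fin n → ℝ} {ρ E : ℝ}
    (ha : l2norm (fun j => a j / s j) ≤ ρ) (hρ : ρ ≤ 1 / 4)
    (ha' : l2norm (fun j => (a' j - a j) / s j) ≤ ρ)
    (he : l2norm e ≤ E) (hs' : ∀ j, s' j = s j * (1 + newtonDs A b s μ j / s j + e j)) :
    l2norm (fun j => ((s' + a') j - (s + a) j - newtonDs A b (s + a) μ j) / (s + a) j) ≤
      4 / 3 * (E + 11 * ρ) := by
  have hlow := shifted_pos hs ha hρ
  have hpos : ∀ j, 0 < (s + a) j := fun j => by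
    have h1 := hlow j
    have h2 := hs j
    simp only [Pi.add_apply]
    linarith
  have h2 : (fun j => ((s + a) j - s j) / s j) = fun j => a j / s j := by
    funext j; simp
  have hL := l2norm_newtonDs_sub_le (b := b) hA hs hμ hpos (ρ := ρ) (by rw [h2]; exact ha) hρ
    (proximity_shifted_lt hA hs hμ hδ ha hρ).le
  -- Three contributions: `e`, the change of the shift (`ρ`) and the change of the Newton direction
  -- (`10 ρ`). Rescaling from `s` to `s + a ≥ 3/4 s` costs `4/3`.
  have h3 : (fun j => ((s' + a') j - (s + a) j - newtonDs A b (s + a) μ j) / (s + a) j) =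
      fun j => s j / (s + a) j * ((e + fun j => (a' j - a j) / s j) +
        fun j => (newtonDs A b s μ j - newtonDs A b (s + a) μ j) / s j) j := by
    funext j
    have h4 := (hs j).ne'
    have h5 := (hpos j).ne'
    simp only [Pi.add_apply] at h5 ⊢
    rw [hs']
    field_simp
    ring
  rw [h3]
  refine (l2norm_mul_le (c := 4 / 3) fun j => ?_).trans
    (mul_le_mul_of_nonneg_left ?_ (by norm_num))
  · rw [abs_of_pos (div_pos (hs j) (hpos j)), div_le_iff₀ (hpos j)]
    have := hlow j
    simp only [Pi.add_apply]
    linarith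
  · refine (l2norm_add_le _ _).trans ?_
    have h6 := l2norm_add_le e fun j => (a' j - a j) / s j
    linarith

end Shifted

/-! ### Iteration count, choice of the precision, and conclusion -/

/-- The number of iterations after which the barrier parameter drops below `2 ^ (-2L)`. -/
theorem exists_iteration_count {n L : ℕ} {μ₀ η θ κ : ℝ} (hn : 0 < n) (hL : 4 ≤ L) (hη : 0 < η)
    (hη' : η ≤ 1 / 8) (hθ : θ = η / √(n : ℝ)) (hκ : 1 ≤ κ) (hμ₀ : 0 < μ₀)
    (hμ : μ₀ ≤ (2 : ℝ) ^ (κ * (L : ℝ))) :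
    ∃ K : ℕ, (∀ k < K, 1 / (2 ^ L) ^ 2 < barrier μ₀ θ k) ∧ barrier μ₀ θ K ≤ 1 / (2 ^ L) ^ 2 ∧
      (K : ℝ) ≤ 3 / 4 * ((κ + 2) / η) * (√n * L) := by
  have hn1 : (1 : ℝ) ≤ √n := Real.one_le_sqrt.2 (by exact_mod_cast hn)
  have hL4 : (4 : ℝ) ≤ L := by exact_mod_cast hL
  have hθ0 : 0 < θ := by rw [hθ]; positivity
  have hθ8 : θ ≤ 1 / 8 := by rw [hθ]; exact (div_le_self hη.le hn1).trans hη'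
  have hlim : Filter.Tendsto (barrier μ₀ θ) Filter.atTop (nhds 0) := by
    have := (tendsto_pow_atTop_nhds_zero_of_lt_one (r := 1 - θ) (by linarith)
      (by linarith)).mul_const μ₀
    rwa [zero_mul] at this
  have hex : ∃ k, barrier μ₀ θ k ≤ 1 / (2 ^ L) ^ 2 :=
    ((hlim.eventually_lt_const (by positivity)).exists).imp fun _ h => h.le
  classical
  refine ⟨Nat.find hex, fun k hk => not_le.1 (Nat.find_min hex hk), Nat.find_spec hex, ?_⟩
  have hq : 4 ≤ √n * L := by nlinarith
  have hX : 24 ≤ (κ + 2) / η := by rw [le_div_iff₀ hη]; linarith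
  rcases Nat.eq_zero_or_pos (Nat.find hex) with h0 | h0
  · rw [h0, Nat.cast_zero]; positivity
  obtain ⟨k, hk⟩ := Nat.exists_eq_succ_of_ne_zero h0.ne'
  have h1 : 1 / (2 ^ L) ^ 2 < (1 - θ) ^ k * μ₀ := not_le.1 (Nat.find_min hex (by omega : k < _))
  have hθ1 : 0 < 1 - θ := by linarith
  have h2 := Real.log_lt_log (by positivity) h1
  rw [Real.log_mul (by positivity) hμ₀.ne', Real.log_pow, one_div, Real.log_inv, Real.log_pow,
    Real.log_pow] at h2
  have h3 : Real.log (1 - θ) ≤ -θ := by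
    have := Real.log_le_sub_one_of_pos hθ1
    linarith
  have h4 : Real.log μ₀ ≤ κ * L * Real.log 2 := by
    rw [← Real.log_rpow two_pos]
    exact Real.log_le_log hμ₀ hμ
  have h5 : (k : ℝ) * Real.log (1 - θ) ≤ k * -θ := mul_le_mul_of_nonneg_left h3 (Nat.cast_nonneg k)
  have h6 : k * θ ≤ (κ + 2) * L * Real.log 2 := by push_cast at h2; linarith
  have h7 : (k : ℝ) ≤ (κ + 2) / η * (√n * L) * Real.log 2 := by
    have e : (κ + 2) / η * (√n * L) * Real.log 2 = (κ + 2) * L * Real.log 2 / θ := by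
      rw [hθ]; field_simp
    rw [e, le_div_iff₀ hθ0]
    exact h6
  -- With `log 2 < 0.7`, the gap between `0.7` and `3/4` pays for the last iteration, because the
  -- product it multiplies is at least 96.
  have h8 := Real.log_two_lt_d9
  have h9 : 24 * 4 ≤ (κ + 2) / η * (√n * L) :=
    mul_le_mul hX hq (by norm_num) (by linarith)
  have h10 : (κ + 2) / η * (√n * L) * Real.log 2 ≤ (κ + 2) / η * (√n * L) * 0.7 :=
    mul_le_mul_of_nonneg_left (by linarith) (by linarith)
  rw [hk]
  push_cast
  linarith

theorem two_mul_mul_sub_le_two_pow {L : ℕ} (hL : 4 ≤ L) : 2 * (L * (L - 2)) ≤ 2 ^ L := by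
  induction L, hL using Nat.le_induction with
  | base => norm_num
  | succ k hk ih =>
    obtain ⟨i, rfl⟩ := Nat.exists_eq_add_of_le hk
    rw [pow_succ]
    have e1 : 4 + i - 2 = i + 2 := by omega
    have e2 : 4 + i + 1 - 2 = i + 3 := by omega
    rw [e1] at ih
    rw [e2]
    nlinarith

/-- From `√n ≤ n ≤ (L - 2) / 2` the product is quadratic in `L`. The second bound lets the iteration
count cost only `3/4` in the precision exponent; a full power `2^L` would give `t₀ = 10` instead of
a value below 10. -/
theorem sqrt_mul_length_le {n L : ℕ} (hn : 0 < n) (hL : 2 * n + 2 ≤ L) :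
    √(n : ℝ) * L ≤ 2 ^ L / 4 ∧ √(n : ℝ) * L ≤ 8 * (2 : ℝ) ^ (3 / 4 * (L : ℝ)) := by
  have hn1 : (1 : ℝ) ≤ n := by exact_mod_cast hn
  have hsq : √(n : ℝ) ≤ n := by
    rw [Real.sqrt_le_left (by linarith)]
    nlinarith
  have hLr : 2 * (n : ℝ) + 2 ≤ L := by exact_mod_cast hL
  have h1 : √(n : ℝ) * L ≤ (L - 2) / 2 * L :=
    mul_le_mul_of_nonneg_right (by linarith) (by linarith)
  constructor
  · have h2 : (2 * (L * (L - 2) : ℕ) : ℝ) ≤ 2 ^ L := by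
      exact_mod_cast two_mul_mul_sub_le_two_pow (by omega : 4 ≤ L)
    rw [Nat.cast_mul, Nat.cast_sub (by omega)] at h2
    push_cast at h2
    linarith
  · have h2 : 3 / 8 * (L : ℝ) ≤ Real.log 2 * (3 / 4 * L) := by
      have := Real.log_two_gt_d9
      nlinarith
    have h3 := Real.quadratic_le_exp_of_nonneg (x := Real.log 2 * (3 / 4 * (L : ℝ))) (by linarith)
    rw [Real.rpow_def_of_pos two_pos]
    have h4 : (3 / 8 * (L : ℝ)) ^ 2 ≤ (Real.log 2 * (3 / 4 * L)) ^ 2 :=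
      pow_le_pow_left₀ (by linarith) h2 2
    nlinarith

/-- In the bound `1 / (G^6 g^3 u v)` on `ε`, `u` and `v` absorb the factors `q` and `w` of the step
count, and one step loses `ε G² g² / 8` of feasibility, which leaves `R`. The products `2 Γ G² R`
measure `R` relative to the slacks inside the loop. The constant `7/160 = 7/8 · 1/20` anticipates
one factor `1 - θ ≥ 7/8` between the last `μ` inside the loop and the final one. -/
theorem precision_arith {G g u v w q K ε Γ R : ℝ} (hG : 16 ≤ G) (hg : G ≤ g) (hu : 8 ≤ u)
    (hv : 1 ≤ v) (hwv : w ≤ v) (hq : 0 ≤ q) (hqG : q ≤ G / 4) (hqu : q ≤ 8 * u) (hε0 : 0 ≤ ε)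
    (hε : ε ≤ 1 / (G ^ 6 * g ^ 3 * u * v)) (hK : K ≤ 36 * w * q) (hΓ : Γ = G * g / 4)
    (hR : R = 9 / 2 * q / (G ^ 4 * g * u)) :
    R * G ≤ 1 / 4 ∧ K * (ε * (Γ ^ 2 + G / 8)) ≤ R ∧ R ≤ 36 / G ^ 4 ∧
      ε * Γ * (2 * G ^ 2 + G / 8) ≤ 1 / (16 * G) ∧ 2 * Γ * G ^ 2 * R ≤ 1 / 4 ∧
      2 * Γ * G ^ 2 * R ≤ 18 / G ∧ Γ * R ≤ 7 / 160 * (1 / G ^ 2) := by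
  have hG0 : 0 < G := by linarith
  have hg0 : 0 < g := by linarith
  have hu0 : 0 < u := by linarith
  have hv0 : 0 < v := by linarith
  have hR0 : 0 ≤ R := by rw [hR]; positivity
  have hGg : 1 ≤ G * g := by nlinarith
  have hΓ0 : 0 < Γ := by rw [hΓ]; positivity
  have hΓ1 : 1 ≤ Γ * G := by rw [hΓ]; nlinarith
  have hX : 2 * Γ * G ^ 2 * R = 9 / 4 * (q / (G * u)) := by
    rw [hΓ, hR]; field_simp
  have hX1 : q / (G * u) ≤ 1 / 32 := by
    rw [div_le_iff₀ (by positivity)]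
    nlinarith
  have hX2 : q / (G * u) ≤ 8 / G := by
    rw [div_le_div_iff₀ (by positivity) hG0]
    nlinarith
  have hD : Γ ^ 2 + G / 8 ≤ G ^ 2 * g ^ 2 / 8 := by
    rw [hΓ]
    nlinarith [mul_le_mul_of_nonneg_right hGg (by positivity : 0 ≤ G * g), mul_pos hG0 hg0]
  have hX3 : Γ * R * G ^ 2 ≤ 7 / 160 := by
    have : Γ * R * G ^ 2 = 2 * Γ * G ^ 2 * R / 2 := by ring
    rw [this, hX]
    linarith
  refine ⟨?_, ?_, ?_, ?_, ?_, ?_, ?_⟩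
  · have : R * G * 1 ≤ R * G * (Γ * G) := mul_le_mul_of_nonneg_left hΓ1 (by positivity)
    nlinarith
  · have h1 : ε * (Γ ^ 2 + G / 8) ≤ 1 / (G ^ 6 * g ^ 3 * u * v) * (G ^ 2 * g ^ 2 / 8) :=
      mul_le_mul hε hD (by positivity) (by positivity)
    have h2 : K ≤ 36 * v * q := hK.trans (by nlinarith)
    calc K * (ε * (Γ ^ 2 + G / 8))
        ≤ 36 * v * q * (1 / (G ^ 6 * g ^ 3 * u * v) * (G ^ 2 * g ^ 2 / 8)) :=
          mul_le_mul h2 h1 (by positivity) (by positivity)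
      _ = R := by rw [hR]; field_simp; ring
  · rw [hR, div_le_div_iff₀ (by positivity) (by positivity)]
    have h1 : 9 / 2 * q ≤ 36 * (g * u) := by nlinarith
    calc 9 / 2 * q * G ^ 4 ≤ 36 * (g * u) * G ^ 4 :=
          mul_le_mul_of_nonneg_right h1 (by positivity)
      _ = _ := by ring
  · have h1 : 2 * G ^ 2 + G / 8 ≤ 4 * G ^ 2 := by nlinarith
    calc ε * Γ * (2 * G ^ 2 + G / 8) ≤ 1 / (G ^ 6 * g ^ 3 * u * v) * Γ * (4 * G ^ 2) :=
          mul_le_mul (mul_le_mul_of_nonneg_right hε hΓ0.le) h1 (by positivity) (by positivity)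
      _ = 1 / (G ^ 2 * (g ^ 2 * u * v) * G) := by rw [hΓ]; field_simp
      _ ≤ 1 / (16 * G) := by
          refine one_div_le_one_div_of_le (by positivity) (mul_le_mul_of_nonneg_right ?_ hG0.le)
          have h2 : 1 ≤ g ^ 2 * u * v :=
            one_le_mul_of_one_le_of_one_le
              (one_le_mul_of_one_le_of_one_le (by nlinarith) (by linarith)) hv
          nlinarith
  · rw [hX]; linarith
  · rw [hX]
    calc 9 / 4 * (q / (G * u)) ≤ 9 / 4 * (8 / G) := mul_le_mul_of_nonneg_left hX2 (by norm_num)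
      _ = 18 / G := by ring
  · rw [mul_one_div, le_div_iff₀ (by positivity)]
    exact hX3

theorem mainTheorem2 (κ η : ℝ) (hη : 0 < η) (hη' : η ≤ 1 / 8) :
    ∃ t₀ C : ℝ, (κ ≤ 1 → 1 / 16 ≤ η → t₀ < 10) ∧
    ∀ (m n : ℕ) (P : IntLO m n), 0 < m → P.realA.rank = m →
    ∀ (y₀ : Fin m → ℝ) (s₀ : Fin n → ℝ) (μ₀ : ℝ),
      StrictDualFeasible P.realA P.realc y₀ s₀ →
      0 < μ₀ → μ₀ ≤ (2 : ℝ) ^ (κ * (P.L : ℝ)) →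
      proximity P.realA P.realb s₀ μ₀ < 1 / 2 →
    ∀ (t θ : ℝ), t₀ ≤ t → θ = η / √(n : ℝ) →
    ∀ (μ : ℕ → ℝ), μ = barrier μ₀ θ →
    ∀ (z : ℕ → Fin n ⊕ Fin m → ℝ) (y : ℕ → Fin m → ℝ) (s : ℕ → Fin n → ℝ),
      (∀ k, (y k, s k) = iterates y₀ s₀ z k) →
      -- every Newton system met inside the loop is solved to precision `2 ^ (-tL)`
      (∀ k, P.stopTol < μ k →
        ResidualPrecise P.realA P.realb (s k) (μ k) ((2 : ℝ) ^ (-t * (P.L : ℝ))) (z k) ∨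
        ForwardPrecise P.realA P.realb (s k) (μ k) ((2 : ℝ) ^ (-t * (P.L : ℝ))) (z k)) →
    ∀ (r : ℕ → Fin n → ℝ), (∀ k, r k = perturbation P.realA P.realc (y k, s k)) →
    -- `K` is the number of iterations
    ∃ K : ℕ, (∀ k < K, P.stopTol < μ k) ∧ μ K ≤ P.stopTol ∧
      (K : ℝ) ≤ C * √(n : ℝ) * (P.L : ℝ) ∧
      -- all iterates are strictly feasible for slightly perturbed problems, close to
      -- their central paths
      (∀ k ≤ K,
        StrictDualFeasible P.realA (P.realc + r k) (y k) (s k) ∧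
        proximity P.realA P.realb (s k) (μ k) < 1 / 2 ∧
        l2norm (r k) ≤ C * (2 : ℝ) ^ (-4 * (P.L : ℝ))) ∧
      ((∀ k < K, ResidualPrecise P.realA P.realb (s k) (μ k)
          ((2 : ℝ) ^ (-t * (P.L : ℝ))) (z k)) →
        ∀ k ≤ K, l2norm (r k) ≤ C * (2 : ℝ) ^ ((1 - t) * (P.L : ℝ))) ∧
      -- the whole run is a feasible run, with almost exact Newton steps, on the single
      -- perturbed problem with objective `c + r K`
      (∃ s' : ℕ → Fin n → ℝ, s' K = s K ∧
        (∀ k ≤ K, StrictDualFeasible P.realA (P.realc + r K) (y k) (s' k) ∧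
          proximity P.realA P.realb (s' k) (μ k) < 1) ∧
        ∀ k < K, l2norm (fun j =>
          (s' (k + 1) j - s' k j - newtonDs P.realA P.realb (s' k) (μ k) j) / s' k j)
            ≤ C * (2 : ℝ) ^ (-(P.L : ℝ))) ∧
      -- the final primal-dual pair of the perturbed problem, and the rounding
      ∃ x : Fin n → ℝ, x = primalPoint P.realA P.realb (s K) (μ K) ∧
        StrictPrimalFeasible P.realA P.realb x ∧
        x ⬝ᵥ s K ≤ 2 * (n : ℝ) * P.stopTol ∧
        (∀ j, s K j < P.roundTol ↔ j ∈ partB P.realA P.realb P.realc) ∧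
        (∀ j, x j < P.roundTol ↔ j ∈ partN P.realA P.realb P.realc) ∧
        (∃! w, P.IsRounding x (s K) w) ∧
        ∀ w, P.IsRounding x (s K) w → w ∈ optimalSet P.realA P.realb P.realc := by
  set κ' := max κ 1 with hκ'
  have hκ1 : 1 ≤ κ' := le_max_right _ _
  -- `36 w = (3/4)(κ' + 2) / η` is the constant of the iteration count; `ω` makes `2^(ωL)` exceed
  -- `w` and vanishes when `κ' = 1` and `η ≥ 1/16`.
  set w := (κ' + 2) / (48 * η) with hw
  have hw0 : 0 ≤ w := by positivity
  set ω := max 0 (w - 1) with hω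
  have hω0 : 0 ≤ ω := le_max_left _ _
  have hωw : w - 1 ≤ ω := le_max_right _ _
  -- The exponents match `G^6`, `g^3`, `u` and `V` below. In the second constant `36 w` serves the
  -- iteration count and the residual case, and 300 exceeds the numerical constants `36` and
  -- `3169/12`.
  refine ⟨6 + 3 * κ' + 3 / 4 + ω, 300 + 36 * w, fun hκ hη16 => ?_, ?_⟩
  · have h1 : κ' = 1 := max_eq_right hκ
    have h2 : ω = 0 := by
      refine max_eq_left (sub_nonpos.2 ?_)
      rw [hw, h1, div_le_one (by positivity)]
      linarith
    rw [h1, h2]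
    norm_num
  intro m n P hm hA y₀ s₀ μ₀ h0 hμ₀ hμκ hδ t θ ht hθ μ hμdef z y s hit hz r hr
  subst hμdef
  obtain ⟨v, hvO, hsc⟩ := exists_strictly_complementary hA (P.dim_pos hm hA) h0 hμ₀ hδ
  have hn0 := P.dim_pos hm hA
  have hLn := P.le_length hm hA
  have hL4 : 4 ≤ P.L := by omega
  have hLr : (4 : ℝ) ≤ P.L := by exact_mod_cast hL4
  set G := (2 : ℝ) ^ P.L with hG
  have hG16 : 16 ≤ G := by
    calc (16 : ℝ) = 2 ^ 4 := by norm_num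
      _ ≤ 2 ^ P.L := pow_le_pow_right₀ (by norm_num) hL4
  have hG0 : 0 < G := by linarith
  have hrpow : ∀ i : ℕ, (2 : ℝ) ^ ((i : ℝ) * P.L) = G ^ i := fun i => by
    rw [mul_comm, Real.rpow_mul two_pos.le, Real.rpow_natCast, Real.rpow_natCast]
  have hTol : P.stopTol = 1 / G ^ 2 := by
    rw [IntLO.stopTol, neg_mul, Real.rpow_neg two_pos.le, one_div]
    exact congrArg _ (hrpow 2)
  have hround : (2 : ℝ) ^ (-(P.L : ℝ)) = 1 / G := by
    rw [Real.rpow_neg two_pos.le, Real.rpow_natCast, one_div]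
  have hfour : (2 : ℝ) ^ (-4 * (P.L : ℝ)) = 1 / G ^ 4 := by
    rw [neg_mul, Real.rpow_neg two_pos.le, one_div]
    exact congrArg _ (hrpow 4)
  set g := (2 : ℝ) ^ (κ' * (P.L : ℝ)) with hg
  have hμg : μ₀ ≤ g := hμκ.trans (Real.rpow_le_rpow_of_exponent_le one_le_two
    (mul_le_mul_of_nonneg_right (le_max_left _ _) (by linarith)))
  have hGg : G ≤ g := by
    rw [hG, ← Real.rpow_natCast]
    refine Real.rpow_le_rpow_of_exponent_le one_le_two ?_
    exact le_mul_of_one_le_left (by linarith) hκ1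
  have hg0 : 0 < g := by linarith
  set u := (2 : ℝ) ^ (3 / 4 * (P.L : ℝ)) with hu
  have hu8 : 8 ≤ u := by
    calc (8 : ℝ) = 2 ^ (3 : ℝ) := by norm_num
      _ ≤ u := Real.rpow_le_rpow_of_exponent_le one_le_two (by linarith)
  set V := (2 : ℝ) ^ (ω * (P.L : ℝ)) with hV
  have hV1 : 1 + ω ≤ V := by
    rw [hV, Real.rpow_def_of_pos two_pos]
    have h1 := Real.add_one_le_exp (Real.log 2 * (ω * (P.L : ℝ)))
    have h2 : 1 ≤ Real.log 2 * P.L := by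
      have := mul_le_mul Real.log_two_gt_d9.le hLr (by norm_num) (by positivity)
      linarith
    linarith [mul_le_mul_of_nonneg_left h2 hω0]
  set ε := (2 : ℝ) ^ (-t * (P.L : ℝ)) with hεdef
  have hε0 : 0 < ε := Real.rpow_pos_of_pos two_pos _
  have hε : ε ≤ 1 / (G ^ 6 * g ^ 3 * u * V) := by
    have h1 : G ^ 6 * g ^ 3 * u * V = 2 ^ ((6 + 3 * κ' + 3 / 4 + ω) * (P.L : ℝ)) := by
      rw [← hrpow 6, hg, ← Real.rpow_mul_natCast two_pos.le, hu, hV, ← Real.rpow_add two_pos,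
        ← Real.rpow_add two_pos, ← Real.rpow_add two_pos]
      congr 1
      push_cast
      ring
    rw [h1, one_div, ← Real.rpow_neg two_pos.le, hεdef]
    refine Real.rpow_le_rpow_of_exponent_le one_le_two ?_
    rw [neg_mul]
    exact neg_le_neg (mul_le_mul_of_nonneg_right ht (by linarith))
  have hεG : (2 : ℝ) ^ ((1 - t) * (P.L : ℝ)) = G * ε := by
    rw [hεdef, hG, ← Real.rpow_natCast, ← Real.rpow_add two_pos]
    congr 1
    ring
  obtain ⟨K, hK, hKle, hKq⟩ := exists_iteration_count hn0 hL4 hη hη' hθ hκ1 hμ₀ hμg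
  rw [← hG] at hK hKle
  obtain ⟨hqG, hqu⟩ := sqrt_mul_length_le hn0 hLn
  rw [← hG] at hqG
  set q := √(n : ℝ) * P.L with hq
  have hq0 : 0 ≤ q := by positivity
  have hKw : (K : ℝ) ≤ 36 * w * q := by
    refine hKq.trans (le_of_eq ?_)
    rw [hw]
    field_simp
    ring
  obtain ⟨hRG, hKR, hR4, hE, hρ4, hρG, hΓR⟩ := precision_arith hG16 hGg hu8 (by linarith)
    (by linarith) hq0 hqG hqu hε0.le hε hKw rfl rfl
  set Γ := G * g / 4 with hΓ
  set R := 9 / 2 * q / (G ^ 4 * g * u) with hR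
  have hR0 : 0 ≤ R := by positivity
  have hΓ0 : 0 < Γ := by positivity
  have hGΓ : G ≤ Γ := by
    have := mul_le_mul_of_nonneg_left (hG16.trans hGg) hG0.le
    linarith
  set D := ε * (Γ ^ 2 + G / 8) with hD
  have hD0 : 0 ≤ D := by positivity
  set E := ε * Γ * (2 * G ^ 2 + G / 8) with hEdef
  have hE1 : E ≤ 1 / 100 := hE.trans (one_div_le_one_div_of_le (by norm_num) (by linarith))
  have hθ8 : θ ≤ 1 / 8 := by
    rw [hθ]
    exact (div_le_self hη.le (Real.one_le_sqrt.2 (by exact_mod_cast hn0))).trans hη'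
  have hμpos : ∀ k, 0 < barrier μ₀ θ k := fun k => mul_pos (pow_pos (by linarith) _) hμ₀
  have hinv := IntLO.run_invariants hm hA hvO h0 hμ₀ hδ hη hη' hθ hGg hμg hΓ hε0.le hit hK
    (fun k hk => hz k (by rw [hTol]; exact hK k hk)) hr hRG hKR hE1
  have hinc : ∀ k < K, l2norm (r (k + 1) - r k) ≤ D := fun k hk => ((hinv k hk.le).2.2.2.2.2 hk).1
  have hrR : ∀ k ≤ K, l2norm (r k) ≤ R := fun k hk =>
    (hinv k hk).2.2.1.trans ((mul_le_mul_of_nonneg_right (by exact_mod_cast hk) hD0).trans hKR)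
  have hr0 : r 0 = 0 := by
    have h1 : (y 0, s 0) = (y₀, s₀) := hit 0
    rw [hr, h1, perturbation]
    simp only [h0.1, sub_self]
  have hfeas : ∀ k, P.realAᵀ *ᵥ y k + s k = P.realc + r k := fun k => by
    rw [hr, perturbation]; abel
  have hdiv : ∀ k < K, ∀ a : Fin n → ℝ, l2norm a ≤ R →
      l2norm (fun j => a j / s k j) ≤ 2 * Γ * G ^ 2 * R := by
    intro k hk a ha
    obtain ⟨⟨-, hs⟩, -, -, -, hlow, -⟩ := hinv k hk.le
    refine (l2norm_div_le (hμpos k) hs hlow _).trans ?_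
    refine mul_le_mul ?_ ha (l2norm_nonneg _) (by positivity)
    have := hK k hk
    rw [div_lt_iff₀ (by positivity)] at this
    rw [div_le_iff₀ (hμpos k)]
    linarith [mul_le_mul_of_nonneg_left this.le hΓ0.le]
  have hshift : ∀ k < K, l2norm (fun j => (r K - r k) j / s k j) ≤ 2 * Γ * G ^ 2 * R := by
    intro k hk
    refine hdiv k hk _ ?_
    have h1 := l2norm_telescope_le hinc k (K - k) (by omega)
    rw [Nat.add_sub_cancel' hk.le] at h1
    exact h1.trans ((mul_le_mul_of_nonneg_right (by exact_mod_cast Nat.sub_le K k) hD0).trans hKR)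
  -- Shifting the slack by `r K - r k` exchanges the current perturbation for the final one and
  -- leaves `y k` unchanged.
  refine ⟨K, fun k hk => hTol ▸ hK k hk, hTol ▸ hKle, ?_, fun k hk => ⟨(hinv k hk).1,
    (hinv k hk).2.1, ?_⟩, fun hres k hk => ?_, ⟨fun k => s k + (r K - r k), ?_, fun k hk => ?_,
    fun k hk => ?_⟩, ?_⟩
  · rw [mul_assoc, ← hq]
    exact hKw.trans (mul_le_mul_of_nonneg_right (by linarith) hq0)
  · rw [hfour, mul_one_div]
    exact (hrR k hk).trans (hR4.trans (div_le_div_of_nonneg_right (by linarith) (by positivity)))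
  · have h1 : ∀ i < K, l2norm (r (i + 1) - r i) ≤ ε := fun i hi => by
      have h2 := (l2norm_inl_le _).trans (hres i hi)
      have hsi : s i = (iterates y₀ s₀ z i).2 := by rw [← hit i]
      rw [hr, hr, hit, hit, iterate_increment, ← hsi]
      simpa [newtonRhs] using h2
    have h3 := l2norm_telescope_le h1 0 k (by omega)
    rw [zero_add, hr0, sub_zero] at h3
    rw [hεG]
    calc l2norm (r k) ≤ K * ε :=
          h3.trans (mul_le_mul_of_nonneg_right (by exact_mod_cast hk) hε0.le)
      _ ≤ 36 * w * G * ε := by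
          refine mul_le_mul_of_nonneg_right (hKw.trans ?_) hε0.le
          exact mul_le_mul_of_nonneg_left (by linarith) (by positivity)
      _ ≤ (300 + 36 * w) * (G * ε) := by
          rw [mul_assoc]
          exact mul_le_mul_of_nonneg_right (by linarith) (by positivity)
  · simp
  · obtain ⟨⟨-, hs⟩, hprox, -⟩ := hinv k hk
    have h1 : P.realAᵀ *ᵥ y k + (s k + (r K - r k)) = P.realc + r K := by
      rw [← add_assoc, hfeas]; abel
    rcases hk.lt_or_eq with hk | rfl
    · refine ⟨⟨h1, fun j => ?_⟩, proximity_shifted_lt hA hs (hμpos k) hprox (hshift k hk) hρ4⟩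
      have h2 := shifted_pos hs (hshift k hk) hρ4 j
      have h3 := hs j
      change 0 < s k j + (r K - r k) j
      linarith
    -- At `k = K` the shift is zero; the general estimate would need `μ k` above the tolerance.
    · refine ⟨⟨h1, fun j => ?_⟩, ?_⟩
      · simpa using hs j
      · simpa using hprox.trans (by norm_num)
  · obtain ⟨⟨-, hs⟩, hprox, -, -, -, hstep⟩ := hinv k hk.le
    obtain ⟨hd, e, he, hse⟩ := hstep hk
    have h1 : l2norm (fun j => ((r K - r (k + 1)) j - (r K - r k) j) / s k j) ≤
        2 * Γ * G ^ 2 * R := by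
      have e1 : (fun j => ((r K - r (k + 1)) j - (r K - r k) j) / s k j) =
          -fun j => (r (k + 1) - r k) j / s k j := by
        funext j
        simp only [Pi.sub_apply, Pi.neg_apply]
        ring
      rw [e1, l2norm_neg]
      refine hdiv k hk _ (hd.trans (le_trans ?_ hKR))
      exact le_mul_of_one_le_left hD0 (by exact_mod_cast (by omega : 1 ≤ K))
    refine (shifted_step_error_le hA hs (hμpos k) hprox (hshift k hk) hρ4 h1 he hse).trans ?_
    rw [hround]
    calc 4 / 3 * (E + 11 * (2 * Γ * G ^ 2 * R)) ≤ 4 / 3 * (1 / (16 * G) + 11 * (18 / G)) := by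
          linarith
      _ = 3169 / 12 * (1 / G) := by field_simp; norm_num
      _ ≤ _ := mul_le_mul_of_nonneg_right (by linarith) (by positivity)
  · obtain ⟨hfeasK, hprox, -, hb, -⟩ := hinv K le_rfl
    refine ⟨_, rfl, ⟨mulVec_primalPoint hA hfeasK.2 (hμpos K),
      primalPoint_pos hfeasK.2 (hμpos K) hprox⟩, ?_, ?_⟩
    · refine (primalPoint_dotProduct_le hfeasK.2 (hμpos K) hprox).trans ?_
      rw [hTol]
      exact mul_le_mul (by linarith [n.cast_nonneg (α := ℝ)]) hKle (hμpos K).le (by positivity)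
    · obtain ⟨R', hrR', hΓR'⟩ : ∃ R', l2norm (r K) ≤ R' ∧ Γ * R' ≤ 1 / 20 * barrier μ₀ θ K := by
        rcases Nat.eq_zero_or_pos K with h1 | h1
        · refine ⟨0, by rw [h1, hr0, l2norm_zero], ?_⟩
          rw [mul_zero]
          exact mul_nonneg (by norm_num) (hμpos K).le
        · refine ⟨R, hrR K le_rfl, hΓR.trans ?_⟩
          obtain ⟨k, rfl⟩ := Nat.exists_eq_succ_of_ne_zero h1.ne'
          have h2 := hK k (Nat.lt_succ_self k)
          have h3 : barrier μ₀ θ (k + 1) = (1 - θ) * barrier μ₀ θ k := by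
            simp only [barrier]; ring
          rw [Nat.succ_eq_add_one, h3]
          linarith [mul_le_mul_of_nonneg_right hθ8 (hμpos k).le]
      exact IntLO.rounding_spec hm hA hvO hsc h0 hfeasK (hμpos K) hprox (hTol ▸ hKle)
        (fun j => (abs_le_l2norm _ j).trans hrR') rfl (fun j => (hb j).1) hGΓ hΓR'
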